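/- Fix integers $K\ge 2$, $L\ge 3$ and $\epsilon\in(0,1)$. \emph{The exact kernel.} For integers $n\ge1$, $m\ge 0$ consider bipartite multigraphs on the v-nodes $[n]$ and the c-nodes $[m]$ in which every v-node carries an ordered list of (not necessarily distinct) c-nodes, the ends of its edges, of length $0$ or in $\{3,\dots,L\}$. For $\vec z=(\vec\omega,\vec\tau)=(\omega_1,\dots,\omega_K,\tau_3,\dots,\tau_L)$ let $\mathcal G(\vec z)$ be the set of those graphs in which exactly $\omega_i$ c-nodes have degree $i$ for $1\le i\le K-1$, exactly $\omega_K$ c-nodes have degree at least $K$, and exactly $\tau_j$ v-nodes have degree $j$ for $3\le j\le L$ (degrees are counted with multiplicity). One step of the peeling process chooses uniformly at random a c-node of degree $1$ and deletes all edges of the unique v-node adjacent to it; if there is no c-node of degree $1$ the graph is left unchanged. Let $W_n(\Delta\vec z\,|\,\vec z)$ be the probability that one step of the peeling process, started from a uniformly random element of $\mathcal G(\vec z)$, changes the degree counts $\vec z$ by $\Delta\vec z\in\mathbb Z^{K+L-2}$. \emph{The asymptotic kernel.} For $\vec v=(v_3,\dots,v_L)$ put $d(\vec v)=\sum_{j=3}^L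 j v_j$, let $e_k(t)=\sum_{i\ge k}t^i/i!$, and let $$\mathsf H(\epsilon)=\Big\{\vec x=(x_1,\dots,x_K,v_3,\dots,v_L)\in\mathbb R_{\ge0}^{K}\times\mathbb R_{\ge0}^{L-2}:\ x_K\ge\epsilon,\ \sum_{j=3}^L v_j\le 1,\ d(\vec v)-\sum_{i=1}^K i x_i\ge\epsilon\Big\}.$$ For $\vec x\in\mathsf H(\epsilon)$ let $\lambda=\lambda(\vec x)$ be the positive solution of $$\frac{\lambda e_{K-1}(\lambda)}{e_K(\lambda)}=\frac{d(\vec v)-\sum_{i=1}^{K-1}i x_i}{x_K},$$ and put $$\mathfrak p_i=\frac{(i+1)x_{i+1}}{d(\vec v)}\ (0\le i\le K-2),\qquad \mathfrak p_{K-1}=\frac{x_K\lambda^K}{(K-1)!\,e_K(\lambda)\,d(\vec v)},\qquad \mathfrak p_K=\frac{x_K\lambda}{d(\vec v)}.$$ For $\Delta\vec z=(\Delta\vec\omega,\Delta\vec\tau)\in\mathbb Z^{K+L-2}$ set $W(\Delta\vec z\,|\,\vec x)=0$ unless there is an $\ell\in\{3,\dots,L\}$ with $\Delta\tau_i=-\mathbf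 1_{i=\ell}$ for all $i$ and the integers $q_i=-\sum_{j=i+1}^K\Delta\omega_j$ ($0\le i\le K-1$) and $q_K=\ell+\sum_{i=1}^K i\,\Delta\omega_i$ satisfy $q_0\ge1$ and $q_1,\dots,q_K\ge0$; in that case $$W(\Delta\vec z\,|\,\vec x)=\frac{\ell v_\ell}{d(\vec v)}\binom{\ell-1}{q_0-1,q_1,\dots,q_K}\mathfrak p_0^{q_0-1}\mathfrak p_1^{q_1}\cdots\mathfrak p_K^{q_K}.$$ \emph{Claim.} For every $\vec x\in\mathsf H(\epsilon)$ the equation for $\lambda$ has exactly one positive solution and $W(\cdot\,|\,\vec x)$ is a probability distribution on $\mathbb Z^{K+L-2}$. Moreover there is a positive constant $\mathsf k_2=\mathsf k_2(L,K,\epsilon)$ such that for all $n\ge1$, all $\vec z\in\mathbb Z^{K+L-2}$ with $n^{-1}\vec z\in\mathsf H(\epsilon)$ and $\omega_i\ge1$ for $1\le i\le K$, and all $m\ge\sum_{i=1}^K\omega_i$, $$\big\|W_n(\cdot\,|\,\vec z)-W(\cdot\,|\,n^{-1}\vec z)\big\|_{\mathrm{TV}}\le \mathsf k_2\,n^{-1}.$$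 -/

import Mathlib

namespace Peeling

/-- Vectors `(u, v) = (u_1, …, u_K, v_3, …, v_L)` with entries in `R`. -/
abbrev State (K L : ℕ) (R : Type) : Type := (Finset.Icc 1 K → R) × (Finset.Icc 3 L → R)

/-! ### The configurational model and the peeling algorithm -/

/-- A bipartite multigraph on v-nodes `Fin n` and c-nodes `Fin m`, v-nodes having degree at most `L`:
every v-node carries the ordered list of the (not necessarily distinct) c-nodes at the ends of its
edges. -/
abbrev Graph (L n m : ℕ) : Type := Fin n → Σ j : Fin (L + 1), (Fin (j : ℕ) → Fin m)

/-- Degree of a v-node. -/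
def vDeg {L n m : ℕ} (G : Graph L n m) (α : Fin n) : ℕ := (G α).1

/-- Degree of a c-node, counted with multiplicity. -/
def cDeg {L n m : ℕ} (G : Graph L n m) (a : Fin m) : ℕ :=
  ∑ α : Fin n, (Finset.univ.filter fun s => (G α).2 s = a).card

/-- The degree counts `(ω, τ)` of a graph: `ω_i` is the number of c-nodes of degree exactly `i` for
`1 ≤ i < K`, `ω_K` is the number of c-nodes of degree at least `K`, and `τ_j` is the number of
v-nodes of degree `j`. -/
def degreeCounts (K : ℕ) {L n m : ℕ} (G : Graph L n m) : State K L ℤ :=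
  (fun i => ((Finset.univ.filter fun a : Fin m =>
      if (i : ℕ) < K then cDeg G a = (i : ℕ) else K ≤ cDeg G a).card : ℤ),
   fun j => ((Finset.univ.filter fun α : Fin n => vDeg G α = (j : ℕ)).card : ℤ))

/-- The ensemble `𝒢(z)`: every v-node has degree `0` or a degree in `{3, …, L}`, and the degree
counts are `z`. -/
def ensemble {K L : ℕ} (n m : ℕ) (z : State K L ℤ) : Finset (Graph L n m) :=
  Finset.univ.filter fun G => (∀ α, vDeg G α = 0 ∨ 3 ≤ vDeg G α) ∧ degreeCounts K G = z

/-- The c-nodes of degree one. -/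
def leaves {L n m : ℕ} (G : Graph L n m) : Finset (Fin m) :=
  Finset.univ.filter fun a => cDeg G a = 1

/-- Delete all edges of the v-nodes adjacent to the c-node `a`
(there is exactly one such v-node if `a` has degree one). -/
def peel {L n m : ℕ} (G : Graph L n m) (a : Fin m) : Graph L n m :=
  fun α => if ∃ s, (G α).2 s = a then ⟨0, Fin.elim0⟩ else G α

/-- Transition probabilities of the graph-valued peeling process: a c-node of degree one is chosen
uniformly at random and peeled; the graph stays put if there is none. -/
noncomputable def graphKernel {L n m : ℕ} (G G' : Graph L n m) : ℝ :=
  if leaves G = ∅ then (if G' = G then 1 else 0)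
  else (((leaves G).filter fun a => peel G a = G').card : ℝ) / ((leaves G).card : ℝ)

/-- The exact kernel `W_n(Δz | z)` of the degree counts: the probability that one step of the peeling
process, started from a uniformly random graph in `𝒢(z)`, changes the degree counts by `Δz`. -/
noncomputable def exactKernel {K L : ℕ} (n m : ℕ) (z Δz : State K L ℤ) : ℝ :=
  (∑ G ∈ ensemble n m z,
      ∑ G' ∈ Finset.univ.filter (fun G' : Graph L n m => degreeCounts K G' = z + Δz),
        graphKernel G G') / ((ensemble n m z).card : ℝ)

/-! ### The asymptotic kernel -/

/-- The coordinate `u_i` of `u = (u_1, …, u_K)`, read as `0` outside `1 ≤ i ≤ K`. -/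
def coord {K : ℕ} (u : Finset.Icc 1 K → ℝ) (i : ℕ) : ℝ :=
  if h : i ∈ Finset.Icc 1 K then u ⟨i, h⟩ else 0

/-- `d(v) = ∑_{j=3}^L j v_j`. -/
def totalDeg {L : ℕ} (v : Finset.Icc 3 L → ℝ) : ℝ := ∑ j : Finset.Icc 3 L, ((j : ℕ) : ℝ) * v j

/-- The domain `H(ε)`. -/
def domainH (K L : ℕ) (ε : ℝ) : Set (State K L ℝ) :=
  {x | (∀ i, 0 ≤ x.1 i) ∧ (∀ j, 0 ≤ x.2 j) ∧ ε ≤ coord x.1 K ∧ ∑ j, x.2 j ≤ 1 ∧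
    ε ≤ totalDeg x.2 - ∑ i : Finset.Icc 1 K, ((i : ℕ) : ℝ) * x.1 i}

/-- `e_k(t) = ∑_{i ≥ k} t^i / i!`. -/
noncomputable def expTail (k : ℕ) (t : ℝ) : ℝ := ∑' i : ℕ, t ^ (i + k) / ((i + k).factorial : ℝ)

/-- `l` is a positive solution of
`l e_{K-1}(l) / e_K(l) = (d(v) - ∑_{i=1}^{K-1} i x_i) / x_K`. -/
def IsLambda {K L : ℕ} (x : State K L ℝ) (l : ℝ) : Prop :=
  0 < l ∧ l * expTail (K - 1) l / expTail K l =
    (totalDeg x.2 - ∑ i ∈ Finset.Ico 1 K, (i : ℝ) * coord x.1 i) / coord x.1 K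

/-- The solution `λ = λ(x)`. -/
noncomputable def lam {K L : ℕ} (x : State K L ℝ) : ℝ := Classical.epsilon (IsLambda x)

/-- The probabilities `𝔭_0, …, 𝔭_K`. -/
noncomputable def pp {K L : ℕ} (x : State K L ℝ) (i : ℕ) : ℝ :=
  if i + 1 < K then ((i : ℝ) + 1) * coord x.1 (i + 1) / totalDeg x.2
  else if i + 1 = K then
    coord x.1 K * lam x ^ K / (((K - 1).factorial : ℝ) * expTail K (lam x) * totalDeg x.2)
  else coord x.1 K * lam x / totalDeg x.2

/-- `q_i = -∑_{j=i+1}^K Δω_j` for `i < K`, and `q_K = ℓ + ∑_{i=1}^K i Δω_i`. -/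
def qq {K : ℕ} (ℓ : ℕ) (Δω : Finset.Icc 1 K → ℤ) (i : ℕ) : ℤ :=
  if i < K then -∑ j ∈ Finset.univ.filter (fun j : Finset.Icc 1 K => i < (j : ℕ)), Δω j
  else (ℓ : ℤ) + ∑ j : Finset.Icc 1 K, ((j : ℕ) : ℤ) * Δω j

/-- The exponents `(q_0 - 1, q_1, …, q_K)`. -/
def expo {K : ℕ} (ℓ : ℕ) (Δω : Finset.Icc 1 K → ℤ) (i : ℕ) : ℕ :=
  if i = 0 then (qq ℓ Δω 0 - 1).toNat else (qq ℓ Δω i).toNat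

/-- The asymptotic kernel `W(Δz | x)`. At most one `ℓ` satisfies `Δτ_i = -1_{i=ℓ}` for all `i`, so
at most one term of the sum is nonzero. -/
noncomputable def asymKernel {K L : ℕ} (x : State K L ℝ) (Δz : State K L ℤ) : ℝ :=
  ∑ ℓ : Finset.Icc 3 L,
    if (∀ i, Δz.2 i = if i = ℓ then -1 else 0) ∧ 1 ≤ qq (ℓ : ℕ) Δz.1 0 ∧
        (∀ i ∈ Finset.Icc 1 K, 0 ≤ qq (ℓ : ℕ) Δz.1 i) then
      ((ℓ : ℕ) : ℝ) * x.2 ℓ / totalDeg x.2 *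
        (Nat.multinomial (Finset.range (K + 1)) (expo (ℓ : ℕ) Δz.1) : ℝ) *
        ∏ i ∈ Finset.range (K + 1), pp x i ^ expo (ℓ : ℕ) Δz.1 i
    else 0

/-- The rescaled state `n⁻¹ z`. -/
noncomputable def rescale {K L : ℕ} (n : ℕ) (z : State K L ℤ) : State K L ℝ :=
  (fun i => (z.1 i : ℝ) / n, fun j => (z.2 j : ℝ) / n)

/-- Total variation distance of two probability mass functions. -/
noncomputable def tvDist {S : Type} (f g : S → ℝ) : ENNReal :=
  2⁻¹ * ∑' s, ENNReal.ofReal |f s - g s|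

end Peeling

set_option linter.unusedSectionVars false

open Finset Filter Topology

namespace Peeling

/-! Fix the v-degrees. A graph is then a map from the `E = n d(v)` edge slots to the c-nodes,
uniform among the maps with the prescribed truncated degree counts. Give every slot a type: the
degree, truncated at `K`, that its c-node keeps when this slot is removed. Choosing a leaf means
choosing a slot of type `0`. If the edges at its v-node lead to distinct c-nodes, the change of the
degree counts is a function of the types at that v-node (`degreeCounts_peel_sub`), and the
asymptotic kernel is the image under this function of independent types of law `𝔭`, mixed over a
size-biased v-degree (`sum_types_eq_kernelTerm`). So the types of boundedly many slots, one of them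
a leaf, have to be shown independent of law `𝔭` up to a relative error `O(1/n)`.

Slots are exchangeable, so up to `O(1/E)` for repeated slots the joint law of the types is an
average of products of type frequencies. All type counts are deterministic except the two largest
types, and both are driven by the number `T` of c-nodes of degree exactly `K`. If `K T` has the
predicted mean up to `O(1)` and mean square deviation `O(E)`, a first order expansion of the product
gives an error `O(1/E)` (`abs_sum_prod_slotCount_sub_le`).

By the exponential formula (`sum_prod_deg`) the moments of `T` are expressed by coefficients of
`(∑_{k ≥ K} X^k / k!)^N`, where `N = ω_K` and `M` is the total degree of the heavy c-nodes. The mean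
of `K T` is `M - N ρ` with `ρ` a ratio of consecutive coefficients, so the crux is `N |ρ - λ| =
O(1)` (`ratio_sub_lambda`). No local limit theorem is used. Let `μ` be the analogous ratio with one
factor less. Log-concavity of the coefficients gives `ρ ≤ μ` and compares the law of one degree with
a truncated Poisson law of parameter `μ`, whence `λ ≤ μ`. Nonnegativity of the variance of `T` gives
`(N - 1) μ ≤ N ρ`. A quantitative monotonicity of the truncated Poisson mean (`meanTP_sub_ge`) then
bounds `N (μ - λ)`.

Double edges are controlled by the second factorial moment of the degrees (`card_collision_le`).
Every error carries a factor `ω_1 / E`, so the choice of one leaf among `ω_1` costs nothing, however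
small `ω_1 ≥ 1` is. On `H(ε)` one has `M / N ≤ L / ε` and `E ≥ n ε`, which makes all constants
uniform. The parameter `λ` exists and is unique because the truncated Poisson mean is continuous,
strictly increasing and lies between `t` and `t + K`, while the prescribed mean exceeds `K`. -/

/-! ### Truncated Poisson laws -/

/-- A weighted Chebyshev inequality for a pair of weights with monotone likelihood ratio, with the
contribution of one pair of indices kept. -/
lemma sum_mul_sum_sub_ge (I : Finset ℕ) (c : ℝ) (u w : ℕ → ℝ)
    (h : ∀ j k, j ≤ k → w k * u j ≤ w j * u k) (h0 : 0 ∈ I) (h1 : 1 ∈ I) :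
    u 1 * w 0 - w 1 * u 0 ≤
      (∑ k ∈ I, ((k : ℝ) + c) * u k) * (∑ k ∈ I, w k) -
        (∑ k ∈ I, ((k : ℝ) + c) * w k) * (∑ k ∈ I, u k) := by
  set s : ℕ × ℕ → ℝ := fun x => ((x.1 : ℝ) - x.2) * (u x.1 * w x.2 - w x.1 * u x.2) with hs
  have key : 2 * ((∑ k ∈ I, ((k : ℝ) + c) * u k) * (∑ k ∈ I, w k) -
        (∑ k ∈ I, ((k : ℝ) + c) * w k) * (∑ k ∈ I, u k)) = ∑ x ∈ I ×ˢ I, s x := by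
    have e1 : ∑ x ∈ I ×ˢ I, s x =
        ∑ x ∈ I ×ˢ I, ((((x.1 : ℝ) + c) * u x.1 * w x.2 - ((x.1 : ℝ) + c) * w x.1 * u x.2)) +
        ∑ x ∈ I ×ˢ I, ((w x.1 * (((x.2 : ℝ) + c) * u x.2) -
          u x.1 * (((x.2 : ℝ) + c) * w x.2))) := by
      rw [← Finset.sum_add_distrib]
      exact Finset.sum_congr rfl fun x _ => by simp only [hs]; ring
    rw [e1]
    simp only [Finset.sum_sub_distrib, Finset.sum_product, ← Finset.mul_sum, ← Finset.sum_mul]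
    ring
  have hnn : ∀ x ∈ I ×ˢ I, 0 ≤ s x := by
    rintro ⟨k, j⟩ -
    rcases le_total j k with hjk | hjk
    · exact mul_nonneg (by simpa using hjk) (by simp only; linarith [h j k hjk, mul_comm (w j) (u k)])
    · exact mul_nonneg_of_nonpos_of_nonpos (by simpa using hjk)
        (by simp only; linarith [h k j hjk, mul_comm (w j) (u k)])
  -- Keeping the terms of these two pairs, instead of discarding all of them, makes the inequality
  -- strict and quantitative.
  have hsub : ({(1, 0), (0, 1)} : Finset (ℕ × ℕ)) ⊆ I ×ˢ I := by
    intro x hx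
    simp only [Finset.mem_insert, Finset.mem_singleton] at hx
    rcases hx with rfl | rfl <;> simp [h0, h1]
  have := Finset.sum_le_sum_of_subset_of_nonneg hsub (fun x hx _ => hnn x hx)
  rw [Finset.sum_pair (by simp)] at this
  have e2 : s (1, 0) + s (0, 1) = 2 * (u 1 * w 0 - w 1 * u 0) := by
    simp only [hs]; push_cast; ring
  linarith

lemma hasSum_mul_sub_ge {c U W U' W' : ℝ} {u w : ℕ → ℝ}
    (h : ∀ j k, j ≤ k → w k * u j ≤ w j * u k) (hU : HasSum u U) (hW : HasSum w W)
    (hU' : HasSum (fun k : ℕ => ((k : ℝ) + c) * u k) U')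
    (hW' : HasSum (fun k : ℕ => ((k : ℝ) + c) * w k) W') :
    u 1 * w 0 - w 1 * u 0 ≤ U' * W - W' * U := by
  refine ge_of_tendsto ((hU'.tendsto_sum_nat.mul hW.tendsto_sum_nat).sub
    (hW'.tendsto_sum_nat.mul hU.tendsto_sum_nat)) ?_
  filter_upwards [eventually_ge_atTop 2] with R hR
  exact sum_mul_sum_sub_ge _ c u w h (by simp; omega) (by simp; omega)

lemma hasSum_expTail (K : ℕ) (t : ℝ) :
    HasSum (fun i : ℕ => t ^ (i + K) / ((i + K).factorial : ℝ)) (expTail K t) :=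
  ((summable_nat_add_iff K).2 (Real.summable_pow_div_factorial t)).hasSum

lemma expTail_eq (K : ℕ) (t : ℝ) :
    expTail K t = Real.exp t - ∑ i ∈ range K, t ^ i / (i.factorial : ℝ) := by
  have h := (Real.summable_pow_div_factorial t).sum_add_tsum_nat_add K
  have h2 : ∑' n : ℕ, t ^ n / (n.factorial : ℝ) = Real.exp t := by
    rw [Real.exp_eq_exp_ℝ]; exact (NormedSpace.expSeries_div_hasSum_exp t).tsum_eq
  rw [h2] at h
  unfold expTail
  linarith

lemma continuous_expTail (K : ℕ) : Continuous (expTail K) := by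
  rw [show expTail K = fun t => Real.exp t - ∑ i ∈ range K, t ^ i / (i.factorial : ℝ) from
    funext (expTail_eq K)]
  fun_prop

lemma expTail_pred {K : ℕ} (hK : 1 ≤ K) (t : ℝ) :
    expTail (K - 1) t = t ^ (K - 1) / ((K - 1).factorial : ℝ) + expTail K t := by
  obtain ⟨k, rfl⟩ := Nat.exists_eq_add_of_le' hK
  simp only [Nat.add_sub_cancel, expTail_eq, Finset.sum_range_succ]
  ring

lemma le_expTail (K : ℕ) {t : ℝ} (ht : 0 ≤ t) : t ^ K / (K.factorial : ℝ) ≤ expTail K t := by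
  have := (hasSum_expTail K t).summable.le_tsum 0 (fun j _ => by positivity)
  simpa [expTail] using this

lemma expTail_pos (K : ℕ) {t : ℝ} (ht : 0 < t) : 0 < expTail K t :=
  lt_of_lt_of_le (by positivity) (le_expTail K ht.le)

lemma expTail_le (K : ℕ) {t : ℝ} (ht : 0 ≤ t) :
    expTail K t ≤ t ^ K / (K.factorial : ℝ) * Real.exp t := by
  have h2 : HasSum (fun n : ℕ => t ^ n / (n.factorial : ℝ)) (Real.exp t) := by
    rw [Real.exp_eq_exp_ℝ]; exact NormedSpace.expSeries_div_hasSum_exp t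
  refine hasSum_le (fun i => ?_) (hasSum_expTail K t) (h2.mul_left _)
  rw [div_mul_div_comm, pow_add, mul_comm (t ^ i)]
  have : (K.factorial : ℝ) * i.factorial ≤ (i + K).factorial := by
    have := Nat.le_of_dvd (Nat.factorial_pos _) (Nat.factorial_mul_factorial_dvd_factorial_add K i)
    rw [add_comm K i] at this
    exact_mod_cast this
  gcongr

/-- The probability that a Poisson variable of parameter `t`, conditioned to be at least `K`,
equals `K`. -/
noncomputable def atomTP (K : ℕ) (t : ℝ) : ℝ := t ^ K / (K.factorial : ℝ) / expTail K t

/-- The mean of a Poisson variable of parameter `t` conditioned to be at least `K`. -/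
noncomputable def meanTP (K : ℕ) (t : ℝ) : ℝ := t * expTail (K - 1) t / expTail K t

/-- The truncation moves the mean away from the parameter only through the atom at `K`, since
`e_{K-1}` and `e_K` differ by a single term. -/
lemma meanTP_eq {K : ℕ} (hK : 1 ≤ K) {t : ℝ} (ht : 0 < t) :
    meanTP K t = t + K * atomTP K t := by
  have h := expTail_pos K ht
  unfold meanTP atomTP
  rw [expTail_pred hK]
  obtain ⟨k, rfl⟩ := Nat.exists_eq_add_of_le' hK
  have : ((k.factorial : ℕ) : ℝ) ≠ 0 := by positivity
  simp only [Nat.add_sub_cancel, Nat.factorial_succ, Nat.cast_mul]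
  field_simp
  ring

lemma atomTP_pos (K : ℕ) {t : ℝ} (ht : 0 < t) : 0 < atomTP K t := by
  have h := expTail_pos K ht
  unfold atomTP
  positivity

lemma atomTP_le_one (K : ℕ) {t : ℝ} (ht : 0 < t) : atomTP K t ≤ 1 :=
  (div_le_one (expTail_pos K ht)).2 (le_expTail K ht.le)

lemma exp_neg_le_atomTP (K : ℕ) {t : ℝ} (ht : 0 < t) : Real.exp (-t) ≤ atomTP K t := by
  unfold atomTP
  rw [le_div_iff₀ (expTail_pos K ht), Real.exp_neg, inv_mul_le_iff₀ (Real.exp_pos _), mul_comm]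
  exact expTail_le K ht.le

lemma hasSum_mul_expTail {K : ℕ} (hK : 1 ≤ K) (t : ℝ) :
    HasSum (fun i : ℕ => ((i : ℝ) + K) * (t ^ (i + K) / ((i + K).factorial : ℝ)))
      (t * expTail (K - 1) t) := by
  obtain ⟨k, rfl⟩ := Nat.exists_eq_add_of_le' hK
  simp only [Nat.add_sub_cancel]
  refine ((hasSum_expTail k t).mul_left t).congr_fun fun i => ?_
  rw [← add_assoc, Nat.factorial_succ]
  push_cast
  have : (i : ℝ) + (k + 1) ≠ 0 := by positivity
  field_simp
  ring

/-- Poisson weights have monotone likelihood ratio in the parameter. The pair of values `K`, `K + 1`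
alone contributes the product of the two atoms times `(t - s) / (K + 1)`, and an atom is at least
`exp (-t)`. This bounds differences of parameters by differences of means in `ratio_sub_lambda`. -/
lemma meanTP_sub_ge {K : ℕ} (hK : 1 ≤ K) {s t : ℝ} (hs : 0 < s) (hst : s ≤ t) :
    Real.exp (-(s + t)) * (t - s) / (K + 1) ≤ meanTP K t - meanTP K s := by
  have ht := hs.trans_le hst
  have hps := expTail_pos K hs
  have hpt := expTail_pos K ht
  have h := hasSum_mul_sub_ge (c := K) (u := fun i => t ^ (i + K) / ((i + K).factorial : ℝ))
    (w := fun i => s ^ (i + K) / ((i + K).factorial : ℝ)) (fun j k hjk => by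
      rw [div_mul_div_comm, div_mul_div_comm, mul_comm ((k + K).factorial : ℝ)]
      have : s ^ (k + K) * t ^ (j + K) ≤ s ^ (j + K) * t ^ (k + K) := by
        obtain ⟨d, rfl⟩ := Nat.exists_eq_add_of_le hjk
        have : s ^ d ≤ t ^ d := by gcongr
        calc s ^ (j + d + K) * t ^ (j + K) = s ^ (j + K) * t ^ (j + K) * s ^ d := by ring
          _ ≤ s ^ (j + K) * t ^ (j + K) * t ^ d := by gcongr
          _ = _ := by ring
      gcongr) (hasSum_expTail K t) (hasSum_expTail K s) (hasSum_mul_expTail hK t)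
    (hasSum_mul_expTail hK s)
  have e1 : meanTP K t - meanTP K s =
      (t * expTail (K - 1) t * expTail K s - s * expTail (K - 1) s * expTail K t) /
        (expTail K t * expTail K s) := by
    unfold meanTP; field_simp
  have e2 : (t ^ (1 + K) / ((1 + K).factorial : ℝ)) * (s ^ (0 + K) / ((0 + K).factorial : ℝ)) -
      (s ^ (1 + K) / ((1 + K).factorial : ℝ)) * (t ^ (0 + K) / ((0 + K).factorial : ℝ)) =
      atomTP K s * atomTP K t * (t - s) / (K + 1) * (expTail K t * expTail K s) := by
    unfold atomTP
    rw [add_comm 1 K, Nat.factorial_succ, zero_add]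
    push_cast
    field_simp
    ring
  rw [e1, le_div_iff₀ (by positivity)]
  refine le_trans ?_ h
  rw [e2]
  have : Real.exp (-(s + t)) ≤ atomTP K s * atomTP K t := by
    rw [neg_add, Real.exp_add]
    exact mul_le_mul (exp_neg_le_atomTP K hs) (exp_neg_le_atomTP K ht) (Real.exp_pos _).le
      (atomTP_pos K hs).le
  have : 0 ≤ t - s := sub_nonneg.2 hst
  gcongr

lemma meanTP_strictMono {K : ℕ} (hK : 1 ≤ K) {s t : ℝ} (hs : 0 < s) (hst : s < t) :
    meanTP K s < meanTP K t := by
  have h := meanTP_sub_ge hK hs hst.le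
  have : 0 < Real.exp (-(s + t)) * (t - s) / (K + 1) := by
    have := sub_pos.2 hst
    positivity
  linarith

lemma existsUnique_meanTP {K : ℕ} (hK : 1 ≤ K) {y : ℝ} (hy : (K : ℝ) < y) :
    ∃! t : ℝ, 0 < t ∧ meanTP K t = y := by
  have h0 : 0 < y - K := sub_pos.2 hy
  have hle : y - K ≤ y := by simp
  -- The mean lies between `t` and `t + K`, so `[y - K, y]` brackets the solution; `y > K` keeps the
  -- interval in the positive axis.
  have hcont : ContinuousOn (meanTP K) (Set.Icc (y - K) y) := by
    unfold meanTP
    exact ((continuous_id.mul (continuous_expTail _)).continuousOn).div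
      (continuous_expTail _).continuousOn fun t ht => (expTail_pos K (h0.trans_le ht.1)).ne'
  obtain ⟨t, ht, hty⟩ := intermediate_value_Icc hle hcont (show y ∈ Set.Icc _ _ from by
    have hy0 : 0 < y := h0.trans_le hle
    constructor
    · rw [meanTP_eq hK h0]
      have := mul_le_mul_of_nonneg_left (atomTP_le_one K h0) (Nat.cast_nonneg (α := ℝ) K)
      linarith
    · rw [meanTP_eq hK hy0]
      have := mul_nonneg (Nat.cast_nonneg (α := ℝ) K) (atomTP_pos K hy0).le
      linarith)
  refine ⟨t, ⟨h0.trans_le ht.1, hty⟩, ?_⟩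
  rintro s ⟨hs, hsy⟩
  rcases lt_trichotomy s t with h | h | h
  · exact absurd (meanTP_strictMono hK hs h) (by rw [hsy, hty]; exact lt_irrefl _)
  · exact h
  · exact absurd (meanTP_strictMono hK (h0.trans_le ht.1) h) (by rw [hsy, hty]; exact lt_irrefl _)

section

open PowerSeries

/-! ### The exponential formula -/

/-- Number of elements of `S` mapped to `b`. -/
def deg {S B : Type*} [Fintype S] [DecidableEq B] (φ : S → B) (b : B) : ℕ :=
  (univ.filter fun s => φ s = b).card

/-- The exponential generating function of a sequence. -/
noncomputable def egf (w : ℕ → ℝ) : ℝ⟦X⟧ := PowerSeries.mk fun k => w k / (k.factorial : ℝ)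

@[simp] lemma coeff_egf (w : ℕ → ℝ) (k : ℕ) : coeff k (egf w) = w k / (k.factorial : ℝ) := by
  simp [egf]

lemma derivative_egf (w : ℕ → ℝ) : d⁄dX ℝ (egf w) = egf fun k => w (k + 1) := by
  ext k
  rw [coeff_derivative, coeff_egf, coeff_egf, Nat.factorial_succ]
  push_cast
  field_simp

lemma derivation_prod {ι : Type*} [DecidableEq ι] (s : Finset ι) (f : ι → ℝ⟦X⟧) :
    d⁄dX ℝ (∏ i ∈ s, f i) = ∑ i ∈ s, (∏ j ∈ s.erase i, f j) * d⁄dX ℝ (f i) := by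
  induction s using Finset.induction_on with
  | empty => simp
  | insert a s ha ih =>
    rw [Finset.prod_insert ha, Derivation.leibniz, ih, Finset.sum_insert ha,
      Finset.erase_insert ha, smul_eq_mul, smul_eq_mul, Finset.mul_sum, add_comm]
    congr 1
    refine Finset.sum_congr rfl fun i hi => ?_
    have hia : a ≠ i := fun h => ha (h ▸ hi)
    rw [Finset.erase_insert_of_ne hia, Finset.prod_insert (fun h => ha (Finset.mem_of_mem_erase h))]
    ring

lemma deg_comp_equiv {S S' B : Type*} [Fintype S] [Fintype S'] [DecidableEq B] (φ : S → B)
    (e : S' ≃ S) (b : B) : deg (φ ∘ e) b = deg φ b := by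
  unfold deg
  exact Finset.card_equiv e (by simp)

lemma deg_cons {B : Type*} [DecidableEq B] {n : ℕ} (b₀ : B) (ψ : Fin n → B) (b : B) :
    deg (Fin.cons b₀ ψ : Fin (n + 1) → B) b = (if b₀ = b then 1 else 0) + deg ψ b := by
  unfold deg
  rw [Finset.card_filter, Finset.card_filter, Fin.sum_univ_succ]
  simp

/-- Sending the first point to `b₀` shifts the weight sequence of `b₀` by one, which differentiates
its generating function. Summed over `b₀`, this is the Leibniz rule for the product. -/
lemma sum_prod_deg_fin {B : Type*} [Fintype B] [DecidableEq B] (n : ℕ) (w : B → ℕ → ℝ) :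
    ∑ ψ : Fin n → B, ∏ b, w b (deg ψ b) =
      (n.factorial : ℝ) * coeff n (∏ b, egf (w b)) := by
  induction n generalizing w with
  | zero =>
    simp only [Finset.univ_unique, Finset.sum_singleton]
    have : ∀ b, deg (default : Fin 0 → B) b = 0 := fun b => by simp [deg]
    simp only [this, Nat.factorial_zero, Nat.cast_one, one_mul, coeff_zero_eq_constantCoeff,
      map_prod]
    refine Finset.prod_congr rfl fun b _ => ?_
    rw [← coeff_zero_eq_constantCoeff_apply, coeff_egf]
    simp
  | succ n ih =>
    rw [← (Fin.consEquiv fun _ : Fin (n + 1) => B).sum_comp, Fintype.sum_prod_type]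
    have h1 : ∀ b₀ : B, ∑ ψ : Fin n → B, ∏ b, w b (deg (Fin.cons b₀ ψ : Fin (n + 1) → B) b) =
        (n.factorial : ℝ) * coeff n ((∏ b ∈ univ.erase b₀, egf (w b)) * d⁄dX ℝ (egf (w b₀))) := by
      intro b₀
      have := ih fun b => if b₀ = b then fun k => w b (k + 1) else w b
      rw [← Finset.prod_erase_mul univ _ (Finset.mem_univ b₀)] at this
      rw [derivative_egf]
      convert this using 4 with ψ _ b _
      · rw [deg_cons]
        split_ifs <;> simp [add_comm]
      · refine Finset.prod_congr rfl fun b hb => ?_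
        rw [if_neg (Finset.ne_of_mem_erase hb).symm]
      · simp
    refine (Finset.sum_congr rfl fun b₀ _ => h1 b₀).trans ?_
    rw [← Finset.mul_sum, ← map_sum, ← derivation_prod,
      coeff_derivative, Nat.factorial_succ]
    push_cast
    ring

/-- The exponential formula for maps with weights on the fibre sizes. -/
lemma sum_prod_deg {S B : Type*} [Fintype S] [DecidableEq S] [Fintype B] [DecidableEq B]
    (w : B → ℕ → ℝ) :
    ∑ ψ : S → B, ∏ b, w b (deg ψ b) =
      ((Fintype.card S).factorial : ℝ) * coeff (Fintype.card S) (∏ b, egf (w b)) := by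
  rw [← sum_prod_deg_fin]
  refine Fintype.sum_equiv ((Fintype.equivFin S).arrowCongr (Equiv.refl B)) _ _ fun ψ => ?_
  refine Finset.prod_congr rfl fun b _ => ?_
  rw [← deg_comp_equiv ψ (Fintype.equivFin S).symm]
  rfl

/-! ### Powers of the truncated exponential series -/

/-- The power series `∑_{k ≥ K} X^k / k!`. -/
noncomputable def tp (K : ℕ) : ℝ⟦X⟧ := egf fun k => if K ≤ k then 1 else 0

/-- The coefficient of `X^M` in `(∑_{k ≥ K} X^k / k!)^N`. -/
noncomputable def tpc (K N M : ℕ) : ℝ := coeff M (tp K ^ N)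

lemma coeff_tp_nonneg (K k : ℕ) : 0 ≤ coeff k (tp K) := by
  unfold tp
  rw [coeff_egf]
  positivity

lemma tpc_nonneg (K N M : ℕ) : 0 ≤ tpc K N M := by
  unfold tpc
  induction N generalizing M with
  | zero => rw [pow_zero, coeff_one]; positivity
  | succ N ih =>
    rw [pow_succ, coeff_mul]
    exact Finset.sum_nonneg fun x _ => mul_nonneg (ih _) (coeff_tp_nonneg _ _)

lemma tpc_succ (K N M : ℕ) :
    tpc K (N + 1) M = ∑ x ∈ antidiagonal M, coeff x.1 (tp K) * tpc K N x.2 := by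
  unfold tpc
  rw [pow_succ', coeff_mul]

lemma tpc_succ_ge (K N M k : ℕ) (hk : K ≤ k) (hkM : k ≤ M) :
    1 / (k.factorial : ℝ) * tpc K N (M - k) ≤ tpc K (N + 1) M := by
  rw [tpc_succ]
  refine le_trans (le_of_eq ?_) (Finset.single_le_sum
    (f := fun x : ℕ × ℕ => coeff x.1 (tp K) * tpc K N x.2)
    (fun x _ => mul_nonneg (coeff_tp_nonneg _ _) (tpc_nonneg _ _ _))
    (show (k, M - k) ∈ antidiagonal M by simp; omega))
  simp [tp, hk]

lemma tpc_mul_pos (K N : ℕ) : 0 < tpc K N (K * N) := by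
  induction N with
  | zero => simp [tpc]
  | succ N ih =>
    refine lt_of_lt_of_le ?_ (tpc_succ_ge K N (K * (N + 1)) K le_rfl (by nlinarith))
    rw [show K * (N + 1) - K = K * N by rw [mul_add, mul_one]; omega]
    positivity

/-- One factor absorbs the whole excess over `K N`, all others contribute `X^K / K!`. -/
lemma tpc_pos {K N M : ℕ} (hN : 1 ≤ N) (hM : K * N ≤ M) : 0 < tpc K N M := by
  obtain ⟨N, rfl⟩ := Nat.exists_eq_add_of_le' hN
  rw [mul_add, mul_one] at hM
  refine lt_of_lt_of_le ?_ (tpc_succ_ge K N M (M - K * N) (by omega) (by omega))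
  rw [show M - (M - K * N) = K * N by omega]
  have := tpc_mul_pos K N
  positivity

/-- The truncated exponential is its own derivative up to one boundary monomial. That monomial
produces the term with one factor less in `mul_tpc`. -/
lemma derivative_tp {K : ℕ} (hK : 1 ≤ K) :
    d⁄dX ℝ (tp K) = tp K + C (1 / ((K - 1).factorial : ℝ)) * X ^ (K - 1) := by
  unfold tp
  rw [derivative_egf]
  ext k
  rw [map_add, coeff_egf, coeff_egf, coeff_C_mul, coeff_X_pow]
  rcases lt_trichotomy (k + 1) K with h | h | h
  · rw [if_neg (by omega), if_neg (by omega), if_neg (by omega)]; simp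
  · rw [if_pos (by omega), if_neg (by omega), if_pos (by omega)]
    rw [show K - 1 = k by omega]; simp
  · rw [if_pos (by omega), if_pos (by omega), if_neg (by omega)]; simp

lemma X_mul_derivative_pow {K : ℕ} (hK : 1 ≤ K) (N : ℕ) :
    X * d⁄dX ℝ (tp K ^ (N + 1)) = C ((N : ℝ) + 1) * (X * tp K ^ (N + 1)) +
      C (((N : ℝ) + 1) / ((K - 1).factorial : ℝ)) * (X ^ K * tp K ^ N) := by
  rw [Derivation.leibniz_pow, derivative_tp hK, nsmul_eq_mul, smul_eq_mul, Nat.add_sub_cancel]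
  obtain ⟨k, rfl⟩ := Nat.exists_eq_add_of_le' hK
  rw [Nat.add_sub_cancel, div_eq_mul_one_div ((N : ℝ) + 1), map_mul]
  push_cast
  rw [show (C ((N : ℝ) + 1) : ℝ⟦X⟧) = (N : ℝ⟦X⟧) + 1 by simp]
  ring

lemma coeff_X_mul_derivative (f : ℝ⟦X⟧) (M : ℕ) : coeff M (X * d⁄dX ℝ f) = M * coeff M f := by
  cases M with
  | zero => simp
  | succ M => rw [coeff_succ_X_mul, coeff_derivative]; push_cast; ring

/-- Differentiating the power of the truncated exponential. -/
lemma mul_tpc {K : ℕ} (hK : 1 ≤ K) (N : ℕ) {M : ℕ} (hM : K ≤ M) :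
    (M : ℝ) * tpc K (N + 1) M = (N + 1) * tpc K (N + 1) (M - 1) +
      (N + 1) / ((K - 1).factorial : ℝ) * tpc K N (M - K) := by
  have h := congrArg (coeff M) (X_mul_derivative_pow hK N)
  rw [coeff_X_mul_derivative, map_add, coeff_C_mul, coeff_C_mul] at h
  obtain ⟨d, rfl⟩ := Nat.exists_eq_add_of_le hM
  obtain ⟨k, rfl⟩ := Nat.exists_eq_add_of_le' hK
  rw [show k + 1 + d = (k + d) + 1 by ring, coeff_succ_X_mul, show k + d + 1 = d + (k + 1) by ring,
    coeff_X_pow_mul] at h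
  rw [show k + 1 + d = d + (k + 1) by ring, show d + (k + 1) - 1 = k + d by omega,
    show d + (k + 1) - (k + 1) = d by omega]
  exact h

/-- The mean of the law of one summand under conditioning on the sum. -/
lemma sum_mul_tpc {K : ℕ} (N M : ℕ) :
    ((N : ℝ) + 1) * ∑ x ∈ antidiagonal M, (x.1 : ℝ) * (coeff x.1 (tp K) * tpc K N x.2) =
      M * tpc K (N + 1) M := by
  have h : X * d⁄dX ℝ (tp K ^ (N + 1)) = C ((N : ℝ) + 1) * ((X * d⁄dX ℝ (tp K)) * tp K ^ N) := by
    rw [Derivation.leibniz_pow, nsmul_eq_mul, smul_eq_mul, Nat.add_sub_cancel]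
    rw [show (C ((N : ℝ) + 1) : ℝ⟦X⟧) = (N : ℝ⟦X⟧) + 1 by simp]
    push_cast
    ring
  have h := congrArg (coeff M) h
  rw [coeff_X_mul_derivative, coeff_C_mul, coeff_mul] at h
  rw [tpc, h]
  congr 1
  refine Finset.sum_congr rfl fun x _ => ?_
  rw [coeff_X_mul_derivative, tpc, mul_assoc]

end

section

open PowerSeries

/-! ### Log-concavity -/

/-- Log-concave nonnegative two-sided sequences without internal zeros. -/
def LogConcaveSeq (f : ℤ → ℝ) : Prop :=
  (∀ i, 0 ≤ f i) ∧ ∀ i j, i ≤ j → f (i - 1) * f (j + 1) ≤ f i * f j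

lemma LogConcaveSeq.spread {f : ℤ → ℝ} (hf : LogConcaveSeq f) {i j : ℤ} (hij : i ≤ j) (r : ℕ) :
    f (i - r) * f (j + r) ≤ f i * f j := by
  induction r with
  | zero => simp
  | succ r ih =>
    refine le_trans ?_ ih
    have := hf.2 (i - r) (j + r) (by omega)
    rw [sub_sub, add_assoc] at this
    exact_mod_cast this

lemma LogConcaveSeq.mul_le_mul_of_le {f : ℤ → ℝ} (hf : LogConcaveSeq f) {i j p q : ℤ}
    (h1 : p ≤ i) (h2 : p ≤ j) (h : p + q = i + j) : f p * f q ≤ f i * f j := by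
  rcases le_total i j with hij | hij
  · have := hf.spread hij (i - p).toNat
    rw [Int.toNat_of_nonneg (by omega)] at this
    rwa [show i - (i - p) = p by ring, show j + (i - p) = q by linarith] at this
  · have := hf.spread hij (j - p).toNat
    rw [Int.toNat_of_nonneg (by omega)] at this
    rw [show j - (j - p) = p by ring, show i + (j - p) = q by linarith] at this
    rwa [mul_comm (f i)]

/-- Twice `c m * c n - c (m - 1) * c (n + 1)` is a sum over `(i, j)` of a minor of `g` times a minor
of `f`, and log-concavity gives both minors the same sign: nonnegative for `i ≤ j`, nonpositive
otherwise. -/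
lemma LogConcaveSeq.convolution {f g c : ℤ → ℝ} (hf : LogConcaveSeq f) (hg : LogConcaveSeq g)
    (hc : ∀ n, HasSum (fun i => f (n - i) * g i) (c n)) : LogConcaveSeq c := by
  refine ⟨fun n => (hc n).nonneg fun i => mul_nonneg (hf.1 _) (hg.1 _), fun m n hmn => ?_⟩
  have hprod : ∀ m n, HasSum (fun x : ℤ × ℤ => (f (m - x.1) * g x.1) * (f (n - x.2) * g x.2))
      (c m * c n) := fun m n =>
    (hc m).mul (hc n) ((hc m).summable.mul_of_nonneg (hc n).summable
      (fun i => mul_nonneg (hf.1 _) (hg.1 _)) (fun i => mul_nonneg (hf.1 _) (hg.1 _)))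
  -- The involution `e` performs the antisymmetrisation, and `e'` aligns the second product with the
  -- first so that the factors of `f` agree.
  let e : ℤ × ℤ ≃ ℤ × ℤ :=
    { toFun := fun x => (x.2 + 1, x.1 - 1)
      invFun := fun x => (x.2 + 1, x.1 - 1)
      left_inv := fun x => by simp
      right_inv := fun x => by simp }
  let e' : ℤ × ℤ ≃ ℤ × ℤ :=
    { toFun := fun x => (x.1 - 1, x.2 + 1)
      invFun := fun x => (x.1 + 1, x.2 - 1)
      left_inv := fun x => by simp
      right_inv := fun x => by simp }
  have H1 := hprod m n
  have H1' := e.hasSum_iff.2 H1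
  have H2 := e'.hasSum_iff.2 (hprod (m - 1) (n + 1))
  have H2' := e.hasSum_iff.2 H2
  have H := (H1.sub H2).add (H1'.sub H2')
  have hnn := H.nonneg fun x => by
    obtain ⟨i, j⟩ := x
    simp only [Function.comp, e, e', Equiv.coe_fn_mk]
    have key : 0 ≤ (g i * g j - g (i - 1) * g (j + 1)) *
        (f (m - i) * f (n - j) - f (m - (j + 1)) * f (n - (i - 1))) := by
      rcases le_or_gt i j with hij | hij
      · exact mul_nonneg (sub_nonneg.2 (hg.2 i j hij))
          (sub_nonneg.2 (hf.mul_le_mul_of_le (by omega) (by omega) (by ring)))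
      · refine mul_nonneg_of_nonpos_of_nonpos (sub_nonpos.2 ?_) (sub_nonpos.2 ?_)
        · rw [mul_comm (g i)]
          exact hg.mul_le_mul_of_le (by omega) (by omega) (by ring)
        · exact hf.mul_le_mul_of_le (by omega) (by omega) (by ring)
    have e3 : m - 1 - (i - 1) = m - i := by ring
    have e4 : n + 1 - (j + 1) = n - j := by ring
    have e5 : m - 1 - (j + 1 - 1) = m - (j + 1) := by ring
    have e6 : n + 1 - (i - 1 + 1) = n - (i - 1) := by ring
    have e7 : j + 1 - 1 = j := by ring
    have e8 : i - 1 + 1 = i := by ring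
    rw [e3, e4, e5, e6, e7, e8]
    linarith
  linarith

/-- Extension of a sequence by zero to negative indices. -/
noncomputable def extZ (f : ℕ → ℝ) (n : ℤ) : ℝ := if 0 ≤ n then f n.toNat else 0

@[simp] lemma extZ_natCast (f : ℕ → ℝ) (n : ℕ) : extZ f n = f n := by simp [extZ]

lemma extZ_of_neg (f : ℕ → ℝ) {n : ℤ} (h : n < 0) : extZ f n = 0 := by
  simp [extZ, not_le.2 h]

lemma hasSum_extZ_coeff_mul (f g : ℝ⟦X⟧) (n : ℤ) :
    HasSum (fun i => extZ (fun k => coeff k f) (n - i) * extZ (fun k => coeff k g) i)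
      (extZ (fun k => coeff k (f * g)) n) := by
  rcases lt_or_ge n 0 with hn | hn
  · rw [extZ_of_neg _ hn]
    convert hasSum_zero using 2 with i
    rcases lt_or_ge i 0 with hi | hi
    · rw [extZ_of_neg _ hi, mul_zero]
    · rw [extZ_of_neg _ (show n - i < 0 by omega), zero_mul]
  · obtain ⟨k, rfl⟩ := Int.eq_ofNat_of_zero_le hn
    rw [extZ_natCast, mul_comm f g, coeff_mul, Finset.Nat.sum_antidiagonal_eq_sum_range_succ_mk]
    have : ∑ i ∈ range k.succ, coeff i g * coeff (k - i) f =
        ∑ i ∈ (range (k + 1)).map Nat.castEmbedding,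
          extZ (fun k => coeff k f) ((k : ℤ) - i) * extZ (fun k => coeff k g) i := by
      rw [Finset.sum_map]
      refine Finset.sum_congr rfl fun i hi => ?_
      have : i ≤ k := by simpa [Nat.lt_succ_iff] using hi
      rw [Nat.castEmbedding_apply, ← Nat.cast_sub this, extZ_natCast, extZ_natCast, mul_comm]
    rw [this]
    refine hasSum_sum_of_ne_finset_zero fun i hi => ?_
    rcases lt_or_ge i 0 with h0 | h0
    · rw [extZ_of_neg _ h0, mul_zero]
    · obtain ⟨l, rfl⟩ := Int.eq_ofNat_of_zero_le h0
      rw [extZ_of_neg _ (show (k : ℤ) - l < 0 by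
        by_contra hcon
        exact hi (Finset.mem_map.2 ⟨l, by simp; omega, rfl⟩)), zero_mul]

lemma logConcaveSeq_tp (K : ℕ) : LogConcaveSeq (extZ fun k => coeff k (tp K)) := by
  have hnn : ∀ i, 0 ≤ extZ (fun k => coeff k (tp K)) i := fun i => by
    unfold extZ; split_ifs
    · exact coeff_tp_nonneg _ _
    · exact le_rfl
  refine ⟨hnn, fun i j hij => ?_⟩
  rcases lt_or_ge (i - 1) 0 with h | h
  · rw [extZ_of_neg _ h, zero_mul]; exact mul_nonneg (hnn _) (hnn _)
  · obtain ⟨p, hp⟩ := Int.eq_ofNat_of_zero_le h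
    obtain ⟨q, rfl⟩ := Int.eq_ofNat_of_zero_le (show 0 ≤ j by omega)
    obtain rfl : i = ((p + 1 : ℕ) : ℤ) := by push_cast; omega
    have hpq : p + 1 ≤ q := by exact_mod_cast hij
    rw [hp, show (q : ℤ) + 1 = ((q + 1 : ℕ) : ℤ) by push_cast; rfl]
    simp only [extZ_natCast, tp, coeff_egf]
    by_cases hKp : K ≤ p
    · rw [if_pos hKp, if_pos (by omega), if_pos (by omega), if_pos (by omega), div_mul_div_comm,
        div_mul_div_comm]
      have : (p + 1).factorial * q.factorial ≤ p.factorial * (q + 1).factorial := by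
        rw [Nat.factorial_succ, Nat.factorial_succ q]
        calc (p + 1) * p.factorial * q.factorial = (p.factorial * q.factorial) * (p + 1) := by ring
          _ ≤ (p.factorial * q.factorial) * (q + 1) := by gcongr; omega
          _ = _ := by ring
      have : ((p + 1).factorial : ℝ) * q.factorial ≤ p.factorial * (q + 1).factorial := by
        exact_mod_cast this
      gcongr
    · rw [if_neg hKp, zero_div, zero_mul]
      positivity

lemma logConcaveSeq_tpc (K N : ℕ) : LogConcaveSeq (extZ (tpc K N)) := by
  induction N with
  | zero =>
    have h0 : ∀ i : ℤ, extZ (tpc K 0) i = if i = 0 then 1 else 0 := fun i => by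
      rcases lt_or_ge i 0 with h | h
      · rw [extZ_of_neg _ h, if_neg h.ne]
      · obtain ⟨k, rfl⟩ := Int.eq_ofNat_of_zero_le h
        simp [tpc, coeff_one]
    refine ⟨fun i => by rw [h0]; positivity, fun i j hij => ?_⟩
    simp only [h0]
    by_cases h : i - 1 = 0
    · rw [if_neg (show ¬ j + 1 = 0 by omega), mul_zero]; positivity
    · rw [if_neg h, zero_mul]; positivity
  | succ N ih =>
    refine ih.convolution (logConcaveSeq_tp K) fun n => ?_
    have := hasSum_extZ_coeff_mul (tp K ^ N) (tp K) n
    rw [← pow_succ] at this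
    exact this

lemma tpc_logConcave (K N : ℕ) {i j : ℕ} (hij : i ≤ j) :
    tpc K N i * tpc K N (j + 1) ≤ tpc K N (i + 1) * tpc K N j := by
  have := (logConcaveSeq_tpc K N).mul_le_mul_of_le (i := (i + 1 : ℕ)) (j := (j : ℕ)) (p := (i : ℕ))
    (q := (j + 1 : ℕ)) (by push_cast; omega) (by exact_mod_cast hij) (by push_cast; ring)
  simpa only [extZ_natCast] using this

/-- By log-concavity the ratio of a coefficient to the next one is largest at the top of the range.
Each step downwards from `x ≤ m + 1` therefore costs at most the factor found at `m + 1`. -/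
lemma tpc_sub_le (K N : ℕ) {m x d : ℕ} (hpos : 0 < tpc K N (m + 1)) (hx : x ≤ m + 1)
    (hd : d ≤ x) :
    tpc K N (x - d) ≤ (tpc K N m / tpc K N (m + 1)) ^ d * tpc K N x := by
  induction d with
  | zero => simp
  | succ d ih =>
    have h1 := ih (by omega)
    have h2 := tpc_logConcave K N (show x - (d + 1) ≤ m by omega)
    rw [show x - (d + 1) + 1 = x - d by omega] at h2
    have hμ : 0 ≤ tpc K N m / tpc K N (m + 1) := div_nonneg (tpc_nonneg _ _ _) hpos.le
    have h3 : tpc K N (x - (d + 1)) ≤ tpc K N m / tpc K N (m + 1) * tpc K N (x - d) := by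
      rw [div_mul_eq_mul_div, le_div_iff₀ hpos]; linarith
    calc _ ≤ _ := h3
      _ ≤ tpc K N m / tpc K N (m + 1) * ((tpc K N m / tpc K N (m + 1)) ^ d * tpc K N x) := by gcongr
      _ = _ := by ring

end

section

open PowerSeries

/-! ### Maps with prescribed truncated degrees -/

section ClassFiber

variable {S B : Type*} [Fintype S] [DecidableEq S] [Fintype B] [DecidableEq B]

/-- The maps `S → B` whose degrees, truncated at `K`, are given by `κ`. -/
def classFiber (S : Type*) [Fintype S] [DecidableEq S] (K : ℕ) (κ : B → ℕ) : Finset (S → B) :=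
  univ.filter fun φ => ∀ a, min (deg φ a) K = κ a

/-- The points whose degree is allowed to be any number `≥ K`. -/
def heavy (K : ℕ) (κ : B → ℕ) : Finset B := univ.filter fun a => κ a = K

/-- The number of points of degree exactly `K`. -/
def tight (K : ℕ) (φ : S → B) : ℕ := (univ.filter fun a => deg φ a = K).card

lemma mem_classFiber {K : ℕ} {κ : B → ℕ} {φ : S → B} :
    φ ∈ classFiber S K κ ↔ ∀ a, min (deg φ a) K = κ a := by simp [classFiber]

/-- The combinatorial constant common to all weighted counts over a class fibre. -/
noncomputable def fiberConst (S : Type*) [Fintype S] (K : ℕ) (κ : B → ℕ) : ℝ :=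
  ((Fintype.card S).factorial : ℝ) * ∏ a ∈ (heavy K κ)ᶜ, (1 / ((κ a).factorial : ℝ))

lemma fiberConst_pos (K : ℕ) (κ : B → ℕ) : 0 < fiberConst S K κ := by
  unfold fiberConst
  have : 0 < ∏ a ∈ (heavy K κ)ᶜ, (1 / ((κ a).factorial : ℝ)) :=
    Finset.prod_pos fun a _ => by positivity
  positivity

/-- Points outside `heavy` have a fixed degree and contribute only a monomial. What remains is a
coefficient over the heavy points, to which `M` elements of `S` are attached; the constant is the
same for all weights and cancels in averages. -/
lemma sum_classFiber {K M : ℕ} {κ : B → ℕ} (hκ : ∀ a, κ a ≤ K)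
    (hM : M + ∑ a ∈ (heavy K κ)ᶜ, κ a = Fintype.card S) (v : B → ℕ → ℝ) :
    ∑ φ ∈ classFiber S K κ, ∏ a ∈ heavy K κ, v a (deg φ a) =
      fiberConst S K κ *
        coeff M (∏ a ∈ heavy K κ, egf fun k => if K ≤ k then v a k else 0) := by
  have h1 : ∑ φ ∈ classFiber S K κ, ∏ a ∈ heavy K κ, v a (deg φ a) =
      ∑ φ : S → B, ∏ a, (if min (deg φ a) K = κ a then
        (if a ∈ heavy K κ then v a (deg φ a) else 1) else 0) := by
    rw [classFiber, Finset.sum_filter]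
    refine Finset.sum_congr rfl fun φ _ => ?_
    split_ifs with h
    · rw [Finset.prod_congr rfl fun a _ => if_pos (h a), Finset.prod_ite_mem, Finset.univ_inter]
    · push Not at h
      obtain ⟨a, ha⟩ := h
      exact (Finset.prod_eq_zero (Finset.mem_univ a) (if_neg ha)).symm
  rw [h1, sum_prod_deg fun a k => if min k K = κ a then (if a ∈ heavy K κ then v a k else 1) else 0,
    ← Finset.prod_mul_prod_compl (heavy K κ)]
  have h2 : ∏ a ∈ heavy K κ, egf (fun k => if min k K = κ a then
      (if a ∈ heavy K κ then v a k else 1) else 0) =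
      ∏ a ∈ heavy K κ, egf fun k => if K ≤ k then v a k else 0 := by
    refine Finset.prod_congr rfl fun a ha => ?_
    have haK : κ a = K := (Finset.mem_filter.1 ha).2
    congr 1
    funext k
    simp [haK, ha]
  have h3 : ∏ a ∈ (heavy K κ)ᶜ, egf (fun k => if min k K = κ a then
      (if a ∈ heavy K κ then v a k else 1) else 0) =
      C (∏ a ∈ (heavy K κ)ᶜ, (1 / ((κ a).factorial : ℝ))) * X ^ (∑ a ∈ (heavy K κ)ᶜ, κ a) := by
    rw [map_prod, ← Finset.prod_pow_eq_pow_sum, ← Finset.prod_mul_distrib]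
    refine Finset.prod_congr rfl fun a ha => ?_
    have ha' : a ∉ heavy K κ := Finset.mem_compl.1 ha
    have haK : κ a < K := lt_of_le_of_ne (hκ a) fun h => ha' (by simp [heavy, h])
    ext k
    rw [coeff_egf, coeff_C_mul, coeff_X_pow, if_neg ha']
    by_cases hk : k = κ a
    · rw [if_pos (by omega), if_pos hk, hk, mul_one]
    · rw [if_neg (by omega), if_neg hk]; simp
  rw [h2, h3, ← hM, mul_left_comm, coeff_C_mul, coeff_mul_X_pow, hM, fiberConst]
  ring

lemma tp_prod (K : ℕ) (s : Finset B) (v : B → ℕ → ℝ) (hv : ∀ a ∈ s, ∀ k, v a k = 1) :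
    ∏ a ∈ s, egf (fun k => if K ≤ k then v a k else 0) = tp K ^ s.card := by
  rw [← Finset.prod_const]
  exact Finset.prod_congr rfl fun a ha => by simp [tp, hv a ha]

variable {K M : ℕ} {κ : B → ℕ}

lemma card_classFiber (hκ : ∀ a, κ a ≤ K)
    (hM : M + ∑ a ∈ (heavy K κ)ᶜ, κ a = Fintype.card S) :
    ((classFiber S K κ).card : ℝ) = fiberConst S K κ * tpc K (heavy K κ).card M := by
  have := sum_classFiber hκ hM fun _ _ => 1
  rw [tp_prod _ _ _ (by simp)] at this
  simpa [tpc] using this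

/-- Forcing degree `K` at a heavy point replaces its factor by `X^K / K!`. -/
lemma card_classFiber_tight (hκ : ∀ a, κ a ≤ K)
    (hM : M + ∑ a ∈ (heavy K κ)ᶜ, κ a = Fintype.card S) {A : Finset B} (hA : A ⊆ heavy K κ)
    (hAM : K * A.card ≤ M) :
    (((classFiber S K κ).filter fun φ => ∀ a ∈ A, deg φ a = K).card : ℝ) =
      fiberConst S K κ * ((1 / (K.factorial : ℝ)) ^ A.card *
        tpc K ((heavy K κ).card - A.card) (M - K * A.card)) := by
  have h := sum_classFiber hκ hM fun a k => if a ∈ A then (if k = K then 1 else 0) else 1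
  rw [← Finset.prod_sdiff hA (f := fun a => egf _), tp_prod _ _ _ fun a ha k => by
    rw [if_neg (Finset.mem_sdiff.1 ha).2], Finset.card_sdiff_of_subset hA] at h
  have h2 : ∏ a ∈ A, egf (fun k => if K ≤ k then
      (if a ∈ A then (if k = K then (1 : ℝ) else 0) else 1) else 0) =
      C ((1 / (K.factorial : ℝ)) ^ A.card) * X ^ (K * A.card) := by
    rw [map_pow, pow_mul, ← mul_pow, ← Finset.prod_const]
    refine Finset.prod_congr rfl fun a ha => ?_
    ext k
    rw [coeff_egf, coeff_C_mul, coeff_X_pow, if_pos ha]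
    by_cases hk : k = K
    · simp [hk]
    · simp [hk]
  rw [h2, mul_left_comm, coeff_C_mul, coeff_mul_X_pow'] at h
  rw [if_pos hAM] at h
  rw [tpc, ← h, Finset.card_filter]
  push_cast
  refine Finset.sum_congr rfl fun φ _ => ?_
  rw [Finset.prod_ite, Finset.prod_const_one, mul_one]
  rw [Finset.filter_mem_eq_inter, Finset.inter_eq_right.2 hA]
  split_ifs with hall
  · rw [Finset.prod_congr rfl fun a ha => if_pos (hall a ha), Finset.prod_const_one]
  · push Not at hall
    obtain ⟨a, ha, hne⟩ := hall
    exact (Finset.prod_eq_zero ha (if_neg hne)).symm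

lemma tight_eq_sum {φ : S → B} (hφ : φ ∈ classFiber S K κ) :
    (tight K φ : ℝ) = ∑ a ∈ heavy K κ, if deg φ a = K then (1 : ℝ) else 0 := by
  rw [tight, Finset.card_filter, heavy, Finset.sum_filter]
  push_cast
  refine Finset.sum_congr rfl fun a _ => ?_
  have := mem_classFiber.1 hφ a
  by_cases h : deg φ a = K
  · rw [if_pos h, if_pos (by omega)]
  · simp [h]

lemma sum_tight (hκ : ∀ a, κ a ≤ K)
    (hM : M + ∑ a ∈ (heavy K κ)ᶜ, κ a = Fintype.card S) (hKM : K ≤ M) :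
    ∑ φ ∈ classFiber S K κ, (tight K φ : ℝ) = fiberConst S K κ *
      ((heavy K κ).card * (1 / (K.factorial : ℝ) * tpc K ((heavy K κ).card - 1) (M - K))) := by
  rw [Finset.sum_congr rfl fun φ hφ => tight_eq_sum hφ, Finset.sum_comm]
  have : ∀ a ∈ heavy K κ, ∑ φ ∈ classFiber S K κ, (if deg φ a = K then (1 : ℝ) else 0) =
      fiberConst S K κ * (1 / (K.factorial : ℝ) * tpc K ((heavy K κ).card - 1) (M - K)) := by
    intro a ha
    have := card_classFiber_tight hκ hM (A := {a}) (by simpa using ha) (by simpa using hKM)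
    simp only [Finset.mem_singleton, forall_eq, Finset.card_singleton, pow_one, mul_one] at this
    rw [← this, Finset.card_filter]
    push_cast
    rfl
  rw [Finset.sum_congr rfl this, Finset.sum_const, nsmul_eq_mul]
  ring

lemma sum_tight_sq (hκ : ∀ a, κ a ≤ K)
    (hM : M + ∑ a ∈ (heavy K κ)ᶜ, κ a = Fintype.card S) (hKM : K * 2 ≤ M) :
    ∑ φ ∈ classFiber S K κ, (tight K φ : ℝ) ^ 2 = fiberConst S K κ *
      ((heavy K κ).card * (1 / (K.factorial : ℝ) * tpc K ((heavy K κ).card - 1) (M - K)) +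
      (heavy K κ).card * (((heavy K κ).card : ℝ) - 1) * ((1 / (K.factorial : ℝ)) ^ 2 *
        tpc K ((heavy K κ).card - 2) (M - K * 2))) := by
  have h1 : ∀ φ ∈ classFiber S K κ, (tight K φ : ℝ) ^ 2 = (tight K φ : ℝ) +
      ∑ a ∈ heavy K κ, ∑ b ∈ (heavy K κ).erase a,
        if ∀ c ∈ ({a, b} : Finset B), deg φ c = K then (1 : ℝ) else 0 := by
    intro φ hφ
    rw [tight_eq_sum hφ, sq, Finset.sum_mul_sum, ← Finset.sum_add_distrib]
    refine Finset.sum_congr rfl fun a ha => ?_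
    rw [← Finset.add_sum_erase _ _ ha]
    congr 1
    · split_ifs <;> simp
    · refine Finset.sum_congr rfl fun b _ => ?_
      simp only [Finset.mem_insert, Finset.mem_singleton, forall_eq_or_imp, forall_eq]
      by_cases h1 : deg φ a = K <;> by_cases h2 : deg φ b = K <;> simp [h1, h2]
  rw [Finset.sum_congr rfl h1, Finset.sum_add_distrib, sum_tight hκ hM (by omega), mul_add]
  congr 1
  rw [Finset.sum_comm]
  have h2 : ∀ a ∈ heavy K κ, ∑ φ ∈ classFiber S K κ, ∑ b ∈ (heavy K κ).erase a,
      (if ∀ c ∈ ({a, b} : Finset B), deg φ c = K then (1 : ℝ) else 0) =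
      (((heavy K κ).card : ℝ) - 1) * (fiberConst S K κ * ((1 / (K.factorial : ℝ)) ^ 2 *
        tpc K ((heavy K κ).card - 2) (M - K * 2))) := by
    intro a ha
    rw [Finset.sum_comm]
    have h3 : ∀ b ∈ (heavy K κ).erase a, ∑ φ ∈ classFiber S K κ,
        (if ∀ c ∈ ({a, b} : Finset B), deg φ c = K then (1 : ℝ) else 0) =
        fiberConst S K κ * ((1 / (K.factorial : ℝ)) ^ 2 *
          tpc K ((heavy K κ).card - 2) (M - K * 2)) := by
      intro b hb
      have hc : ({a, b} : Finset B).card = 2 := Finset.card_pair (Finset.ne_of_mem_erase hb).symm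
      have := card_classFiber_tight hκ hM (A := {a, b}) (by
        intro c hc
        simp only [Finset.mem_insert, Finset.mem_singleton] at hc
        rcases hc with rfl | rfl
        · exact ha
        · exact Finset.mem_of_mem_erase hb) (by rw [hc]; exact hKM)
      rw [hc] at this
      rw [← this, Finset.card_filter]
      push_cast
      rfl
    rw [Finset.sum_congr rfl h3, Finset.sum_const, nsmul_eq_mul, Finset.card_erase_of_mem ha,
      Nat.cast_sub (Finset.card_pos.2 ⟨a, ha⟩)]
    simp
  rw [Finset.sum_congr rfl h2, Finset.sum_const, nsmul_eq_mul]
  ring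

/-- Since `k (k - 1) / k! = 1 / (k - 2)!`, the left side is `X^2` times the exponential truncated at
`K - 2`, which has two terms more than `tp K`. -/
lemma egf_mul_pred (hK : 2 ≤ K) :
    egf (fun k => if K ≤ k then (k : ℝ) * (k - 1) else 0) =
      X ^ 2 * tp K + C (1 / ((K - 1).factorial : ℝ)) * X ^ (K + 1) +
        C (1 / ((K - 2).factorial : ℝ)) * X ^ K := by
  ext k
  rw [coeff_egf, map_add, map_add, coeff_C_mul, coeff_C_mul, coeff_X_pow, coeff_X_pow,
    coeff_X_pow_mul']
  rcases lt_or_ge k 2 with hk | hk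
  · rw [if_neg (by omega), if_neg (by omega), if_neg (by omega), if_neg (by omega)]; simp
  · obtain ⟨j, rfl⟩ := Nat.exists_eq_add_of_le' hk
    obtain ⟨q, rfl⟩ := Nat.exists_eq_add_of_le' hK
    rw [if_pos hk, Nat.add_sub_cancel, Nat.add_sub_cancel, tp, coeff_egf]
    have hf : ((j + 2).factorial : ℝ) = (j + 2) * (j + 1) * j.factorial := by
      rw [Nat.factorial_succ, Nat.factorial_succ]; push_cast; ring
    have hj : (j.factorial : ℝ) ≠ 0 := by positivity
    have key : ((j + 2 : ℕ) : ℝ) * (((j + 2 : ℕ) : ℝ) - 1) / ((j + 2).factorial : ℝ) =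
        1 / (j.factorial : ℝ) := by
      rw [hf]; push_cast
      field_simp
      ring
    rcases lt_trichotomy j q with h | h | h
    · rw [if_neg (by omega), if_neg (by omega), if_neg (by omega), if_neg (by omega)]; simp
    · subst h
      rw [if_pos (by omega), if_neg (by omega), if_neg (by omega), if_pos rfl, key]; simp
    · rw [if_pos (by omega), key]
      rcases eq_or_ne j (q + 1) with h' | h'
      · subst h'
        rw [if_neg (by omega), if_pos (by omega), if_neg (by omega)]
        simp
      · rw [if_pos (by omega), if_neg (by omega), if_neg (by omega)]; simp

lemma sum_deg_mul_pred (hK : 2 ≤ K) (hκ : ∀ a, κ a ≤ K)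
    (hM : M + ∑ a ∈ (heavy K κ)ᶜ, κ a = Fintype.card S) (hKM : K + 1 ≤ M) {a : B}
    (ha : a ∈ heavy K κ) :
    ∑ φ ∈ classFiber S K κ, (deg φ a : ℝ) * (deg φ a - 1) = fiberConst S K κ *
      (tpc K (heavy K κ).card (M - 2) +
        1 / ((K - 1).factorial : ℝ) * tpc K ((heavy K κ).card - 1) (M - (K + 1)) +
        1 / ((K - 2).factorial : ℝ) * tpc K ((heavy K κ).card - 1) (M - K)) := by
  have h := sum_classFiber hκ hM fun b k => if b = a then (k : ℝ) * (k - 1) else 1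
  rw [← Finset.prod_erase_mul _ _ ha, tp_prod _ _ _ fun b hb k => by
    rw [if_neg (Finset.ne_of_mem_erase hb)], Finset.card_erase_of_mem ha] at h
  simp only [if_true] at h
  rw [egf_mul_pred hK] at h
  have hN : (heavy K κ).card = (heavy K κ).card - 1 + 1 := by
    have := Finset.card_pos.2 ⟨a, ha⟩; omega
  have e : tp K ^ ((heavy K κ).card - 1) * (X ^ 2 * tp K +
      C (1 / ((K - 1).factorial : ℝ)) * X ^ (K + 1) + C (1 / ((K - 2).factorial : ℝ)) * X ^ K) =
      X ^ 2 * tp K ^ (heavy K κ).card +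
      C (1 / ((K - 1).factorial : ℝ)) * (X ^ (K + 1) * tp K ^ ((heavy K κ).card - 1)) +
      C (1 / ((K - 2).factorial : ℝ)) * (X ^ K * tp K ^ ((heavy K κ).card - 1)) := by
    conv_rhs => rw [hN, pow_succ]
    simp only [Nat.add_sub_cancel]
    ring
  rw [e, map_add, map_add, coeff_C_mul, coeff_C_mul, coeff_X_pow_mul', coeff_X_pow_mul',
    coeff_X_pow_mul', if_pos (by omega), if_pos hKM, if_pos (by omega)] at h
  refine Eq.trans ?_ h
  refine Finset.sum_congr rfl fun φ _ => ?_
  rw [Finset.prod_eq_single_of_mem a ha fun b _ hb => if_neg hb, if_pos rfl]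

end ClassFiber

end

section

open PowerSeries

/-! ### Ratios of coefficients -/

lemma sum_antidiagonal_eq_shift {K M : ℕ} (hKM : K ≤ M) (F : ℕ → ℕ → ℝ)
    (hF : ∀ k l, k < K → F k l = 0) :
    ∑ x ∈ antidiagonal M, F x.1 x.2 = ∑ i ∈ range (M - K + 1), F (i + K) (M - K - i) := by
  rw [Finset.Nat.sum_antidiagonal_eq_sum_range_succ_mk, show M.succ = K + (M - K + 1) by omega,
    Finset.sum_range_add, Finset.sum_eq_zero fun i hi => hF _ _ (Finset.mem_range.1 hi), zero_add]
  refine Finset.sum_congr rfl fun i _ => ?_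
  simp only
  rw [add_comm K i, show M - (i + K) = M - K - i by omega]

lemma coeff_tp_of_lt {K k : ℕ} (h : k < K) : coeff k (tp K) = 0 := by simp [tp, not_le.2 h]

lemma coeff_tp_add (K i : ℕ) : coeff (i + K) (tp K) = 1 / ((i + K).factorial : ℝ) := by simp [tp]

/-- Nonnegativity of the variance of the number of points of degree exactly `K`. -/
lemma tpc_variance {K N M : ℕ} (hM : K * 2 ≤ M) :
    ((N : ℝ) + 2) * tpc K (N + 1) (M - K) ^ 2 ≤ tpc K (N + 2) M *
      ((K.factorial : ℝ) * tpc K (N + 1) (M - K) + (N + 1) * tpc K N (M - K * 2)) := by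
  -- The inequality between coefficients is Cauchy–Schwarz for `tight` on maps from `M` slots to `N
  -- + 2` points, all of them heavy.
  have hheavy : heavy K (fun _ : Fin (N + 2) => K) = univ := by simp [heavy]
  have hM' : M + ∑ a ∈ (heavy K (fun _ : Fin (N + 2) => K))ᶜ, K = Fintype.card (Fin M) := by
    simp [hheavy]
  have hκ : ∀ a : Fin (N + 2), (fun _ : Fin (N + 2) => K) a ≤ K := fun _ => le_rfl
  have h0 := card_classFiber hκ hM'
  have h1 := sum_tight hκ hM' (by omega)
  have h2 := sum_tight_sq hκ hM' hM
  have h := sq_sum_le_card_mul_sum_sq (s := classFiber (Fin M) K (fun _ : Fin (N + 2) => K))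
    (f := fun φ => (tight K φ : ℝ))
  have hc := fiberConst_pos (S := Fin M) K (fun _ : Fin (N + 2) => K)
  rw [h0, h1, h2, hheavy] at h
  simp only [Finset.card_univ, Fintype.card_fin, Nat.add_sub_cancel,
    show N + 2 - 1 = N + 1 by omega] at h
  set c := fiberConst (Fin M) K (fun _ : Fin (N + 2) => K)
  set Z := tpc K (N + 2) M
  set Z1 := tpc K (N + 1) (M - K)
  set Z2 := tpc K N (M - K * 2)
  have hf : 0 < (K.factorial : ℝ) := by positivity
  push_cast at h
  have e1 : (c * (((N : ℝ) + 2) * (1 / K.factorial * Z1))) ^ 2 =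
      c ^ 2 * ((N : ℝ) + 2) / (K.factorial : ℝ) ^ 2 * (((N : ℝ) + 2) * Z1 ^ 2) := by
    field_simp
  have e2 : c * Z * (c * (((N : ℝ) + 2) * (1 / K.factorial * Z1) +
      ((N : ℝ) + 2) * ((N : ℝ) + 2 - 1) * ((1 / K.factorial) ^ 2 * Z2))) =
      c ^ 2 * ((N : ℝ) + 2) / (K.factorial : ℝ) ^ 2 *
        (Z * ((K.factorial : ℝ) * Z1 + (N + 1) * Z2)) := by
    field_simp
    ring
  rw [e1, e2] at h
  exact le_of_mul_le_mul_left h (by positivity)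

lemma factorial_pred_mul {K : ℕ} (hK : 1 ≤ K) :
    (K.factorial : ℝ) = K * ((K - 1).factorial : ℝ) := by
  obtain ⟨k, rfl⟩ := Nat.exists_eq_add_of_le' hK
  rw [Nat.factorial_succ]; push_cast; simp

section Ratio

variable {K N M : ℕ}

/-- This is `tpc_variance` after `mul_tpc` has turned the coefficients with fewer factors into
ratios of consecutive coefficients. -/
lemma pred_ratio_mul_le (hK : 1 ≤ K) (hM : K * (N + 2) < M) :
    ((N : ℝ) + 1) * (tpc K (N + 1) (M - K - 1) / tpc K (N + 1) (M - K)) ≤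
      (N + 2) * (tpc K (N + 2) (M - 1) / tpc K (N + 2) M) := by
  have hKM : K * 2 ≤ M := by nlinarith
  have hZ : 0 < tpc K (N + 2) M := tpc_pos (by omega) hM.le
  have hZ1 : 0 < tpc K (N + 1) (M - K) := tpc_pos (by omega) (by
    have : K * (N + 2) = K * (N + 1) + K := by ring
    omega)
  have h1 := mul_tpc hK (N + 1) (M := M) (by omega)
  have h2 := mul_tpc hK N (M := M - K) (by omega)
  rw [Nat.cast_sub (by omega), show M - K - K = M - K * 2 by omega] at h2
  have h3 := tpc_variance (K := K) (N := N) hKM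
  rw [factorial_pred_mul hK] at h3
  have hf : (0 : ℝ) < (K - 1).factorial := by positivity
  push_cast at h1
  rw [← mul_div_assoc, ← mul_div_assoc, div_le_div_iff₀ hZ1 hZ]
  set Z := tpc K (N + 2) M
  set Z1 := tpc K (N + 1) (M - K)
  set Z2 := tpc K N (M - K * 2)
  set F := ((K - 1).factorial : ℝ)
  have h1' : ((N : ℝ) + 2) * tpc K (N + 2) (M - 1) = M * Z - (N + 2) / F * Z1 := by
    rw [show N + 2 = N + 1 + 1 by ring]; rw [h1]; ring
  have h2' : ((N : ℝ) + 1) * tpc K (N + 1) (M - K - 1) = (M - K) * Z1 - (N + 1) / F * Z2 := by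
    rw [h2]; ring
  rw [h1', h2']
  have h4 : ((N : ℝ) + 2) / F * Z1 ^ 2 ≤ Z * (K * Z1 + (N + 1) / F * Z2) := by
    rw [div_mul_eq_mul_div, div_le_iff₀ hf]
    refine h3.trans (le_of_eq ?_)
    field_simp
  nlinarith [h4]

/-- Splitting off one factor shows that the ratio with `N + 2` factors is at most an average of
ratios with `N + 1` factors at indices up to `M - K`. Log-concavity makes the ratio at `M - K` the
largest. -/
lemma ratio_le_pred_ratio (hM : K * (N + 2) < M) :
    tpc K (N + 2) (M - 1) / tpc K (N + 2) M ≤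
      tpc K (N + 1) (M - K - 1) / tpc K (N + 1) (M - K) := by
  have e : K * (N + 2) = K * (N + 1) + K := by ring
  have hZ : 0 < tpc K (N + 2) M := tpc_pos (by omega) hM.le
  have hZ1 : 0 < tpc K (N + 1) (M - K) := tpc_pos (by omega) (by omega)
  have h0 : ∀ k l, k < K → coeff k (tp K) * tpc K (N + 1) l = 0 := fun k l h => by
    rw [coeff_tp_of_lt h, zero_mul]
  rw [div_le_div_iff₀ hZ hZ1, show N + 2 = N + 1 + 1 by ring,
    tpc_succ K (N + 1) (M - 1), tpc_succ K (N + 1) M,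
    sum_antidiagonal_eq_shift (K := K) (by omega) (fun k l => coeff k (tp K) * tpc K (N + 1) l) h0,
    sum_antidiagonal_eq_shift (K := K) (by omega) (fun k l => coeff k (tp K) * tpc K (N + 1) l) h0,
    Finset.sum_mul, Finset.mul_sum, show M - K + 1 = (M - 1 - K + 1) + 1 by omega,
    Finset.sum_range_succ _ (M - 1 - K + 1)]
  refine le_add_of_le_of_nonneg (Finset.sum_le_sum fun i hi => ?_)
    (mul_nonneg (tpc_nonneg _ _ _) (mul_nonneg (coeff_tp_nonneg _ _) (tpc_nonneg _ _ _)))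
  have hi' := Finset.mem_range.1 hi
  have h := tpc_logConcave K (N + 1) (i := M - 1 - K - i) (j := M - K - 1) (by omega)
  rw [show M - 1 - K - i + 1 = M - K - i by omega, show M - K - 1 + 1 = M - K by omega] at h
  calc _ = coeff (i + K) (tp K) * (tpc K (N + 1) (M - 1 - K - i) * tpc K (N + 1) (M - K)) := by ring
    _ ≤ coeff (i + K) (tp K) * (tpc K (N + 1) (M - K - i) * tpc K (N + 1) (M - K - 1)) :=
      mul_le_mul_of_nonneg_left h (coeff_tp_nonneg _ _)
    _ = _ := by ring

lemma tpc_succ_shift (N : ℕ) (hKM : K ≤ M) :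
    tpc K (N + 1) M = ∑ i ∈ range (M - K + 1),
      1 / ((i + K).factorial : ℝ) * tpc K N (M - K - i) := by
  rw [tpc_succ, sum_antidiagonal_eq_shift (K := K) hKM (fun k l => coeff k (tp K) * tpc K N l)
    fun k l h => by rw [coeff_tp_of_lt h, zero_mul]]
  simp only [coeff_tp_add]

/-- The right side is the probability that one of `N + 2` heavy points has degree exactly `K`. By
`tpc_sub_le` the weights of the larger degrees, relative to that of `K`, are at most those of the
Poisson law of parameter `μ`, so the atom at `K` can only be larger. -/
lemma atomTP_le_ratio (hM : K * (N + 2) < M) {μ : ℝ}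
    (hμ : μ = tpc K (N + 1) (M - K - 1) / tpc K (N + 1) (M - K)) (hμ0 : 0 < μ) :
    atomTP K μ ≤ tpc K (N + 1) (M - K) / tpc K (N + 2) M / (K.factorial : ℝ) := by
  have e : K * (N + 2) = K * (N + 1) + K := by ring
  have hZ : 0 < tpc K (N + 2) M := tpc_pos (by omega) hM.le
  have hZ1 : 0 < tpc K (N + 1) (M - K) := tpc_pos (by omega) (by omega)
  have hE := expTail_pos K hμ0
  have key : μ ^ K * tpc K (N + 2) M ≤ tpc K (N + 1) (M - K) * expTail K μ := by
    rw [show N + 2 = N + 1 + 1 by ring, tpc_succ_shift _ (by omega), Finset.mul_sum]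
    have hsum := (hasSum_expTail K μ).mul_left (tpc K (N + 1) (M - K))
    refine le_trans (Finset.sum_le_sum fun i hi => ?_)
      (sum_le_hasSum (range (M - K + 1)) (fun i _ => by positivity) hsum)
    have hi' := Finset.mem_range.1 hi
    have h := tpc_sub_le K (N + 1) (m := M - K - 1) (x := M - K) (d := i)
      (by rwa [show M - K - 1 + 1 = M - K by omega]) (by omega) (by omega)
    rw [show M - K - 1 + 1 = M - K by omega, ← hμ] at h
    calc μ ^ K * (1 / ((i + K).factorial : ℝ) * tpc K (N + 1) (M - K - i))
        ≤ μ ^ K * (1 / ((i + K).factorial : ℝ) * (μ ^ i * tpc K (N + 1) (M - K))) := by gcongr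
      _ = _ := by rw [pow_add]; ring
  unfold atomTP
  rw [div_right_comm]
  have : μ ^ K / expTail K μ ≤ tpc K (N + 1) (M - K) / tpc K (N + 2) M := by
    rwa [div_le_div_iff₀ hE hZ]
  gcongr

/-- By symmetry `M / (N + 2)` is the mean degree of one point. Its law is dominated in likelihood
ratio, again by `tpc_sub_le`, by the truncated Poisson law of parameter `μ`. -/
lemma mean_le_meanTP_ratio (hK : 1 ≤ K) (hM : K * (N + 2) < M) {μ : ℝ}
    (hμ : μ = tpc K (N + 1) (M - K - 1) / tpc K (N + 1) (M - K)) (hμ0 : 0 < μ) :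
    (M : ℝ) / (N + 2) ≤ meanTP K μ := by
  have e : K * (N + 2) = K * (N + 1) + K := by ring
  have hZ : 0 < tpc K (N + 2) M := tpc_pos (by omega) hM.le
  have hZ1 : 0 < tpc K (N + 1) (M - K) := tpc_pos (by omega) (by omega)
  have hE := expTail_pos K hμ0
  set w : ℕ → ℝ := fun i => if i < M - K + 1 then
    1 / ((i + K).factorial : ℝ) * tpc K (N + 1) (M - K - i) else 0 with hw
  have hwnn : ∀ i, 0 ≤ w i := fun i => by
    simp only [hw]; split_ifs
    · exact mul_nonneg (by positivity) (tpc_nonneg _ _ _)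
    · exact le_rfl
  have hW : HasSum w (tpc K (N + 2) M) := by
    rw [show N + 2 = N + 1 + 1 by ring, tpc_succ_shift _ (by omega)]
    rw [Finset.sum_congr rfl fun i hi => (show _ = w i from
      (if_pos (Finset.mem_range.1 hi)).symm)]
    exact hasSum_sum_of_ne_finset_zero fun i hi => if_neg fun h => hi (Finset.mem_range.2 h)
  have hW' : HasSum (fun i : ℕ => ((i : ℝ) + K) * w i) (M * tpc K (N + 2) M / (N + 2)) := by
    have h := sum_mul_tpc (K := K) (N + 1) M
    rw [sum_antidiagonal_eq_shift (K := K) (by omega)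
      (fun k l => (k : ℝ) * (coeff k (tp K) * tpc K (N + 1) l)) fun k l h => by
        rw [coeff_tp_of_lt h, zero_mul, mul_zero]] at h
    have h' : (M : ℝ) * tpc K (N + 2) M / (N + 2) =
        ∑ i ∈ range (M - K + 1), ((i : ℝ) + K) * w i := by
      rw [div_eq_iff (by positivity), show N + 2 = N + 1 + 1 by ring, ← h]
      push_cast
      rw [mul_comm, show (N : ℝ) + 1 + 1 = N + 2 by ring]
      congr 1
      refine Finset.sum_congr rfl fun i hi => ?_
      simp only [hw]
      rw [if_pos (Finset.mem_range.1 hi), coeff_tp_add]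
    rw [h']
    exact hasSum_sum_of_ne_finset_zero fun i hi => by
      simp only [hw]
      rw [if_neg fun h => hi (Finset.mem_range.2 h), mul_zero]
  have hmlr : ∀ j k, j ≤ k → w k * (μ ^ (j + K) / ((j + K).factorial : ℝ)) ≤
      w j * (μ ^ (k + K) / ((k + K).factorial : ℝ)) := by
    intro j k hjk
    by_cases hk : k < M - K + 1
    · simp only [hw]
      rw [if_pos hk, if_pos (by omega)]
      have h := tpc_sub_le K (N + 1) (m := M - K - 1) (x := M - K - j) (d := k - j)
        (by rwa [show M - K - 1 + 1 = M - K by omega]) (by omega) (by omega)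
      rw [show M - K - 1 + 1 = M - K by omega, ← hμ,
        show M - K - j - (k - j) = M - K - k by omega] at h
      calc _ ≤ 1 / ((k + K).factorial : ℝ) * (μ ^ (k - j) * tpc K (N + 1) (M - K - j)) *
            (μ ^ (j + K) / ((j + K).factorial : ℝ)) := by gcongr
        _ = 1 / ((j + K).factorial : ℝ) * tpc K (N + 1) (M - K - j) *
            ((μ ^ (k - j) * μ ^ (j + K)) / ((k + K).factorial : ℝ)) := by ring
        _ = _ := by rw [← pow_add, show k - j + (j + K) = k + K by omega]
    · have : w k = 0 := if_neg hk
      rw [this, zero_mul]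
      exact mul_nonneg (hwnn j) (by positivity)
  have h := hasSum_mul_sub_ge (c := K) hmlr (hasSum_expTail K μ) hW (hasSum_mul_expTail hK μ) hW'
  have h01 := hmlr 0 1 zero_le_one
  unfold meanTP
  rw [div_le_div_iff₀ (by positivity) hE]
  have h2 : M * tpc K (N + 2) M / (N + 2) * expTail K μ ≤
      μ * expTail (K - 1) μ * tpc K (N + 2) M := by linarith
  rw [div_mul_eq_mul_div, div_le_iff₀ (by positivity)] at h2
  refine le_of_mul_le_mul_right ?_ hZ
  linarith

lemma ratio_le (hK : 1 ≤ K) (hN : 1 ≤ N) (hM : K * N < M) :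
    tpc K N (M - 1) / tpc K N M ≤ M / N := by
  have hZ : 0 < tpc K N M := tpc_pos hN hM.le
  obtain ⟨n, rfl⟩ := Nat.exists_eq_add_of_le' hN
  have h1 := mul_tpc hK n (M := M) (by nlinarith)
  have h2 := tpc_nonneg K n (M - K)
  rw [div_le_div_iff₀ hZ (by positivity)]
  have : 0 ≤ ((n : ℝ) + 1) / ((K - 1).factorial : ℝ) * tpc K n (M - K) := by positivity
  push_cast
  linarith

/-- The constant in the comparison of the coefficient ratio with the Poisson parameter. -/
noncomputable def ratioConst (K : ℕ) (y : ℝ) : ℝ := y + 2 * (K + 1) * y * Real.exp (3 * y)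

/-- The ratio of consecutive coefficients approximates the Poisson parameter to relative order
`1 / N`. -/
lemma ratio_sub_lambda (hK : 1 ≤ K) (hN : 1 ≤ N) (hM : K * N < M) {l : ℝ} (hl : 0 < l)
    (hml : meanTP K l = M / N) :
    (N : ℝ) * |tpc K N (M - 1) / tpc K N M - l| ≤ ratioConst K (M / N) := by
  have hN0 : (0 : ℝ) < N := by exact_mod_cast hN
  have hρ := ratio_le hK hN hM
  have hρ0 : 0 ≤ tpc K N (M - 1) / tpc K N M := div_nonneg (tpc_nonneg _ _ _) (tpc_nonneg _ _ _)
  have hly : l ≤ M / N := by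
    rw [← hml, meanTP_eq hK hl]
    have := mul_nonneg (Nat.cast_nonneg (α := ℝ) K) (atomTP_pos K hl).le
    linarith
  have hy0 : 0 < (M : ℝ) / N := hl.trans_le hly
  set y : ℝ := (M : ℝ) / N with hy
  have hC : 0 ≤ 2 * (K + 1) * y * Real.exp (3 * y) := by positivity
  -- For a single factor there is no predecessor to compare with, but both `ρ` and `l` lie in `[0,
  -- y]`.
  rcases Nat.lt_or_ge N 2 with h1 | h2
  · obtain rfl : N = 1 := by omega
    unfold ratioConst
    rw [Nat.cast_one, one_mul, abs_le]
    constructor <;> linarith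
  obtain ⟨n, rfl⟩ := Nat.exists_eq_add_of_le' h2
  have e : K * (n + 2) = K * (n + 1) + K := by ring
  have hZ : 0 < tpc K (n + 2) M := tpc_pos (by omega) hM.le
  have hZ1 : 0 < tpc K (n + 1) (M - K) := tpc_pos (by omega) (by omega)
  have ha := pred_ratio_mul_le (N := n) hK hM
  have hb := ratio_le_pred_ratio (N := n) hM
  set ρ := tpc K (n + 2) (M - 1) / tpc K (n + 2) M with hρdef
  obtain ⟨μ, hμ⟩ : ∃ μ, μ = tpc K (n + 1) (M - K - 1) / tpc K (n + 1) (M - K) := ⟨_, rfl⟩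
  have hμ0 : 0 < μ := hμ ▸ div_pos (tpc_pos (by omega) (by omega)) hZ1
  have hc := atomTP_le_ratio (N := n) hM hμ hμ0
  have hd := mean_le_meanTP_ratio (N := n) hK hM hμ hμ0
  rw [← hμ] at ha hb
  push_cast at hy hml hN0 ⊢
  rw [← hy] at hd
  -- The mean at `μ` is at least `y`, which is the mean at `l`.
  have hlμ : l ≤ μ := by
    by_contra hcon
    have := meanTP_strictMono hK hμ0 (not_le.1 hcon)
    linarith
  have hrec := mul_tpc hK (n + 1) (M := M) (by omega)
  have hyeq : y = ρ + K * (tpc K (n + 1) (M - K) / tpc K (n + 2) M / (K.factorial : ℝ)) := by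
    have hf : ((K - 1).factorial : ℝ) ≠ 0 := by positivity
    have hK0 : (K : ℝ) ≠ 0 := by positivity
    rw [hy, hρdef, factorial_pred_mul hK]
    push_cast at hrec
    rw [show n + 1 + 1 = n + 2 by ring] at hrec
    field_simp
    field_simp at hrec
    linarith
  -- Both means are a parameter plus `K` times an atom. The atoms compare favourably by `hc`, which
  -- leaves `μ - ρ`, and the variance inequality `ha` says `N (μ - ρ) ≤ μ`.
  have hmμ : ((n : ℝ) + 2) * (meanTP K μ - y) ≤ μ := by
    rw [meanTP_eq hK hμ0, hyeq]
    have := mul_le_mul_of_nonneg_left hc (Nat.cast_nonneg (α := ℝ) K)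
    have := mul_le_mul_of_nonneg_left this hN0.le
    linarith
  have hμ2 : μ ≤ 2 * y := by
    have hn : (0 : ℝ) ≤ n := Nat.cast_nonneg n
    have h3 : ((n : ℝ) + 1) * μ ≤ ((n : ℝ) + 1) * (2 * ρ) := by nlinarith
    have := le_of_mul_le_mul_left h3 (by positivity)
    linarith
  have hgap := meanTP_sub_ge hK hl hlμ
  have hup : ((n : ℝ) + 2) * (μ - l) ≤ 2 * (K + 1) * y * Real.exp (3 * y) := by
    have h1 : ((n : ℝ) + 2) * (Real.exp (-(l + μ)) * (μ - l) / (K + 1)) ≤ 2 * y := by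
      rw [hml] at hgap
      exact (mul_le_mul_of_nonneg_left hgap hN0.le).trans (hmμ.trans hμ2)
    -- The exponent `3 y` comes from `l ≤ y` and `μ ≤ 2 y`.
    have h2 : Real.exp (-(3 * y)) ≤ Real.exp (-(l + μ)) := Real.exp_le_exp.2 (by linarith)
    have h3 : ((n : ℝ) + 2) * (Real.exp (-(3 * y)) * (μ - l) / (K + 1)) ≤ 2 * y := by
      refine le_trans ?_ h1
      have : 0 ≤ μ - l := sub_nonneg.2 hlμ
      gcongr
    rw [Real.exp_neg] at h3
    have hexp := Real.exp_pos (3 * y)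
    have e3 : ((n : ℝ) + 2) * (μ - l) = ((n : ℝ) + 2) * ((Real.exp (3 * y))⁻¹ * (μ - l) / (K + 1)) *
        ((K + 1) * Real.exp (3 * y)) := by field_simp
    rw [e3]
    calc _ ≤ 2 * y * ((K + 1) * Real.exp (3 * y)) := by gcongr
      _ = _ := by ring
  -- From above, `ρ ≤ μ` and `hup` suffice. From below, `N (ρ - l) ≥ (N - 1) (μ - l) - l ≥ -y`,
  -- which explains the summand `y` of `ratioConst`.
  rw [← abs_of_pos hN0, ← abs_mul, abs_le]
  unfold ratioConst
  constructor
  · nlinarith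
  · nlinarith

end Ratio

end

section

open PowerSeries

/-! ### Moments of the degrees over a class fibre -/

section Moments

variable {S B : Type*} [Fintype S] [DecidableEq S] [Fintype B] [DecidableEq B]
  {K M : ℕ} {κ : B → ℕ}

lemma tight_le_card_heavy {φ : S → B} (hφ : φ ∈ classFiber S K κ) :
    tight K φ ≤ (heavy K κ).card := by
  unfold tight heavy
  refine Finset.card_le_card fun a ha => ?_
  have h1 := mem_classFiber.1 hφ a
  simp only [Finset.mem_filter, Finset.mem_univ, true_and] at ha ⊢
  omega

/-- The recursion `mul_tpc` converts the probability of degree exactly `K` into the ratio of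
consecutive coefficients. Only that ratio has to be compared with the Poisson parameter. -/
lemma mul_sum_tight (hK : 1 ≤ K) (hκ : ∀ a, κ a ≤ K)
    (hM : M + ∑ a ∈ (heavy K κ)ᶜ, κ a = Fintype.card S) (hN : 1 ≤ (heavy K κ).card)
    (hKM : K * (heavy K κ).card < M) :
    (K : ℝ) * ∑ φ ∈ classFiber S K κ, (tight K φ : ℝ) = (classFiber S K κ).card *
      (M - (heavy K κ).card * (tpc K (heavy K κ).card (M - 1) / tpc K (heavy K κ).card M)) := by
  have hKM' : K ≤ M := by nlinarith
  have hZ : 0 < tpc K (heavy K κ).card M := tpc_pos hN hKM.le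
  rw [sum_tight hκ hM hKM', card_classFiber hκ hM, factorial_pred_mul hK]
  obtain ⟨n, hn⟩ := Nat.exists_eq_add_of_le' hN
  have h := mul_tpc hK n hKM'
  rw [hn] at hZ ⊢
  have hK0 : (K : ℝ) ≠ 0 := by positivity
  have hf : ((K - 1).factorial : ℝ) ≠ 0 := by positivity
  have h' : (M : ℝ) - ((n + 1 : ℕ) : ℝ) * (tpc K (n + 1) (M - 1) / tpc K (n + 1) M) =
      (n + 1) / ((K - 1).factorial : ℝ) * tpc K n (M - K) / tpc K (n + 1) M := by
    rw [eq_div_iff hZ.ne']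
    push_cast
    have : (tpc K (n + 1) (M - 1) / tpc K (n + 1) M) * tpc K (n + 1) M = tpc K (n + 1) (M - 1) :=
      div_mul_cancel₀ _ hZ.ne'
    linear_combination h - (n + 1) * this
  rw [h']
  push_cast
  field_simp

/-- Write `T` for `tight` and `ρ` for the ratio. The second factorial moment of `T` involves a
coefficient with two factors less; `mul_tpc` and `ratio_le_pred_ratio` give `K E[T²] ≤ E[T] (M - (N
- 1) ρ)`. Hence `K T` has variance at most `K E[T] ρ ≤ K M`. With one heavy point the bound is `T ≤
1`. -/
lemma sum_tight_sq_le (hK : 1 ≤ K) (hκ : ∀ a, κ a ≤ K)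
    (hM : M + ∑ a ∈ (heavy K κ)ᶜ, κ a = Fintype.card S) (hN : 1 ≤ (heavy K κ).card)
    (hKM : K * (heavy K κ).card < M) :
    (K : ℝ) ^ 2 * ∑ φ ∈ classFiber S K κ, (tight K φ : ℝ) ^ 2 ≤ (classFiber S K κ).card *
      ((M - (heavy K κ).card *
        (tpc K (heavy K κ).card (M - 1) / tpc K (heavy K κ).card M)) ^ 2 + K * M) := by
  have hK0 : (0 : ℝ) < K := by exact_mod_cast hK
  have hmean := mul_sum_tight hK hκ hM hN hKM
  have hTN : ∑ φ ∈ classFiber S K κ, (tight K φ : ℝ) ≤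
      (classFiber S K κ).card * (heavy K κ).card := by
    rw [← nsmul_eq_mul]
    exact Finset.sum_le_card_nsmul _ _ _ fun φ hφ => by exact_mod_cast tight_le_card_heavy hφ
  have hρ := ratio_le hK hN hKM
  have hcard := card_classFiber hκ hM
  have hZ : 0 < tpc K (heavy K κ).card M := tpc_pos hN hKM.le
  have hcpos : (0 : ℝ) < (classFiber S K κ).card := by
    rw [hcard]; exact mul_pos (fiberConst_pos _ _) hZ
  have hMK : (K : ℝ) * (heavy K κ).card ≤ M := by exact_mod_cast hKM.le
  rcases Nat.lt_or_ge (heavy K κ).card 2 with h1 | h2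
  · have hN1 : (heavy K κ).card = 1 := by omega
    have h3 : ∑ φ ∈ classFiber S K κ, (tight K φ : ℝ) ^ 2 ≤ (classFiber S K κ).card := by
      have : ∀ φ ∈ classFiber S K κ, (tight K φ : ℝ) ^ 2 ≤ 1 := fun φ hφ => by
        have := tight_le_card_heavy hφ
        rw [hN1] at this
        have h' : (tight K φ : ℝ) ≤ 1 := by exact_mod_cast this
        exact pow_le_one₀ (Nat.cast_nonneg _) h'
      simpa using Finset.sum_le_card_nsmul _ _ _ this
    rw [hN1, Nat.cast_one, mul_one] at hMK
    calc (K : ℝ) ^ 2 * ∑ φ ∈ classFiber S K κ, (tight K φ : ℝ) ^ 2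
        ≤ (K : ℝ) ^ 2 * ((classFiber S K κ).card : ℝ) := by gcongr
      _ = ((classFiber S K κ).card : ℝ) * (K * K) := by ring
      _ ≤ _ := by
        gcongr
        have : (K : ℝ) * K ≤ K * M := by gcongr
        linarith [sq_nonneg ((M : ℝ) - (heavy K κ).card *
          (tpc K (heavy K κ).card (M - 1) / tpc K (heavy K κ).card M))]
  · have hM2 : K * 2 ≤ M := by nlinarith
    have hsq := sum_tight_sq hκ hM hM2
    have hsum := sum_tight hκ hM (show K ≤ M by omega)
    obtain ⟨n, hn⟩ := Nat.exists_eq_add_of_le' h2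
    have hb := ratio_le_pred_ratio (N := n) (by rw [← hn]; exact hKM)
    have hrec := mul_tpc hK n (M := M - K) (by omega)
    rw [hn] at hsq hsum hmean hTN hρ hcard hZ hKM ⊢
    set c := fiberConst S K κ
    have e : K * (n + 2) = K * (n + 1) + K := by ring
    have hZ1 : 0 < tpc K (n + 1) (M - K) := tpc_pos (by omega) (by omega)
    rw [show n + 2 - 1 = n + 1 by omega, show n + 2 - 2 = n by omega] at hsq
    rw [show n + 2 - 1 = n + 1 by omega] at hsum
    rw [show M - K - K = M - K * 2 by omega, Nat.cast_sub (by omega)] at hrec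
    set ρ := tpc K (n + 2) (M - 1) / tpc K (n + 2) M
    set Z1 := tpc K (n + 1) (M - K)
    set Z2 := tpc K n (M - K * 2)
    have hZμ : ρ * Z1 ≤ tpc K (n + 1) (M - K - 1) := (le_div_iff₀ hZ1).1 hb
    have hf : (K.factorial : ℝ) = K * ((K - 1).factorial : ℝ) := factorial_pred_mul hK
    have hf0 : (0 : ℝ) < (K - 1).factorial := by positivity
    set T1 := ∑ φ ∈ classFiber S K κ, (tight K φ : ℝ)
    set T2 := ∑ φ ∈ classFiber S K κ, (tight K φ : ℝ) ^ 2
    have hT1 : 0 ≤ T1 := Finset.sum_nonneg fun _ _ => Nat.cast_nonneg _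
    have hT2 : (K : ℝ) * T2 ≤ T1 * (M - (n + 1) * ρ) := by
      have h3 : ((n : ℝ) + 1) / ((K - 1).factorial : ℝ) * Z2 ≤
          (M - K - (n + 1) * ρ) * Z1 := by
        have : ((n : ℝ) + 1) * (ρ * Z1) ≤ (n + 1) * tpc K (n + 1) (M - K - 1) := by gcongr
        linarith
      rw [hsq, hsum, hf]
      have h4 : (K : ℝ) * (c * (((n + 2 : ℕ) : ℝ) * (1 / (K * ((K - 1).factorial : ℝ)) * Z1) +
          ((n + 2 : ℕ) : ℝ) * (((n + 2 : ℕ) : ℝ) - 1) *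
            ((1 / (K * ((K - 1).factorial : ℝ))) ^ 2 * Z2))) =
          c * (n + 2) / (K * ((K - 1).factorial : ℝ)) *
            (K * Z1 + (n + 1) / ((K - 1).factorial : ℝ) * Z2) := by
        push_cast
        field_simp
        ring
      rw [h4]
      have hc : 0 < c := fiberConst_pos _ _
      calc _ ≤ c * (n + 2) / (K * ((K - 1).factorial : ℝ)) *
            (K * Z1 + (M - K - (n + 1) * ρ) * Z1) := by gcongr
        _ = _ := by push_cast; field_simp; ring
    have hρ0 : 0 ≤ ρ := div_nonneg (tpc_nonneg _ _ _) (tpc_nonneg _ _ _)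
    push_cast at hmean hTN hρ ⊢
    have h5 : T1 * ρ ≤ (classFiber S K κ).card * M := by
      calc T1 * ρ ≤ ((classFiber S K κ).card * ((n : ℝ) + 2)) * (M / (n + 2)) := by gcongr
        _ = _ := by field_simp
    calc (K : ℝ) ^ 2 * T2 = K * (K * T2) := by ring
      _ ≤ K * (T1 * (M - (n + 1) * ρ)) := by gcongr
      _ = (K * T1) * (M - (n + 2) * ρ) + K * (T1 * ρ) := by ring
      _ ≤ (K * T1) * (M - (n + 2) * ρ) + K * ((classFiber S K κ).card * M) := by gcongr
      _ = _ := by rw [hmean]; ring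

variable {l : ℝ}

/-- The number of slots attached to points of degree exactly `K` is centred up to a constant. -/
lemma abs_sum_tight_sub_le (hK : 1 ≤ K) (hκ : ∀ a, κ a ≤ K)
    (hM : M + ∑ a ∈ (heavy K κ)ᶜ, κ a = Fintype.card S) (hN : 1 ≤ (heavy K κ).card)
    (hKM : K * (heavy K κ).card < M) (hl : 0 < l) (hml : meanTP K l = M / (heavy K κ).card) :
    |∑ φ ∈ classFiber S K κ, ((K : ℝ) * tight K φ - (M - (heavy K κ).card * l))| ≤
      ratioConst K (M / (heavy K κ).card) * (classFiber S K κ).card := by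
  have h := ratio_sub_lambda hK hN hKM hl hml
  have hmean := mul_sum_tight hK hκ hM hN hKM
  rw [Finset.sum_sub_distrib, ← Finset.mul_sum, hmean, Finset.sum_const, nsmul_eq_mul, ← mul_sub,
    abs_mul, abs_of_nonneg (Nat.cast_nonneg _), mul_comm (ratioConst _ _)]
  refine mul_le_mul_of_nonneg_left ?_ (Nat.cast_nonneg _)
  refine le_trans (le_of_eq ?_) h
  rw [← abs_of_nonneg (Nat.cast_nonneg (α := ℝ) (heavy K κ).card), ← abs_mul, ← abs_neg,
    abs_of_nonneg (Nat.cast_nonneg (α := ℝ) (heavy K κ).card)]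
  congr 1
  ring

lemma sum_tight_sub_sq_le (hK : 1 ≤ K) (hκ : ∀ a, κ a ≤ K)
    (hM : M + ∑ a ∈ (heavy K κ)ᶜ, κ a = Fintype.card S) (hN : 1 ≤ (heavy K κ).card)
    (hKM : K * (heavy K κ).card < M) (hl : 0 < l) (hml : meanTP K l = M / (heavy K κ).card) :
    ∑ φ ∈ classFiber S K κ, ((K : ℝ) * tight K φ - (M - (heavy K κ).card * l)) ^ 2 ≤
      (K * M + ratioConst K (M / (heavy K κ).card) ^ 2) * (classFiber S K κ).card := by
  have h := ratio_sub_lambda hK hN hKM hl hml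
  have hmean := mul_sum_tight hK hκ hM hN hKM
  have hsq := sum_tight_sq_le hK hκ hM hN hKM
  set N : ℝ := ((heavy K κ).card : ℝ)
  set ρ := tpc K (heavy K κ).card (M - 1) / tpc K (heavy K κ).card M
  have h2 : (N * (ρ - l)) ^ 2 ≤ ratioConst K (M / N) ^ 2 := by
    rw [← sq_abs, abs_mul, abs_of_nonneg (Nat.cast_nonneg _ : 0 ≤ N)]
    exact pow_le_pow_left₀ (by positivity) h 2
  have e : ∑ φ ∈ classFiber S K κ, ((K : ℝ) * tight K φ - (M - N * l)) ^ 2 =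
      (K : ℝ) ^ 2 * ∑ φ ∈ classFiber S K κ, (tight K φ : ℝ) ^ 2 -
        2 * (M - N * l) * (K * ∑ φ ∈ classFiber S K κ, (tight K φ : ℝ)) +
        (classFiber S K κ).card * (M - N * l) ^ 2 := by
    have hc : ((classFiber S K κ).card : ℝ) * (M - N * l) ^ 2 =
        ∑ _φ ∈ classFiber S K κ, (M - N * l) ^ 2 := by simp
    rw [hc, Finset.mul_sum, Finset.mul_sum, Finset.mul_sum, ← Finset.sum_sub_distrib, ← Finset.sum_add_distrib]
    exact Finset.sum_congr rfl fun φ _ => by ring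
  rw [e, hmean]
  have h3 := mul_le_mul_of_nonneg_left h2 (Nat.cast_nonneg (α := ℝ) (classFiber S K κ).card)
  nlinarith [h3, hsq]

/-- The sum counts ordered pairs of distinct slots on a common heavy point; it is `O(M)` for bounded
mean degree. Two applications of `mul_tpc`, at `M` and at `M - 1`, bound each of the three
coefficients. -/
lemma sum_deg_mul_pred_le (hK : 2 ≤ K) (hκ : ∀ a, κ a ≤ K)
    (hM : M + ∑ a ∈ (heavy K κ)ᶜ, κ a = Fintype.card S) (hN : 1 ≤ (heavy K κ).card)
    (hKM : K * (heavy K κ).card < M) :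
    ∑ φ ∈ classFiber S K κ, ∑ a ∈ heavy K κ, (deg φ a : ℝ) * (deg φ a - 1) ≤
      (2 * (M / (heavy K κ).card) + K) * M * (classFiber S K κ).card := by
  rw [Finset.sum_comm]
  have hN0 : (0 : ℝ) < (heavy K κ).card := by exact_mod_cast hN
  have hKM2 : K + 1 ≤ M := by nlinarith
  have key : ∀ a ∈ heavy K κ, ∑ φ ∈ classFiber S K κ, (deg φ a : ℝ) * (deg φ a - 1) ≤
      (2 * (M / (heavy K κ).card) + K) * (M / (heavy K κ).card) * (classFiber S K κ).card := by
    intro a ha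
    rw [sum_deg_mul_pred hK hκ hM hKM2 ha, card_classFiber hκ hM]
    have hZ : 0 < tpc K (heavy K κ).card M := tpc_pos hN hKM.le
    have hc : 0 < fiberConst S K κ := fiberConst_pos _ _
    obtain ⟨n, hn⟩ := Nat.exists_eq_add_of_le' hN
    rw [hn] at hZ hKM hN0 ⊢
    rw [Nat.add_sub_cancel]
    have h1 := mul_tpc (by omega : 1 ≤ K) n (M := M) (by omega)
    have h2 := mul_tpc (by omega : 1 ≤ K) n (M := M - 1) (by omega)
    rw [show M - 1 - 1 = M - 2 by omega, show M - 1 - K = M - (K + 1) by omega,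
      Nat.cast_sub (by omega)] at h2
    set y : ℝ := (M : ℝ) / ((n + 1 : ℕ) : ℝ) with hy
    set Z := tpc K (n + 1) M
    set Z' := tpc K (n + 1) (M - 1)
    have hF : ((K - 1).factorial : ℝ) = (K - 1) * ((K - 2).factorial : ℝ) := by
      obtain ⟨q, rfl⟩ := Nat.exists_eq_add_of_le' hK
      rw [show q + 2 - 1 = q + 1 by omega, show q + 2 - 2 = q by omega, Nat.factorial_succ]
      push_cast; ring
    have hyM : (M : ℝ) = y * (n + 1) := by rw [hy]; push_cast; field_simp
    have hn0 : (0 : ℝ) < (n : ℝ) + 1 := by positivity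
    have n1 := tpc_nonneg K (n + 1) (M - 2)
    have n2 := tpc_nonneg K n (M - (K + 1))
    have n3 := tpc_nonneg K n (M - K)
    have n4 : 0 ≤ Z' := tpc_nonneg K (n + 1) (M - 1)
    have hK1 : (0 : ℝ) < (K : ℝ) - 1 := by
      have : (2 : ℝ) ≤ K := by exact_mod_cast hK
      linarith
    have hf1 : (0 : ℝ) < (K - 1).factorial := by positivity
    have hf2 : (0 : ℝ) < (K - 2).factorial := by positivity
    have h1' : y * Z = Z' + 1 / ((K - 1).factorial : ℝ) * tpc K n (M - K) := by
      rw [hyM] at h1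
      have : ((n : ℝ) + 1) * (y * Z) =
          (n + 1) * (Z' + 1 / ((K - 1).factorial : ℝ) * tpc K n (M - K)) := by
        linear_combination h1
      exact mul_left_cancel₀ hn0.ne' this
    have h2' : tpc K (n + 1) (M - 2) + 1 / ((K - 1).factorial : ℝ) * tpc K n (M - (K + 1)) ≤
        y * Z' := by
      have : ((n : ℝ) + 1) * (tpc K (n + 1) (M - 2) +
          1 / ((K - 1).factorial : ℝ) * tpc K n (M - (K + 1))) ≤ (n + 1) * (y * Z') := by
        calc _ = ((M : ℝ) - (1 : ℕ)) * Z' := by rw [h2]; ring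
          _ ≤ M * Z' := by gcongr; simp
          _ = _ := by rw [hyM]; ring
      exact le_of_mul_le_mul_left this hn0
    have hy0 : 0 ≤ y := by positivity
    have h3 : Z' ≤ y * Z := by
      have : 0 ≤ 1 / ((K - 1).factorial : ℝ) * tpc K n (M - K) := by positivity
      linarith
    have h4 : 1 / ((K - 2).factorial : ℝ) * tpc K n (M - K) ≤ (K - 1) * (y * Z) := by
      have e1 : 1 / ((K - 2).factorial : ℝ) * tpc K n (M - K) =
          (K - 1) * (1 / ((K - 1).factorial : ℝ) * tpc K n (M - K)) := by
        rw [hF]; field_simp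
      rw [e1]
      exact mul_le_mul_of_nonneg_left (by linarith) hK1.le
    have h5 : y * Z' ≤ y * (y * Z) := by gcongr
    calc _ ≤ fiberConst S K κ * (y * (y * Z) + (K - 1) * (y * Z)) := by gcongr; linarith
      _ = (y + (K - 1)) * y * (fiberConst S K κ * Z) := by ring
      _ ≤ _ := by
        have : 0 < fiberConst S K κ * Z := by positivity
        gcongr <;> linarith
  calc _ ≤ ∑ a ∈ heavy K κ, (2 * ((M : ℝ) / (heavy K κ).card) + K) * (M / (heavy K κ).card) *
        (classFiber S K κ).card := Finset.sum_le_sum key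
    _ = _ := by rw [Finset.sum_const, nsmul_eq_mul]; field_simp

end Moments

end

/-! ### Maps with prescribed class counts -/

section ClassMaps

variable {S B : Type*} [Fintype S] [DecidableEq S] [Fintype B] [DecidableEq B]

/-- Exactly `ω i` points have degree `i` truncated at `K`, for `1 ≤ i ≤ K`. -/
def HasClassCounts (K : ℕ) (ω : ℕ → ℕ) (φ : S → B) : Prop :=
  ∀ i ∈ Icc 1 K, (univ.filter fun a => min (deg φ a) K = i).card = ω i

instance (K : ℕ) (ω : ℕ → ℕ) : DecidablePred (HasClassCounts (S := S) (B := B) K ω) := fun φ => by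
  unfold HasClassCounts; infer_instance

/-- The maps `S → B` with prescribed truncated degree counts. -/
def classMaps (S B : Type*) [Fintype S] [DecidableEq S] [Fintype B] [DecidableEq B] (K : ℕ)
    (ω : ℕ → ℕ) : Finset (S → B) :=
  univ.filter fun φ => HasClassCounts K ω φ

/-- The residual degree, truncated at `K`, of the point to which a slot is attached. -/
def slotType (K : ℕ) (φ : S → B) (s : S) : ℕ := min (deg φ (φ s) - 1) K

/-- The number of slots of a given type. -/
def slotCount (K : ℕ) (φ : S → B) (i : ℕ) : ℕ := (univ.filter fun s => slotType K φ s = i).card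

variable {K M : ℕ} {ω : ℕ → ℕ}

lemma mem_classMaps {φ : S → B} : φ ∈ classMaps S B K ω ↔
    ∀ i ∈ Icc 1 K, (univ.filter fun a => min (deg φ a) K = i).card = ω i := by
  simp [classMaps, HasClassCounts]

lemma sum_heavy_compl {κ : B → ℕ} (hκ : ∀ a, κ a ≤ K)
    (hω : ∀ i ∈ Icc 1 K, (univ.filter fun a => κ a = i).card = ω i) :
    ∑ a ∈ (heavy K κ)ᶜ, κ a = ∑ i ∈ Ico 1 K, i * ω i := by
  have h1 : ∑ a ∈ (heavy K κ)ᶜ, κ a = ∑ i ∈ range K, ∑ a ∈ (heavy K κ)ᶜ with κ a = i, κ a := by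
    refine (Finset.sum_fiberwise_of_maps_to (fun a ha => ?_) _).symm
    have : κ a ≠ K := by simpa [heavy] using ha
    exact Finset.mem_range.2 (lt_of_le_of_ne (hκ a) this)
  rw [h1, Finset.range_eq_Ico]
  have h2 : ∀ i ∈ Ico 0 K, ∑ a ∈ (heavy K κ)ᶜ with κ a = i, κ a =
      i * (univ.filter fun a => κ a = i).card := by
    intro i hi
    have e : (heavy K κ)ᶜ.filter (fun a => κ a = i) = univ.filter fun a => κ a = i := by
      ext a
      simp only [heavy, Finset.mem_filter, Finset.mem_compl, Finset.mem_univ, true_and,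
        and_iff_right_iff_imp]
      intro h
      have := (Finset.mem_Ico.1 hi).2
      omega
    rw [e, Finset.sum_congr rfl fun a ha => (Finset.mem_filter.1 ha).2, Finset.sum_const,
      smul_eq_mul, mul_comm]
  rw [Finset.sum_congr rfl h2]
  rcases Nat.eq_zero_or_pos K with rfl | hK
  · simp
  rw [Finset.sum_eq_sum_Ico_succ_bot hK, zero_mul, zero_add]
  refine Finset.sum_congr rfl fun i hi => ?_
  have := Finset.mem_Ico.1 hi
  rw [hω i (Finset.mem_Icc.2 ⟨by omega, by omega⟩)]

/-- To bound an average over `classMaps` it suffices to bound it over each class fibre. -/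
lemma sum_classMaps_le (f : (S → B) → ℝ) (c : ℝ)
    (h : ∀ κ : B → ℕ, (∀ a, κ a ≤ K) →
      (∀ i ∈ Icc 1 K, (univ.filter fun a => κ a = i).card = ω i) →
      ∑ φ ∈ classFiber S K κ, f φ ≤ c * (classFiber S K κ).card) :
    ∑ φ ∈ classMaps S B K ω, f φ ≤ c * (classMaps S B K ω).card := by
  classical
  set g : (S → B) → (B → ℕ) := fun φ a => min (deg φ a) K with hg
  have hfib : ∀ κ ∈ (classMaps S B K ω).image g,
      (classMaps S B K ω).filter (fun φ => g φ = κ) = classFiber S K κ ∧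
      (∀ a, κ a ≤ K) ∧ (∀ i ∈ Icc 1 K, (univ.filter fun a => κ a = i).card = ω i) := by
    intro κ hκ
    obtain ⟨φ₀, hφ₀, rfl⟩ := Finset.mem_image.1 hκ
    rw [mem_classMaps] at hφ₀
    refine ⟨?_, fun a => min_le_right _ _, hφ₀⟩
    ext φ
    rw [Finset.mem_filter, mem_classMaps, mem_classFiber]
    constructor
    · rintro ⟨-, h⟩ a
      exact congrFun h a
    · intro h
      have : g φ = g φ₀ := funext h
      refine ⟨fun i hi => ?_, this⟩
      rw [← hφ₀ i hi]
      congr 1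
      ext a
      have := congrFun this a
      simp only [hg] at this
      simp [this]
  rw [← Finset.sum_fiberwise_of_maps_to (fun φ hφ => Finset.mem_image_of_mem g hφ) f,
    Finset.card_eq_sum_card_image g]
  push_cast
  rw [Finset.mul_sum]
  refine Finset.sum_le_sum fun κ hκ => ?_
  rw [(hfib κ hκ).1]
  exact h κ (hfib κ hκ).2.1 (hfib κ hκ).2.2

lemma abs_sum_classMaps_le (f : (S → B) → ℝ) (c : ℝ)
    (h : ∀ κ : B → ℕ, (∀ a, κ a ≤ K) →
      (∀ i ∈ Icc 1 K, (univ.filter fun a => κ a = i).card = ω i) →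
      |∑ φ ∈ classFiber S K κ, f φ| ≤ c * (classFiber S K κ).card) :
    |∑ φ ∈ classMaps S B K ω, f φ| ≤ c * (classMaps S B K ω).card := by
  rw [abs_le']
  refine ⟨sum_classMaps_le f c fun κ h1 h2 => (le_abs_self _).trans (h κ h1 h2), ?_⟩
  rw [← Finset.sum_neg_distrib]
  refine sum_classMaps_le _ c fun κ h1 h2 => ?_
  rw [Finset.sum_neg_distrib]
  exact (neg_le_abs _).trans (h κ h1 h2)

lemma sum_deg (φ : S → B) : ∑ a, deg φ a = Fintype.card S := by
  unfold deg
  rw [← Finset.card_univ, Finset.card_eq_sum_card_fiberwise fun s _ => Finset.mem_univ (φ s)]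

lemma sum_comp_slot (φ : S → B) (f : B → ℝ) : ∑ s, f (φ s) = ∑ a, (deg φ a : ℝ) * f a := by
  rw [← Finset.sum_fiberwise_of_maps_to (fun s _ => Finset.mem_univ (φ s))]
  refine Finset.sum_congr rfl fun a _ => ?_
  rw [Finset.sum_congr rfl fun s hs => by rw [(Finset.mem_filter.1 hs).2], Finset.sum_const,
    nsmul_eq_mul, deg]

lemma deg_pos (φ : S → B) (s : S) : 1 ≤ deg φ (φ s) :=
  Finset.card_pos.2 ⟨s, by simp⟩

lemma slotCount_eq_mul (φ : S → B) {i : ℕ} (hi : i < K) :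
    (slotCount K φ i : ℝ) = (i + 1) * (univ.filter fun a => deg φ a = i + 1).card := by
  have h1 : (slotCount K φ i : ℝ) = ∑ s, (fun a => if deg φ a = i + 1 then (1 : ℝ) else 0) (φ s) := by
    rw [slotCount, Finset.card_filter]
    push_cast
    refine Finset.sum_congr rfl fun s _ => ?_
    have := deg_pos φ s
    unfold slotType
    by_cases h : deg φ (φ s) = i + 1
    · rw [if_pos (by omega), if_pos h]
    · rw [if_neg (by omega), if_neg h]
  rw [h1, sum_comp_slot φ fun a => if deg φ a = i + 1 then (1 : ℝ) else 0, Finset.card_filter]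
  push_cast
  rw [Finset.mul_sum]
  refine Finset.sum_congr rfl fun a _ => ?_
  split_ifs with h
  · rw [h]; push_cast; ring
  · simp

lemma sum_slotCount (φ : S → B) : ∑ i ∈ range (K + 1), slotCount K φ i = Fintype.card S := by
  unfold slotCount
  rw [← Finset.card_univ, Finset.card_eq_sum_card_fiberwise (f := slotType K φ) (t := range (K + 1))
    fun s _ => by
      have : slotType K φ s ≤ K := min_le_right _ _
      simp; omega]

lemma slotCount_of_lt {φ : S → B} (hφ : φ ∈ classMaps S B K ω) {i : ℕ} (hi : i + 1 < K) :
    (slotCount K φ i : ℝ) = (i + 1) * ω (i + 1) := by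
  rw [slotCount_eq_mul φ (by omega), ← mem_classMaps.1 hφ (i + 1) (by simp; omega)]
  congr 3
  ext a
  simp
  omega

lemma slotCount_pred (hK : 1 ≤ K) (φ : S → B) : (slotCount K φ (K - 1) : ℝ) = K * tight K φ := by
  rw [slotCount_eq_mul φ (by omega), tight, Nat.cast_sub hK, show K - 1 + 1 = K by omega]
  simp

/-- The type counts add up to the number of slots, so the top count is determined by the others. -/
lemma slotCount_top (hK : 1 ≤ K) (hM : M + ∑ i ∈ Ico 1 K, i * ω i = Fintype.card S) {φ : S → B}
    (hφ : φ ∈ classMaps S B K ω) : (slotCount K φ K : ℝ) = M - K * tight K φ := by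
  have h := sum_slotCount (K := K) φ
  rw [← hM] at h
  have h' : ∑ i ∈ range (K + 1), (slotCount K φ i : ℝ) = M + ∑ i ∈ Ico 1 K, (i : ℝ) * ω i := by
    exact_mod_cast h
  obtain ⟨k, rfl⟩ := Nat.exists_eq_add_of_le' hK
  rw [Finset.sum_range_succ, Finset.sum_range_succ] at h'
  have h2 := slotCount_pred hK φ
  rw [Nat.add_sub_cancel] at h2
  rw [h2, Finset.sum_congr rfl fun i hi => slotCount_of_lt hφ (i := i)
    (by have := Finset.mem_range.1 hi; omega), Finset.sum_Ico_eq_sum_range] at h'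
  rw [Nat.add_sub_cancel] at h'
  have e : ∑ x ∈ range k, ((x : ℝ) + 1) * ω (x + 1) =
      ∑ x ∈ range k, ((1 + x : ℕ) : ℝ) * ω (1 + x) :=
    Finset.sum_congr rfl fun x _ => by rw [add_comm x 1]; push_cast; ring
  rw [e] at h'
  linarith

/-! ### Exchangeability -/

lemma slotType_comp (φ : S → B) (σ : Equiv.Perm S) (s : S) :
    slotType K (φ ∘ σ) s = slotType K φ (σ s) := by
  unfold slotType
  rw [deg_comp_equiv]; rfl

lemma comp_mem_classMaps {φ : S → B} (hφ : φ ∈ classMaps S B K ω) (σ : Equiv.Perm S) :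
    φ ∘ σ ∈ classMaps S B K ω := by
  rw [mem_classMaps] at hφ ⊢
  simpa only [deg_comp_equiv] using hφ

lemma exists_perm_comp_eq {J : Type*} {s s' : J → S} (hs : Function.Injective s)
    (hs' : Function.Injective s') : ∃ σ : Equiv.Perm S, ∀ j, σ (s j) = s' j := by
  classical
  let e : {x // x ∈ Set.range s} ≃ {x // x ∈ Set.range s'} :=
    (Equiv.ofInjective s hs).symm.trans (Equiv.ofInjective s' hs')
  refine ⟨e.extendSubtype, fun j => ?_⟩
  rw [Equiv.extendSubtype_apply_of_mem e (s j) ⟨j, rfl⟩]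
  have : (⟨s j, ⟨j, rfl⟩⟩ : {x // x ∈ Set.range s}) = Equiv.ofInjective s hs j := rfl
  simp only [e, Equiv.trans_apply, this, Equiv.symm_apply_apply]
  rfl

/-- Equivariant events have the same number of elements along any two injective families. -/
lemma card_event_eq {J : Type*} (Q : (S → B) → (J → S) → Prop)
    [∀ φ s, Decidable (Q φ s)] (hQ : ∀ φ s (σ : Equiv.Perm S), Q (φ ∘ σ) s ↔ Q φ (σ ∘ s))
    {s s' : J → S} (hs : Function.Injective s) (hs' : Function.Injective s') :
    ((classMaps S B K ω).filter fun φ => Q φ s).card =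
      ((classMaps S B K ω).filter fun φ => Q φ s').card := by
  obtain ⟨σ, hσ⟩ := exists_perm_comp_eq hs hs'
  have hσ' : σ ∘ s = s' := funext hσ
  refine Finset.card_bij' (fun φ _ => φ ∘ σ.symm) (fun φ _ => φ ∘ σ) ?_ ?_ ?_ ?_
  · intro φ hφ
    rw [Finset.mem_filter] at hφ ⊢
    refine ⟨comp_mem_classMaps hφ.1 _, ?_⟩
    rw [hQ, ← hσ']
    convert hφ.2 using 2
    ext j; simp
  · intro φ hφ
    rw [Finset.mem_filter] at hφ ⊢
    refine ⟨comp_mem_classMaps hφ.1 _, ?_⟩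
    rw [hQ, hσ']
    exact hφ.2
  · intro φ _; ext x; simp
  · intro φ _; ext x; simp

/-- Double counting over injective families. -/
lemma card_event_mul_card {J : Type*} [Fintype J] [DecidableEq J] (Q : (S → B) → (J → S) → Prop)
    [∀ φ s, Decidable (Q φ s)] (hQ : ∀ φ s (σ : Equiv.Perm S), Q (φ ∘ σ) s ↔ Q φ (σ ∘ s))
    {s : J → S} (hs : Function.Injective s) :
    ((classMaps S B K ω).filter fun φ => Q φ s).card *
        (univ.filter fun s' : J → S => Function.Injective s').card =
      ∑ φ ∈ classMaps S B K ω,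
        (univ.filter fun s' : J → S => Function.Injective s' ∧ Q φ s').card := by
  rw [mul_comm, ← smul_eq_mul, ← Finset.sum_const,
    Finset.sum_congr rfl fun s' hs' => card_event_eq Q hQ hs (Finset.mem_filter.1 hs').2]
  simp only [Finset.card_filter]
  rw [Finset.sum_comm]
  refine Finset.sum_congr rfl fun φ _ => ?_
  rw [Finset.sum_filter]
  refine Finset.sum_congr rfl fun s' _ => ?_
  by_cases h : Function.Injective s' <;> simp [h]

end ClassMaps

/-- First order expansion of a product of perturbed factors in `[0, 1]`. -/
lemma exists_prod_expansion {J : Type*} (s : Finset J) (p c : J → ℝ)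
    (hp : ∀ j ∈ s, 0 ≤ p j ∧ p j ≤ 1) (hc : ∀ j ∈ s, |c j| ≤ 1) :
    ∃ r : ℝ, |r| ≤ s.card ∧ ∀ (U : ℝ) (y : J → ℝ),
      (∀ j ∈ s, y j = p j + c j * U ∧ 0 ≤ y j ∧ y j ≤ 1) →
      |∏ j ∈ s, y j - ∏ j ∈ s, p j - r * U| ≤ (s.card : ℝ) ^ 2 * U ^ 2 := by
  classical
  induction s using Finset.induction_on with
  | empty => exact ⟨0, by simp, fun U y _ => by simp⟩
  | insert a s ha ih =>
    obtain ⟨r, hr, h⟩ := ih (fun j hj => hp j (mem_insert_of_mem hj))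
      (fun j hj => hc j (mem_insert_of_mem hj))
    have hpa := hp a (mem_insert_self _ _)
    have hca := hc a (mem_insert_self _ _)
    have hP0 : 0 ≤ ∏ j ∈ s, p j := prod_nonneg fun j hj => (hp j (mem_insert_of_mem hj)).1
    have hP1 : ∏ j ∈ s, p j ≤ 1 := prod_le_one (fun j hj => (hp j (mem_insert_of_mem hj)).1)
      fun j hj => (hp j (mem_insert_of_mem hj)).2
    rw [card_insert_of_notMem ha]
    push_cast
    -- The slope is built from `p` and `c` before `U` is given. This order of quantifiers allows the
    -- linear term to be averaged over a random `U` later.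
    refine ⟨p a * r + c a * ∏ j ∈ s, p j, ?_, fun U y hy => ?_⟩
    · refine (abs_add_le _ _).trans ?_
      rw [abs_mul, abs_mul, abs_of_nonneg hpa.1, abs_of_nonneg hP0]
      have h1 : p a * |r| ≤ 1 * s.card := by gcongr; exact hpa.2
      have h2 : |c a| * ∏ j ∈ s, p j ≤ 1 * 1 := by gcongr
      linarith
    · rw [prod_insert ha, prod_insert ha]
      obtain ⟨hya, hya0, hya1⟩ := hy a (mem_insert_self _ _)
      have hs := h U y fun j hj => hy j (mem_insert_of_mem hj)
      have e : y a * ∏ j ∈ s, y j - p a * ∏ j ∈ s, p j - (p a * r + c a * ∏ j ∈ s, p j) * U =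
          y a * (∏ j ∈ s, y j - ∏ j ∈ s, p j - r * U) + c a * r * U ^ 2 := by
        rw [hya]; ring
      rw [e]
      refine (abs_add_le _ _).trans ?_
      rw [abs_mul, abs_mul, abs_mul, abs_of_nonneg hya0, abs_of_nonneg (sq_nonneg U)]
      have h1 : y a * |∏ j ∈ s, y j - ∏ j ∈ s, p j - r * U| ≤ 1 * ((s.card : ℝ) ^ 2 * U ^ 2) := by
        gcongr
      have h2 : |c a| * |r| * U ^ 2 ≤ 1 * s.card * U ^ 2 := by gcongr
      nlinarith [sq_nonneg U, mul_nonneg (Nat.cast_nonneg (α := ℝ) s.card) (sq_nonneg U)]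

/-! ### Type counts over all maps with prescribed class counts: moments and averaged products. -/

section Estimates

variable {S B : Type*} [Fintype S] [DecidableEq S] [Fintype B] [DecidableEq B]
  {K M : ℕ} {ω : ℕ → ℕ} {l : ℝ}

/-- The expected number of slots of type `i` in the Poisson approximation. -/
noncomputable def typeMean (K M : ℕ) (ω : ℕ → ℕ) (l : ℝ) (i : ℕ) : ℝ :=
  if i + 1 < K then (i + 1) * ω (i + 1) else if i + 1 = K then M - ω K * l else ω K * l

/-- The data of a degree profile in the supercritical range together with its Poisson parameter. -/
structure Profile (K M E : ℕ) (ω : ℕ → ℕ) (l : ℝ) : Prop where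
  two_le : 2 ≤ K
  one_le : 1 ≤ ω K
  lt : K * ω K < M
  sum_eq : M + ∑ i ∈ Ico 1 K, i * ω i = E
  l_pos : 0 < l
  mean_eq : meanTP K l = M / ω K

/-- Deviation of the number of slots attached to points of degree exactly `K`. -/
noncomputable def deviation (K M : ℕ) (ω : ℕ → ℕ) (l : ℝ) (φ : S → B) : ℝ :=
  K * tight K φ - (M - ω K * l)

section

variable {E : ℕ}

lemma Profile.l_mul_le (h : Profile K M E ω l) : ω K * l ≤ M := by
  have h1 := h.mean_eq
  have h2 : (0 : ℝ) < ω K := by exact_mod_cast h.one_le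
  rw [meanTP_eq (by linarith [h.two_le]) h.l_pos, eq_div_iff h2.ne'] at h1
  have := mul_nonneg (mul_nonneg (Nat.cast_nonneg (α := ℝ) K) (atomTP_pos K h.l_pos).le) h2.le
  nlinarith

lemma Profile.M_le (h : Profile K M E ω l) : M ≤ E := by
  have := h.sum_eq; omega

lemma Profile.E_pos (h : Profile K M E ω l) : 0 < E := by
  have := h.M_le
  have := h.lt
  omega

lemma typeMean_nonneg (h : Profile K M E ω l) (i : ℕ) : 0 ≤ typeMean K M ω l i := by
  unfold typeMean
  have := h.l_mul_le
  have := h.l_pos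
  split_ifs
  · positivity
  · linarith
  · positivity

lemma typeMean_le (h : Profile K M E ω l) (i : ℕ) : typeMean K M ω l i ≤ E := by
  have h1 := h.l_mul_le
  have h2 : (M : ℝ) ≤ E := by exact_mod_cast h.M_le
  have h3 := mul_nonneg (Nat.cast_nonneg (α := ℝ) (ω K)) h.l_pos.le
  unfold typeMean
  split_ifs with hi
  · have h4 : (i + 1) * ω (i + 1) ≤ ∑ i ∈ Ico 1 K, i * ω i :=
      Finset.single_le_sum (f := fun i => i * ω i) (fun _ _ => Nat.zero_le _)
        (Finset.mem_Ico.2 ⟨by omega, hi⟩)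
    have h5 : (i + 1) * ω (i + 1) ≤ E := by have := h.sum_eq; omega
    exact_mod_cast h5
  · linarith
  · linarith

end

/-- A single random variable drives all type counts: it enters types `K - 1` and `K` with opposite
signs and no other type. -/
lemma slotCount_eq_typeMean (h : Profile K M (Fintype.card S) ω l) {φ : S → B}
    (hφ : φ ∈ classMaps S B K ω) {i : ℕ} (hi : i ≤ K) :
    (slotCount K φ i : ℝ) = typeMean K M ω l i +
      (if i + 1 < K then 0 else if i + 1 = K then 1 else -1) * deviation K M ω l φ := by
  have hK : 1 ≤ K := by linarith [h.two_le]
  unfold typeMean deviation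
  split_ifs with h1 h2
  · rw [slotCount_of_lt hφ h1]; ring
  · obtain rfl : i = K - 1 := by omega
    rw [slotCount_pred hK]; ring
  · obtain rfl : i = K := by omega
    rw [slotCount_top hK h.sum_eq hφ]; ring

lemma slotCount_le (φ : S → B) (i : ℕ) : slotCount K φ i ≤ Fintype.card S :=
  Finset.card_le_univ _

lemma card_heavy_eq (hK : 1 ≤ K) {κ : B → ℕ}
    (hω : ∀ i ∈ Icc 1 K, (univ.filter fun a => κ a = i).card = ω i) :
    (heavy K κ).card = ω K := hω K (Finset.mem_Icc.2 ⟨hK, le_rfl⟩)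

lemma abs_sum_deviation_le (h : Profile K M (Fintype.card S) ω l) :
    |∑ φ ∈ classMaps S B K ω, deviation K M ω l φ| ≤
      ratioConst K (M / ω K) * (classMaps S B K ω).card := by
  have hK : 1 ≤ K := by linarith [h.two_le]
  refine abs_sum_classMaps_le _ _ fun κ hκ hω => ?_
  have hc := card_heavy_eq hK hω
  have hM := h.sum_eq
  rw [← sum_heavy_compl hκ hω] at hM
  have h1 := h.one_le
  have h2 := h.lt
  have h3 := h.mean_eq
  unfold deviation
  rw [← hc] at h1 h2 h3 ⊢
  exact abs_sum_tight_sub_le hK hκ hM h1 h2 h.l_pos h3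

lemma sum_deviation_sq_le (h : Profile K M (Fintype.card S) ω l) :
    ∑ φ ∈ classMaps S B K ω, deviation K M ω l φ ^ 2 ≤
      (K * M + ratioConst K (M / ω K) ^ 2) * (classMaps S B K ω).card := by
  have hK : 1 ≤ K := by linarith [h.two_le]
  refine sum_classMaps_le _ _ fun κ hκ hω => ?_
  have hc := card_heavy_eq hK hω
  have hM := h.sum_eq
  rw [← sum_heavy_compl hκ hω] at hM
  have h1 := h.one_le
  have h2 := h.lt
  have h3 := h.mean_eq
  unfold deviation
  rw [← hc] at h1 h2 h3 ⊢
  exact sum_tight_sub_sq_le hK hκ hM h1 h2 h.l_pos h3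

lemma sum_sum_deg_mul_pred_le (h : Profile K M (Fintype.card S) ω l) :
    ∑ φ ∈ classMaps S B K ω, ∑ a, (deg φ a : ℝ) * (deg φ a - 1) ≤
      (2 * (M / ω K) + 2 * K) * Fintype.card S * (classMaps S B K ω).card := by
  have hK : 1 ≤ K := by linarith [h.two_le]
  refine sum_classMaps_le _ _ fun κ hκ hω => ?_
  have hc := card_heavy_eq hK hω
  have hM := h.sum_eq
  have hME : (M : ℝ) ≤ Fintype.card S := by exact_mod_cast h.M_le
  rw [← sum_heavy_compl hκ hω] at hM
  have h1 := h.one_le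
  have h2 := h.lt
  rw [← hc] at h1 h2 ⊢
  have h3 := sum_deg_mul_pred_le h.two_le hκ hM h1 h2
  -- Outside the heavy points the degree is below `K`, so one factor is bounded and the other sums
  -- to at most the number of slots.
  have h4 : ∀ φ ∈ classFiber S K κ, ∑ a, (deg φ a : ℝ) * (deg φ a - 1) ≤
      ∑ a ∈ heavy K κ, (deg φ a : ℝ) * (deg φ a - 1) + K * Fintype.card S := by
    intro φ hφ
    rw [← Finset.sum_add_sum_compl (heavy K κ)]
    gcongr
    rw [← sum_deg φ]
    push_cast
    rw [Finset.mul_sum]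
    calc _ ≤ ∑ a ∈ (heavy K κ)ᶜ, (K : ℝ) * deg φ a := Finset.sum_le_sum fun a ha => by
            have e1 := mem_classFiber.1 hφ a
            have e2 : κ a ≠ K := by simpa [heavy] using ha
            have e3 : deg φ a ≤ K := by omega
            have e4 : (deg φ a : ℝ) ≤ K := by exact_mod_cast e3
            have e5 : (0 : ℝ) ≤ deg φ a := Nat.cast_nonneg _
            nlinarith
      _ ≤ _ := Finset.sum_le_sum_of_subset_of_nonneg (Finset.subset_univ _)
            fun a _ _ => by positivity
  calc _ ≤ ∑ φ ∈ classFiber S K κ, (∑ a ∈ heavy K κ, (deg φ a : ℝ) * (deg φ a - 1) +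
          K * Fintype.card S) := Finset.sum_le_sum h4
    _ = ∑ φ ∈ classFiber S K κ, ∑ a ∈ heavy K κ, (deg φ a : ℝ) * (deg φ a - 1) +
          (K * Fintype.card S) * (classFiber S K κ).card := by
        rw [Finset.sum_add_distrib, Finset.sum_const, nsmul_eq_mul, mul_comm (_ * _ : ℝ)]
    _ ≤ (2 * (M / (heavy K κ).card) + K) * Fintype.card S * (classFiber S K κ).card +
          (K * Fintype.card S) * (classFiber S K κ).card := by
        gcongr
        refine h3.trans ?_
        gcongr
    _ = _ := by ring

/-- The constant in the estimate of the joint law of `q` slot types. -/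
noncomputable def typeConst (K q : ℕ) (y : ℝ) : ℝ :=
  q * ratioConst K y + (q : ℝ) ^ 2 * (K + ratioConst K y ^ 2)

/-- Expand the product in powers of `deviation / E`. The linear term averages to `O(1/E)` because
the deviation is centred up to `O(1)`, and the quadratic remainder is `O(1/E)` because its mean
square is `O(E)`. Bounding the deviation by its size alone would give only the order `E^{-1/2}`. -/
lemma abs_sum_prod_slotCount_sub_le (h : Profile K M (Fintype.card S) ω l) {J : Type*} [Fintype J]
    (t : J → ℕ) (ht : ∀ j, t j ≤ K) :
    |∑ φ ∈ classMaps S B K ω, ∏ j, ((slotCount K φ (t j) : ℝ) / Fintype.card S) -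
        (classMaps S B K ω).card * ∏ j, (typeMean K M ω l (t j) / Fintype.card S)| ≤
      typeConst K (Fintype.card J) (M / ω K) / Fintype.card S * (classMaps S B K ω).card := by
  set E : ℝ := (Fintype.card S : ℝ) with hE
  have hE0 : 0 < E := by rw [hE]; exact_mod_cast h.E_pos
  have hE1 : 1 ≤ E := by rw [hE]; exact_mod_cast h.E_pos
  set q := Fintype.card J
  set C := ratioConst K (M / ω K)
  set n : ℝ := ((classMaps S B K ω).card : ℝ)
  obtain ⟨r, hr, hexp⟩ := exists_prod_expansion (univ : Finset J)
    (fun j => typeMean K M ω l (t j) / E)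
    (fun j => if t j + 1 < K then 0 else if t j + 1 = K then 1 else -1)
    (fun j _ => ⟨div_nonneg (typeMean_nonneg h _) hE0.le,
      (div_le_one hE0).2 (typeMean_le h _)⟩)
    (fun j _ => by split_ifs <;> simp)
  have h1 : ∀ φ ∈ classMaps S B K ω,
      |∏ j, ((slotCount K φ (t j) : ℝ) / E) - ∏ j, (typeMean K M ω l (t j) / E) -
        r * (deviation K M ω l φ / E)| ≤ (q : ℝ) ^ 2 * (deviation K M ω l φ / E) ^ 2 := by
    intro φ hφ
    refine hexp _ _ fun j _ => ⟨?_, by positivity, ?_⟩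
    · rw [slotCount_eq_typeMean h hφ (ht j)]
      ring
    · rw [div_le_one hE0, hE]
      exact_mod_cast slotCount_le φ (t j)
  have hd1 := abs_sum_deviation_le (B := B) h
  have hd2 := sum_deviation_sq_le (B := B) h
  have e : ∑ φ ∈ classMaps S B K ω, ∏ j, ((slotCount K φ (t j) : ℝ) / E) -
      n * ∏ j, (typeMean K M ω l (t j) / E) =
      ∑ φ ∈ classMaps S B K ω, (∏ j, ((slotCount K φ (t j) : ℝ) / E) -
        ∏ j, (typeMean K M ω l (t j) / E) - r * (deviation K M ω l φ / E)) +
      r / E * ∑ φ ∈ classMaps S B K ω, deviation K M ω l φ := by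
    rw [Finset.mul_sum, ← Finset.sum_add_distrib]
    have : n * ∏ j, (typeMean K M ω l (t j) / E) =
        ∑ _φ ∈ classMaps S B K ω, ∏ j, (typeMean K M ω l (t j) / E) := by simp [n]
    rw [this, ← Finset.sum_sub_distrib]
    exact Finset.sum_congr rfl fun φ _ => by ring
  rw [e]
  refine (abs_add_le _ _).trans ?_
  have hA : |∑ φ ∈ classMaps S B K ω, (∏ j, ((slotCount K φ (t j) : ℝ) / E) -
        ∏ j, (typeMean K M ω l (t j) / E) - r * (deviation K M ω l φ / E))| ≤
      (q : ℝ) ^ 2 * (K + C ^ 2) / E * n := by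
    calc _ ≤ ∑ φ ∈ classMaps S B K ω, (q : ℝ) ^ 2 * (deviation K M ω l φ / E) ^ 2 :=
          (Finset.abs_sum_le_sum_abs _ _).trans (Finset.sum_le_sum h1)
      _ = (q : ℝ) ^ 2 / E ^ 2 * ∑ φ ∈ classMaps S B K ω, deviation K M ω l φ ^ 2 := by
          rw [Finset.mul_sum]; exact Finset.sum_congr rfl fun φ _ => by ring
      _ ≤ (q : ℝ) ^ 2 / E ^ 2 * ((K * M + C ^ 2) * n) := by gcongr
      _ ≤ (q : ℝ) ^ 2 / E ^ 2 * ((K * E + C ^ 2 * E) * n) := by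
          have hME : (M : ℝ) ≤ E := by rw [hE]; exact_mod_cast h.M_le
          gcongr
          nlinarith [sq_nonneg C]
      _ = _ := by field_simp
  have hB : |r / E * ∑ φ ∈ classMaps S B K ω, deviation K M ω l φ| ≤ q * C / E * n := by
    rw [abs_mul, abs_div, abs_of_pos hE0]
    have hr' : |r| ≤ q := by simpa [q] using hr
    calc _ ≤ (q : ℝ) / E * (C * n) := by gcongr
      _ = _ := by ring
  refine (add_le_add hA hB).trans (le_of_eq ?_)
  unfold typeConst
  ring

/-! ### The law of the slot types along an injective family -/

/-- Overwriting the entry at `y` by an arbitrary slot loses nothing, since it was equal to the entry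
at `x`. The constraint at `o` survives because `y ≠ o`. -/
lemma card_mul_card_collision_le {J : Type*} [Fintype J] [DecidableEq J] (Λ : Finset S) (o : J)
    {x y : J} (hxy : x ≠ y) (hy : y ≠ o) :
    (univ.filter fun s : J → S => s o ∈ Λ ∧ s x = s y).card * Fintype.card S ≤
      (univ.filter fun s : J → S => s o ∈ Λ).card := by
  rw [← Finset.card_univ (α := S), ← Finset.card_product]
  refine Finset.card_le_card_of_injOn (fun z => Function.update z.1 y z.2) ?_ ?_
  · rintro ⟨s, v⟩ hz
    simp only [Finset.coe_product, Set.mem_prod, Finset.mem_coe, Finset.mem_filter,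
      Finset.mem_univ, true_and, and_true] at hz ⊢
    rw [Function.update_of_ne hy.symm]
    exact hz.1
  · rintro ⟨s, v⟩ hz ⟨s', v'⟩ hz' heq
    simp only [Finset.coe_product, Set.mem_prod, Finset.mem_coe, Finset.mem_filter,
      Finset.mem_univ, true_and, and_true] at hz hz'
    simp only at heq
    have hne : ∀ j, j ≠ y → s j = s' j := fun j hj => by
      have := congrFun heq j
      rwa [Function.update_of_ne hj, Function.update_of_ne hj] at this
    have hv : v = v' := by simpa using congrFun heq y
    have hs : s = s' := by
      funext j
      by_cases hj : j = y
      · rw [hj, ← hz.2, ← hz'.2]; exact hne x hxy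
      · exact hne j hj
    rw [hs, hv]

lemma card_noninjective_le {J : Type*} [Fintype J] [DecidableEq J] (Λ : Finset S) (o : J) :
    (univ.filter fun s : J → S => s o ∈ Λ ∧ ¬ Function.Injective s).card * Fintype.card S ≤
      Fintype.card J ^ 2 * (univ.filter fun s : J → S => s o ∈ Λ).card := by
  have hsub : (univ.filter fun s : J → S => s o ∈ Λ ∧ ¬ Function.Injective s) ⊆
      ((univ : Finset (J × J)).filter fun x => x.1 ≠ x.2 ∧ x.2 ≠ o).biUnion fun x =>
        univ.filter fun s : J → S => s o ∈ Λ ∧ s x.1 = s x.2 := by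
    intro s hs
    simp only [Finset.mem_filter, Finset.mem_univ, true_and] at hs
    obtain ⟨h1, h2⟩ := hs
    unfold Function.Injective at h2
    push Not at h2
    obtain ⟨x, y, hxy, hne⟩ := h2
    simp only [Finset.mem_biUnion, Finset.mem_filter, Finset.mem_univ, true_and]
    -- The second index of the pair is the one to be overwritten, so the pair is swapped when that
    -- index is `o`.
    by_cases hy : y = o
    · exact ⟨(y, x), ⟨hne.symm, fun hx => hne (hx.trans hy.symm)⟩, h1, hxy.symm⟩
    · exact ⟨(x, y), ⟨hne, hy⟩, h1, hxy⟩
  calc _ ≤ (∑ x ∈ (univ : Finset (J × J)).filter fun x => x.1 ≠ x.2 ∧ x.2 ≠ o,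
        (univ.filter fun s : J → S => s o ∈ Λ ∧ s x.1 = s x.2).card) * Fintype.card S :=
        Nat.mul_le_mul_right _ ((Finset.card_le_card hsub).trans Finset.card_biUnion_le)
    _ ≤ ∑ x ∈ (univ : Finset (J × J)).filter fun x => x.1 ≠ x.2 ∧ x.2 ≠ o,
        (univ.filter fun s : J → S => s o ∈ Λ).card := by
        rw [Finset.sum_mul]
        refine Finset.sum_le_sum fun x hx => ?_
        have := (Finset.mem_filter.1 hx).2
        exact card_mul_card_collision_le Λ o this.1 this.2
    _ ≤ _ := by
        rw [Finset.sum_const, smul_eq_mul]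
        refine Nat.mul_le_mul_right _ ((Finset.card_filter_le _ _).trans ?_)
        rw [Finset.card_univ, Fintype.card_prod, sq]

end Estimates

/-! ### Joint law of the types of several slots, and slots attached to a common point. -/

section Events

variable {S B : Type*} [Fintype S] [DecidableEq S] [Fintype B] [DecidableEq B]
  {K M : ℕ} {ω : ℕ → ℕ} {l : ℝ}

lemma slotCount_zero (hK : 2 ≤ K) {φ : S → B} (hφ : φ ∈ classMaps S B K ω) :
    slotCount K φ 0 = ω 1 := by
  have := slotCount_of_lt hφ (i := 0) (by omega)
  have h : (slotCount K φ 0 : ℝ) = ω 1 := by simpa using this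
  exact_mod_cast h

lemma card_filter_pi_option {J : Type*} [Fintype J] [DecidableEq J] (Λ : Finset S) :
    (univ.filter fun s : Option J → S => s none ∈ Λ).card =
      Λ.card * Fintype.card S ^ Fintype.card J := by
  have : (univ.filter fun s : Option J → S => s none ∈ Λ) =
      Fintype.piFinset fun x : Option J => x.elim Λ fun _ => univ := by
    ext s
    simp only [Finset.mem_filter, Finset.mem_univ, true_and, Fintype.mem_piFinset]
    constructor
    · intro h x
      cases x <;> simp [h]
    · intro h
      exact h none
  rw [this, Fintype.card_piFinset, Fintype.prod_option]
  simp

lemma card_filter_types {J : Type*} [Fintype J] [DecidableEq J] (φ : S → B) (t : J → ℕ) :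
    (univ.filter fun s : Option J → S =>
      slotType K φ (s none) = 0 ∧ ∀ j, slotType K φ (s (some j)) = t j).card =
      slotCount K φ 0 * ∏ j, slotCount K φ (t j) := by
  have : (univ.filter fun s : Option J → S =>
      slotType K φ (s none) = 0 ∧ ∀ j, slotType K φ (s (some j)) = t j) =
      Fintype.piFinset fun x : Option J => univ.filter fun v => slotType K φ v = x.elim 0 t := by
    ext s
    simp only [Finset.mem_filter, Finset.mem_univ, true_and, Fintype.mem_piFinset]
    constructor
    · rintro ⟨h1, h2⟩ x
      cases x with
      | none => simpa using h1
      | some j => simpa using h2 j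
    · intro h
      exact ⟨by simpa using h none, fun j => by simpa using h (some j)⟩
  rw [this, Fintype.card_piFinset, Fintype.prod_option]
  rfl

/-- A given slot is a leaf with probability `ω 1 / E`, by exchangeability. The error estimates keep
this factor, so that it cancels against the uniform choice of a leaf. -/
lemma card_leaf_slot_mul (hK : 2 ≤ K) (v : S) :
    ((classMaps S B K ω).filter fun φ => slotType K φ v = 0).card * Fintype.card S =
      (classMaps S B K ω).card * ω 1 := by
  have h := card_event_mul_card (B := B) (K := K) (ω := ω) (J := Unit)
    (fun φ s => slotType K φ (s ()) = 0)
    (fun φ s σ => by rw [slotType_comp]; rfl) (s := fun _ => v) (Function.injective_of_subsingleton _)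
  have h1 : (univ.filter fun s' : Unit → S => Function.Injective s').card = Fintype.card S := by
    rw [Finset.filter_true_of_mem fun s _ => Function.injective_of_subsingleton s]
    simp
  have h2 : ∀ φ ∈ classMaps S B K ω, (univ.filter fun s' : Unit → S =>
      Function.Injective s' ∧ slotType K φ (s' ()) = 0).card = ω 1 := by
    intro φ hφ
    rw [← slotCount_zero hK hφ, slotCount]
    refine Finset.card_bij' (fun s _ => s ()) (fun v _ => fun _ => v) ?_ ?_ ?_ ?_
    · intro s hs; simpa using (Finset.mem_filter.1 hs).2.2
    · intro v hv
      simp only [Finset.mem_filter, Finset.mem_univ, true_and] at hv ⊢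
      exact ⟨Function.injective_of_subsingleton _, hv⟩
    · intro s _; rfl
    · intro v _; rfl
  rw [h1, Finset.sum_congr rfl h2, Finset.sum_const, smul_eq_mul] at h
  exact h

/-- Double counting of the families of slots with prescribed types. -/
lemma exists_card_types_eq (hK : 2 ≤ K) {J : Type*} [Fintype J] [DecidableEq J]
    {s : Option J → S} (hs : Function.Injective s) (t : J → ℕ) :
    ∃ I F G : ℕ, I + F = Fintype.card S ^ (Fintype.card J + 1) ∧
      ((classMaps S B K ω).filter fun φ =>
        slotType K φ (s none) = 0 ∧ ∀ j, slotType K φ (s (some j)) = t j).card * I + G =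
        ∑ φ ∈ classMaps S B K ω, ω 1 * ∏ j, slotCount K φ (t j) ∧
      G * Fintype.card S ≤ (Fintype.card J + 1) ^ 2 * (ω 1 * Fintype.card S ^ Fintype.card J) *
        (classMaps S B K ω).card ∧
      ((classMaps S B K ω).filter fun φ =>
        slotType K φ (s none) = 0 ∧ ∀ j, slotType K φ (s (some j)) = t j).card * F *
          Fintype.card S ≤
        (Fintype.card J + 1) ^ 2 * (ω 1 * Fintype.card S ^ Fintype.card J) *
          (classMaps S B K ω).card := by
  set q := Fintype.card J
  set Ψ := classMaps S B K ω
  set Q : (S → B) → (Option J → S) → Prop := fun φ s =>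
    slotType K φ (s none) = 0 ∧ ∀ j, slotType K φ (s (some j)) = t j with hQ
  have hdc := card_event_mul_card (B := B) (K := K) (ω := ω) Q
    (fun φ s σ => by simp only [hQ, slotType_comp]; rfl) hs
  have hAE : (Ψ.filter fun φ => Q φ s).card * Fintype.card S ≤ Ψ.card * ω 1 := by
    rw [← card_leaf_slot_mul (B := B) (ω := ω) hK (s none)]
    exact Nat.mul_le_mul_right _ (Finset.card_le_card
      (Finset.monotone_filter_right _ fun φ _ hφ => hφ.1))
  have hsplit : ∀ φ ∈ Ψ, (univ.filter fun s' : Option J → S => Function.Injective s' ∧ Q φ s').card +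
      (univ.filter fun s' : Option J → S => ¬ Function.Injective s' ∧ Q φ s').card =
      ω 1 * ∏ j, slotCount K φ (t j) := by
    intro φ hφ
    rw [← slotCount_zero hK hφ, ← card_filter_types φ t,
      ← Finset.card_filter_add_card_filter_not (s := univ.filter fun s' : Option J → S => Q φ s')
        (fun s' => Function.Injective s'), Finset.filter_filter, Finset.filter_filter]
    simp only [and_comm]
  have hnoninj : ∀ φ ∈ Ψ,
      (univ.filter fun s' : Option J → S => ¬ Function.Injective s' ∧ Q φ s').card *
        Fintype.card S ≤ (q + 1) ^ 2 * (ω 1 * Fintype.card S ^ q) := by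
    intro φ hφ
    have h1 := card_noninjective_le (univ.filter fun v => slotType K φ v = 0) (none : Option J)
    rw [card_filter_pi_option, Fintype.card_option] at h1
    have h2 : (univ.filter fun v => slotType K φ v = 0).card = ω 1 := slotCount_zero hK hφ
    rw [h2] at h1
    refine le_trans (Nat.mul_le_mul_right _ (Finset.card_le_card ?_)) h1
    refine Finset.monotone_filter_right _ fun s' _ hs' => ?_
    exact ⟨by simpa using hs'.2.1, hs'.1⟩
  have hnall : (univ.filter fun s' : Option J → S => ¬ Function.Injective s').card *
      Fintype.card S ≤ (q + 1) ^ 2 * Fintype.card S ^ (q + 1) := by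
    have h1 := card_noninjective_le (univ : Finset S) (none : Option J)
    rw [card_filter_pi_option, Fintype.card_option, Finset.card_univ] at h1
    simp only [Finset.mem_univ, true_and] at h1
    rwa [pow_succ' (Fintype.card S)]
  -- `I` and `F` count the injective and the non-injective families. `G` counts the non-injective
  -- families with the right types, summed over the maps.
  refine ⟨(univ.filter fun s' : Option J → S => Function.Injective s').card,
    (univ.filter fun s' : Option J → S => ¬ Function.Injective s').card,
    ∑ φ ∈ Ψ, (univ.filter fun s' : Option J → S => ¬ Function.Injective s' ∧ Q φ s').card,
    ?_, ?_, ?_, ?_⟩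
  · rw [Finset.card_filter_add_card_filter_not, Finset.card_univ, Fintype.card_fun,
      Fintype.card_option]
  · rw [hdc, ← Finset.sum_add_distrib]
    exact Finset.sum_congr rfl hsplit
  · rw [Finset.sum_mul, mul_comm _ Ψ.card, ← smul_eq_mul Ψ.card]
    exact Finset.sum_le_card_nsmul _ _ _ hnoninj
  · generalize (Ψ.filter fun φ => Q φ s).card = A at hAE
    generalize (univ.filter fun s' : Option J → S => ¬ Function.Injective s').card = F at hnall
    calc A * F * Fintype.card S = A * (F * Fintype.card S) := by ring
      _ ≤ A * ((q + 1) ^ 2 * Fintype.card S ^ (q + 1)) := Nat.mul_le_mul_left _ hnall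
      _ = (q + 1) ^ 2 * Fintype.card S ^ q * (A * Fintype.card S) := by ring
      _ ≤ (q + 1) ^ 2 * Fintype.card S ^ q * (Ψ.card * ω 1) := Nat.mul_le_mul_left _ hAE
      _ = _ := by ring

/-- The joint law of the types of the slots of an injective family, one of which is attached to a
point of degree one. -/
lemma abs_card_types_sub_le (h : Profile K M (Fintype.card S) ω l) {J : Type*} [Fintype J]
    [DecidableEq J] {s : Option J → S} (hs : Function.Injective s) (t : J → ℕ)
    (ht : ∀ j, t j ≤ K) :
    |(((classMaps S B K ω).filter fun φ =>
        slotType K φ (s none) = 0 ∧ ∀ j, slotType K φ (s (some j)) = t j).card : ℝ) -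
      ω 1 * (classMaps S B K ω).card *
        (∏ j, (typeMean K M ω l (t j) / Fintype.card S)) / Fintype.card S| ≤
      ω 1 * (classMaps S B K ω).card / (Fintype.card S : ℝ) ^ 2 *
        (((Fintype.card J : ℝ) + 1) ^ 2 + typeConst K (Fintype.card J) (M / ω K)) := by
  obtain ⟨I, F, G, hall, htot, hGE, hFA⟩ := exists_card_types_eq (B := B) (ω := ω) h.two_le hs t
  have htype := abs_sum_prod_slotCount_sub_le (B := B) h t ht
  have hE0 : (0 : ℝ) < Fintype.card S := by exact_mod_cast h.E_pos
  generalize ((classMaps S B K ω).filter fun φ =>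
    slotType K φ (s none) = 0 ∧ ∀ j, slotType K φ (s (some j)) = t j).card = A at htot hFA ⊢
  have htot' : (A : ℝ) * I + G = ω 1 * (Fintype.card S : ℝ) ^ Fintype.card J *
      ∑ φ ∈ classMaps S B K ω, ∏ j, ((slotCount K φ (t j) : ℝ) / Fintype.card S) := by
    have : ((A * I + G : ℕ) : ℝ) = _ := congrArg (Nat.cast (R := ℝ)) htot
    push_cast at this
    rw [this, Finset.mul_sum]
    refine Finset.sum_congr rfl fun φ _ => ?_
    rw [Finset.prod_div_distrib, Finset.prod_const, Finset.card_univ, mul_assoc,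
      mul_div_cancel₀ _ (pow_ne_zero _ hE0.ne')]
  have hall' : (I : ℝ) + F = (Fintype.card S : ℝ) ^ (Fintype.card J + 1) := by exact_mod_cast hall
  have hGE' : (G : ℝ) * Fintype.card S ≤ ((Fintype.card J : ℝ) + 1) ^ 2 *
      (ω 1 * (Fintype.card S : ℝ) ^ Fintype.card J) * (classMaps S B K ω).card := by
    exact_mod_cast hGE
  have hFA' : (A : ℝ) * F * Fintype.card S ≤ ((Fintype.card J : ℝ) + 1) ^ 2 *
      (ω 1 * (Fintype.card S : ℝ) ^ Fintype.card J) * (classMaps S B K ω).card := by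
    exact_mod_cast hFA
  generalize ∏ j, (typeMean K M ω l (t j) / Fintype.card S) = P at htype ⊢
  generalize ∑ φ ∈ classMaps S B K ω, ∏ j, ((slotCount K φ (t j) : ℝ) / Fintype.card S) = Y
    at htype htot'
  generalize typeConst K (Fintype.card J) (M / ω K) = TC at htype ⊢
  generalize ((classMaps S B K ω).card : ℝ) = n at htype hGE' hFA' ⊢
  generalize (Fintype.card S : ℝ) = E at *
  generalize Fintype.card J = q at *
  have hmain : |(A : ℝ) * E ^ (q + 1) - ω 1 * E ^ q * Y| ≤ (q + 1) ^ 2 * (ω 1 * E ^ q) * n / E := by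
    rw [← htot', ← hall', show (A : ℝ) * (I + F) - (A * I + G) = A * F - G by ring, le_div_iff₀ hE0,
      ← abs_of_pos hE0, ← abs_mul, abs_of_pos hE0, sub_mul, abs_le]
    have : 0 ≤ (A : ℝ) * F * E := by positivity
    have : 0 ≤ (G : ℝ) * E := by positivity
    constructor <;> linarith
  have hfin : |(A : ℝ) * E ^ (q + 1) - ω 1 * E ^ q * (n * P)| ≤
      (q + 1) ^ 2 * (ω 1 * E ^ q) * n / E + ω 1 * E ^ q * (TC / E * n) := by
    have e : (A : ℝ) * E ^ (q + 1) - ω 1 * E ^ q * (n * P) =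
        ((A : ℝ) * E ^ (q + 1) - ω 1 * E ^ q * Y) + ω 1 * E ^ q * (Y - n * P) := by ring
    rw [e]
    refine (abs_add_le _ _).trans (add_le_add hmain ?_)
    rw [abs_mul, abs_of_nonneg (by positivity : (0 : ℝ) ≤ ω 1 * E ^ q)]
    exact mul_le_mul_of_nonneg_left htype (by positivity)
  have e3 : (A : ℝ) - ω 1 * n * P / E =
      ((A : ℝ) * E ^ (q + 1) - ω 1 * E ^ q * (n * P)) / E ^ (q + 1) := by
    rw [pow_succ]
    field_simp
  rw [e3, abs_div, abs_of_pos (pow_pos hE0 _), div_le_iff₀ (pow_pos hE0 _)]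
  refine hfin.trans (le_of_eq ?_)
  rw [pow_succ]
  field_simp
  ring

lemma card_pairs (φ : S → B) :
    ((univ.filter fun x : S × S => x.1 ≠ x.2 ∧ φ x.1 = φ x.2).card : ℝ) =
      ∑ a, (deg φ a : ℝ) * (deg φ a - 1) := by
  rw [← sum_comp_slot φ fun a => (deg φ a : ℝ) - 1, Finset.card_filter]
  push_cast
  rw [← Finset.univ_product_univ, Finset.sum_product]
  refine Finset.sum_congr rfl fun x _ => ?_
  have h1 : (univ.filter fun y => φ y = φ x).erase x = univ.filter fun y => x ≠ y ∧ φ x = φ y := by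
    ext y
    simp only [Finset.mem_erase, Finset.mem_filter, Finset.mem_univ, true_and]
    exact ⟨fun h => ⟨h.1.symm, h.2.symm⟩, fun h => ⟨h.1.symm, h.2.symm⟩⟩
  have h2 := Finset.card_erase_of_mem (s := univ.filter fun y => φ y = φ x) (a := x) (by simp)
  rw [h1] at h2
  have h3 : ((univ.filter fun y => x ≠ y ∧ φ x = φ y).card : ℝ) = (deg φ (φ x) : ℝ) - 1 := by
    rw [h2]
    change (((deg φ (φ x)) - 1 : ℕ) : ℝ) = _
    rw [Nat.cast_sub (deg_pos φ x), Nat.cast_one]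
  rw [← h3, Finset.card_filter]
  push_cast
  rfl

/-- Two further slots are rarely attached to the same point. -/
lemma card_collision_le (h : Profile K M (Fintype.card S) ω l) {s : Fin 3 → S}
    (hs : Function.Injective s) :
    (((classMaps S B K ω).filter fun φ =>
        slotType K φ (s 0) = 0 ∧ φ (s 1) = φ (s 2)).card : ℝ) ≤
      ω 1 * (classMaps S B K ω).card / (Fintype.card S : ℝ) ^ 2 * (9 * (M / ω K + K)) := by
  set E : ℝ := (Fintype.card S : ℝ) with hE
  have hE3 : 3 ≤ Fintype.card S := by simpa using Fintype.card_le_of_injective s hs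
  have hE3' : 3 ≤ E := by rw [hE]; exact_mod_cast hE3
  have hE0 : 0 < E := by linarith
  set Ψ := classMaps S B K ω
  set Q : (S → B) → (Fin 3 → S) → Prop := fun φ s =>
    slotType K φ (s 0) = 0 ∧ φ (s 1) = φ (s 2) with hQ
  have hdc := card_event_mul_card (B := B) (K := K) (ω := ω) Q
    (fun φ s σ => by simp only [hQ, slotType_comp]; rfl) hs
  set A := (Ψ.filter fun φ => Q φ s).card with hA
  have hI : (univ.filter fun s' : Fin 3 → S => Function.Injective s').card =
      (Fintype.card S).descFactorial 3 := by
    rw [← Fintype.card_subtype, Fintype.card_congr (Equiv.subtypeInjectiveEquivEmbedding (Fin 3) S),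
      Fintype.card_embedding_eq, Fintype.card_fin]
  -- Three distinct slots exist, so `E ≥ 3`, and `(E - 1) (E - 2) ≥ 2 E² / 9` with equality at `E =
  -- 3`. This is the origin of the factor `9`.
  have hI2 : 2 * E ^ 3 / 9 ≤ ((Fintype.card S).descFactorial 3 : ℝ) := by
    have : (Fintype.card S).descFactorial 3 =
        (Fintype.card S - 2) * ((Fintype.card S - 1) * Fintype.card S) := by
      simp [Nat.descFactorial_succ]
    rw [this]
    push_cast [Nat.cast_sub (show 2 ≤ Fintype.card S by omega),
      Nat.cast_sub (show 1 ≤ Fintype.card S by omega)]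
    rw [← hE]
    have : 2 * E ^ 2 / 9 ≤ (E - 2) * (E - 1) := by nlinarith
    nlinarith
  have hφ : ∀ φ ∈ Ψ, ((univ.filter fun s' : Fin 3 → S => Function.Injective s' ∧ Q φ s').card : ℝ) ≤
      ω 1 * ∑ a, (deg φ a : ℝ) * (deg φ a - 1) := by
    intro φ hφ
    rw [← card_pairs, ← slotCount_zero h.two_le hφ, slotCount, ← Nat.cast_mul,
      ← Finset.card_product]
    refine Nat.cast_le.2 (Finset.card_le_card_of_injOn (fun s' => (s' 0, (s' 1, s' 2))) ?_ ?_)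
    · intro s' hs'
      simp only [Finset.coe_filter, Finset.mem_univ, true_and, Set.mem_ofPred_eq] at hs'
      simp only [Finset.coe_product, Set.mem_prod, Finset.mem_coe, Finset.mem_filter,
        Finset.mem_univ, true_and]
      exact ⟨hs'.2.1, fun h12 => absurd (hs'.1 h12) (by decide), hs'.2.2⟩
    · intro s₁ _ s₂ _ heq
      simp only [Prod.mk.injEq] at heq
      funext j
      fin_cases j
      · exact heq.1
      · exact heq.2.1
      · exact heq.2.2
  have hsum := sum_sum_deg_mul_pred_le (B := B) h
  have hdc' : (A : ℝ) * ((Fintype.card S).descFactorial 3 : ℝ) ≤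
      ω 1 * ((2 * (M / ω K) + 2 * K) * E * Ψ.card) := by
    have : ((A * (univ.filter fun s' : Fin 3 → S => Function.Injective s').card : ℕ) : ℝ) = _ :=
      congrArg (Nat.cast (R := ℝ)) hdc
    rw [hI] at this
    push_cast at this
    rw [this]
    refine (Finset.sum_le_sum hφ).trans ?_
    rw [← Finset.mul_sum]
    gcongr
  have h1 : (A : ℝ) * (2 * E ^ 3 / 9) ≤ ω 1 * ((2 * (M / ω K) + 2 * K) * E * Ψ.card) :=
    (mul_le_mul_of_nonneg_left hI2 (Nat.cast_nonneg _)).trans hdc'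
  have e : ω 1 * Ψ.card / E ^ 2 * (9 * (M / ω K + K)) =
      ω 1 * ((2 * (M / ω K) + 2 * K) * E * Ψ.card) / (2 * E ^ 3 / 9) := by
    field_simp
  rw [e, le_div_iff₀ (by positivity)]
  exact h1

end Events

section

open PowerSeries

/-! ### The asymptotic kernel as an image of a product law -/

/-- The change of the degree counts when a v-node of degree `ℓ` is removed, `q i` of whose edges
lead to c-nodes of residual degree `i` (truncated at `K`), all of them distinct. -/
def displacement {K L : ℕ} (ℓ : Finset.Icc 3 L) (q : ℕ → ℤ) : State K L ℤ :=
  (fun j => (if (j : ℕ) < K then q j else 0) - q (j - 1), fun j => if j = ℓ then -1 else 0)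

/-- Type counts of a family of slots supplemented by a slot of type `0`. -/
def leafCounts {K : ℕ} {J : Type*} [Fintype J] (t : J → Fin (K + 1)) (i : ℕ) : ℤ :=
  (if i = 0 then 1 else 0) + ((univ.filter fun j => (t j : ℕ) = i).card : ℤ)

/-! ### Recovering the type counts from a change of the degree counts. -/

section QQ

variable {K : ℕ} (ℓ : ℕ) (u : Finset.Icc 1 K → ℤ)

lemma qq_pred (hK : 1 ≤ K) : qq ℓ u (K - 1) = -u ⟨K, Finset.mem_Icc.2 ⟨hK, le_rfl⟩⟩ := by
  unfold qq
  rw [if_pos (by omega)]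
  have : (univ.filter fun j : Finset.Icc 1 K => K - 1 < (j : ℕ)) =
      {⟨K, Finset.mem_Icc.2 ⟨hK, le_rfl⟩⟩} := by
    ext ⟨j, hj⟩
    have := Finset.mem_Icc.1 hj
    simp only [Finset.mem_filter, Finset.mem_univ, true_and, Finset.mem_singleton, Subtype.mk.injEq]
    omega
  rw [this, Finset.sum_singleton]

lemma qq_eq_sub {i : ℕ} (hi : i + 1 < K) :
    qq ℓ u i = qq ℓ u (i + 1) - u ⟨i + 1, Finset.mem_Icc.2 ⟨by omega, hi.le⟩⟩ := by
  unfold qq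
  rw [if_pos (by omega), if_pos hi]
  have : (univ.filter fun j : Finset.Icc 1 K => i < (j : ℕ)) =
      insert ⟨i + 1, Finset.mem_Icc.2 ⟨by omega, hi.le⟩⟩
        (univ.filter fun j : Finset.Icc 1 K => i + 1 < (j : ℕ)) := by
    ext ⟨j, hj⟩
    simp only [Finset.mem_filter, Finset.mem_univ, true_and, Finset.mem_insert, Subtype.mk.injEq]
    omega
  rw [this, Finset.sum_insert (by simp)]
  ring

lemma sum_qq : ∑ i ∈ range (K + 1), qq ℓ u i = ℓ := by
  rw [Finset.sum_range_succ]
  have h : ∑ i ∈ range K, qq ℓ u i = -∑ j : Finset.Icc 1 K, ((j : ℕ) : ℤ) * u j := by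
    have h1 : ∀ i ∈ range K, qq ℓ u i = -∑ j : Finset.Icc 1 K, if i < (j : ℕ) then u j else 0 := by
      intro i hi
      rw [qq, if_pos (Finset.mem_range.1 hi), Finset.sum_filter]
    rw [Finset.sum_congr rfl h1, Finset.sum_neg_distrib, Finset.sum_comm]
    congr 1
    refine Finset.sum_congr rfl fun j _ => ?_
    rw [← Finset.sum_filter, Finset.sum_const, nsmul_eq_mul]
    congr 2
    have : (range K).filter (fun i => i < (j : ℕ)) = range j := by
      ext i
      have := (Finset.mem_Icc.1 j.2).2
      simp only [Finset.mem_filter, Finset.mem_range]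
      omega
    rw [this, Finset.card_range]
  rw [h]
  unfold qq
  rw [if_neg (lt_irrefl K)]
  ring

/-- The displacement telescopes when summed from the top class downwards. It does not see `q K`,
because a c-node with residual degree at least `K` stays in its class; the total number `ℓ` of slots
supplies that entry. -/
lemma qq_of_displacement (hK : 1 ≤ K) (q : ℕ → ℤ) (hq : ∑ i ∈ range (K + 1), q i = ℓ)
    (hu : ∀ j : Finset.Icc 1 K, u j = (if (j : ℕ) < K then q j else 0) - q (j - 1)) :
    ∀ i ≤ K, qq ℓ u i = q i := by
  have h1 : ∀ d i, i + d + 1 = K → qq ℓ u i = q i := by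
    intro d
    induction d with
    | zero =>
      intro i hi
      obtain rfl : i = K - 1 := by omega
      rw [qq_pred ℓ u hK, hu]
      simp
    | succ d ih =>
      intro i hi
      rw [qq_eq_sub ℓ u (by omega), ih (i + 1) (by omega), hu]
      rw [if_pos (by simp only; omega)]
      simp
  intro i hi
  rcases lt_or_eq_of_le hi with h | rfl
  · exact h1 (K - 1 - i) i (by omega)
  · have h2 := sum_qq ℓ u
    rw [← hq, Finset.sum_range_succ, Finset.sum_range_succ, Finset.sum_congr rfl fun j hj =>
      h1 (i - 1 - j) j (by have := Finset.mem_range.1 hj; omega)] at h2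
    linarith

lemma displacement_qq {L : ℕ} (hK : 1 ≤ K) (ℓ' : Finset.Icc 3 L) (Δz : State K L ℤ)
    (h2 : ∀ i, Δz.2 i = if i = ℓ' then -1 else 0) (q : ℕ → ℤ)
    (hq : ∀ i ≤ K, q i = qq ℓ Δz.1 i) : displacement ℓ' q = Δz := by
  unfold displacement
  refine Prod.ext (funext fun j => ?_) (funext fun j => (h2 j).symm)
  obtain ⟨j, hj⟩ := j
  have hj' := Finset.mem_Icc.1 hj
  simp only
  rw [hq (j - 1) (by omega)]
  split_ifs with h
  · rw [hq j hj'.2]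
    have := qq_eq_sub ℓ Δz.1 (i := j - 1) (by omega)
    simp only [show j - 1 + 1 = j by omega] at this
    rw [this]; ring
  · obtain rfl : j = K := by omega
    rw [qq_pred ℓ Δz.1 hK]; ring

end QQ

lemma leafCounts_nonneg {K : ℕ} {J : Type*} [Fintype J] (t : J → Fin (K + 1)) (i : ℕ) :
    0 ≤ leafCounts t i := by unfold leafCounts; positivity

lemma sum_leafCounts {K : ℕ} {J : Type*} [Fintype J] (t : J → Fin (K + 1)) :
    ∑ i ∈ range (K + 1), leafCounts t i = Fintype.card J + 1 := by
  unfold leafCounts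
  rw [Finset.sum_add_distrib, Finset.sum_ite_eq' (range (K + 1)) 0 fun _ => (1 : ℤ)]
  rw [if_pos (by simp), ← Nat.cast_sum, ← Finset.card_eq_sum_card_fiberwise (s := univ)
    (f := fun j => (t j : ℕ)) (t := range (K + 1)) fun j _ => by have := (t j).2; simp; omega,
    Finset.card_univ]
  ring

lemma prod_comp_type {K : ℕ} {J : Type*} [Fintype J] (t : J → Fin (K + 1)) (p : ℕ → ℝ) :
    ∏ j, p (t j) = ∏ i : Fin (K + 1), p i ^ deg t i := by
  rw [← Finset.prod_fiberwise_of_maps_to (fun j _ => Finset.mem_univ (t j))]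
  refine Finset.prod_congr rfl fun a _ => ?_
  rw [Finset.prod_congr rfl fun j hj => by rw [(Finset.mem_filter.1 hj).2], Finset.prod_const, deg]

/-- The number of maps with prescribed fibre sizes. -/
lemma card_deg_eq_multinomial {K : ℕ} {J : Type*} [Fintype J] [DecidableEq J] (e : ℕ → ℕ)
    (he : ∑ i ∈ range (K + 1), e i = Fintype.card J) :
    (univ.filter fun t : J → Fin (K + 1) => ∀ i, deg t i = e i).card =
      Nat.multinomial (range (K + 1)) e := by
  -- Indicator weights turn each generating function into a monomial, so the exponential formula
  -- returns the multinomial coefficient.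
  have h := sum_prod_deg (S := J) (B := Fin (K + 1)) fun b k => if k = e b then (1 : ℝ) else 0
  have h1 : ∀ t : J → Fin (K + 1), ∏ b, (if deg t b = e b then (1 : ℝ) else 0) =
      if ∀ i, deg t i = e i then 1 else 0 := by
    intro t
    split_ifs with hall
    · exact Finset.prod_eq_one fun b _ => if_pos (hall b)
    · push Not at hall
      obtain ⟨b, hb⟩ := hall
      exact Finset.prod_eq_zero (Finset.mem_univ b) (if_neg hb)
  have h2 : ∏ b : Fin (K + 1), egf (fun k => if k = e b then (1 : ℝ) else 0) =
      C (∏ i ∈ range (K + 1), (1 / ((e i).factorial : ℝ))) * X ^ (∑ i ∈ range (K + 1), e i) := by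
    rw [map_prod, ← Finset.prod_pow_eq_pow_sum, ← Finset.prod_mul_distrib, Finset.prod_range]
    refine Finset.prod_congr rfl fun b _ => ?_
    ext k
    rw [coeff_egf, coeff_C_mul, coeff_X_pow]
    split_ifs with hk
    · rw [hk, mul_one]
    · simp
  rw [h2, he, coeff_C_mul, coeff_X_pow, if_pos rfl, mul_one, Finset.sum_congr rfl fun t _ => h1 t]
    at h
  have h3 := Nat.multinomial_spec (range (K + 1)) e
  rw [he] at h3
  have h4 : ((univ.filter fun t : J → Fin (K + 1) => ∀ i, deg t i = e i).card : ℝ) =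
      (Nat.multinomial (range (K + 1)) e : ℝ) := by
    rw [Finset.card_filter]
    push_cast
    rw [h, ← h3]
    push_cast
    rw [mul_right_comm, ← Finset.prod_mul_distrib, Finset.prod_eq_one, one_mul]
    intro i _
    have : ((e i).factorial : ℝ) ≠ 0 := by positivity
    field_simp
  exact_mod_cast h4

/-- The conditional kernel given the degree of the removed v-node. -/
noncomputable def kernelTerm {K L : ℕ} (p : ℕ → ℝ) (ℓ : Finset.Icc 3 L) (Δz : State K L ℤ) : ℝ :=
  if (∀ i, Δz.2 i = if i = ℓ then -1 else 0) ∧ 1 ≤ qq (ℓ : ℕ) Δz.1 0 ∧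
      (∀ i ∈ Finset.Icc 1 K, 0 ≤ qq (ℓ : ℕ) Δz.1 i) then
    (Nat.multinomial (Finset.range (K + 1)) (expo (ℓ : ℕ) Δz.1) : ℝ) *
      ∏ i ∈ Finset.range (K + 1), p i ^ expo (ℓ : ℕ) Δz.1 i
  else 0

lemma asymKernel_eq {K L : ℕ} (x : State K L ℝ) (Δz : State K L ℤ) :
    asymKernel x Δz = ∑ ℓ : Finset.Icc 3 L,
      ((ℓ : ℕ) : ℝ) * x.2 ℓ / totalDeg x.2 * kernelTerm (pp x) ℓ Δz := by
  unfold asymKernel kernelTerm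
  refine Finset.sum_congr rfl fun ℓ _ => ?_
  split_ifs
  · rw [mul_assoc]
  · rw [mul_zero]

lemma deg_eq_card {K : ℕ} {J : Type*} [Fintype J] (t : J → Fin (K + 1)) (i : Fin (K + 1)) :
    deg t i = (univ.filter fun j => (t j : ℕ) = i).card := by
  unfold deg
  simp only [Fin.ext_iff]

/-- The kernel term is the image of `ℓ - 1` independent types of law `p`. The type vectors leading
to a given `Δz` are those with type counts `expo`; there are multinomially many and they have equal
weight. This form gives the total mass and is the one compared with the exact kernel. -/
lemma sum_types_eq_kernelTerm {K L : ℕ} (hK : 1 ≤ K) {J : Type*} [Fintype J] [DecidableEq J]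
    (p : ℕ → ℝ) (ℓ : Finset.Icc 3 L) (hJ : Fintype.card J + 1 = (ℓ : ℕ)) (Δz : State K L ℤ) :
    ∑ t : J → Fin (K + 1), (if displacement ℓ (leafCounts t) = Δz then ∏ j, p (t j) else 0) =
      kernelTerm p ℓ Δz := by
  have hfwd : ∀ t : J → Fin (K + 1), displacement ℓ (leafCounts t) = Δz →
      (∀ i, Δz.2 i = if i = ℓ then -1 else 0) ∧ ∀ i ≤ K, qq ℓ Δz.1 i = leafCounts t i := by
    intro t ht
    refine ⟨fun i => by rw [← ht]; rfl, ?_⟩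
    refine qq_of_displacement ℓ Δz.1 hK _ (by rw [sum_leafCounts, ← hJ]; push_cast; rfl) fun j => ?_
    rw [← ht]; rfl
  have h0 : ∀ t : J → Fin (K + 1), 1 ≤ leafCounts t 0 := fun t => by
    unfold leafCounts; simp
  unfold kernelTerm
  split_ifs with hcond
  · obtain ⟨hτ, hq0, hqi⟩ := hcond
    -- The extra unit at `0` is the chosen leaf slot itself, whose type is not random.
    have hexpo : ∀ i ≤ K, ((if i = 0 then 1 else 0) : ℤ) + (expo ℓ Δz.1 i : ℤ) = qq ℓ Δz.1 i := by
      intro i hi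
      unfold expo
      split_ifs with h
      · rw [h, Int.toNat_of_nonneg (by omega)]; ring
      · rw [Int.toNat_of_nonneg (hqi i (Finset.mem_Icc.2 ⟨by omega, hi⟩))]; ring
    have hiff : ∀ t : J → Fin (K + 1), displacement ℓ (leafCounts t) = Δz ↔
        ∀ i, deg t i = expo ℓ Δz.1 i := by
      intro t
      constructor
      · intro ht i
        have h1 := (hfwd t ht).2 i (Nat.lt_succ_iff.1 i.2)
        have h2 := hexpo i (Nat.lt_succ_iff.1 i.2)
        rw [h1, leafCounts, ← deg_eq_card] at h2
        have := add_left_cancel h2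
        exact_mod_cast this.symm
      · intro ht
        refine displacement_qq ℓ hK ℓ Δz hτ _ fun i hi => ?_
        have h1 := ht ⟨i, by omega⟩
        rw [deg_eq_card] at h1
        simp only at h1
        rw [← hexpo i hi, leafCounts, h1]
    have hsum : ∑ i ∈ range (K + 1), expo ℓ Δz.1 i = Fintype.card J := by
      have h1 : ∑ i ∈ range (K + 1), (((if i = 0 then 1 else 0) : ℤ) + (expo ℓ Δz.1 i : ℤ)) = ℓ := by
        rw [← sum_qq (ℓ : ℕ) Δz.1]
        exact Finset.sum_congr rfl fun i hi => hexpo i (by have := Finset.mem_range.1 hi; omega)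
      rw [Finset.sum_add_distrib, Finset.sum_ite_eq' (range (K + 1)) 0 fun _ => (1 : ℤ),
        if_pos (by simp)] at h1
      have hJ' : (Fintype.card J : ℤ) + 1 = (ℓ : ℕ) := by exact_mod_cast hJ
      have : (∑ i ∈ range (K + 1), (expo ℓ Δz.1 i : ℤ)) = Fintype.card J := by linarith
      exact_mod_cast this
    rw [← card_deg_eq_multinomial _ hsum, Finset.card_filter]
    push_cast
    rw [Finset.sum_mul]
    refine Finset.sum_congr rfl fun t _ => ?_
    by_cases h : ∀ i, deg t i = expo ℓ Δz.1 i
    · rw [if_pos ((hiff t).2 h), if_pos h, one_mul, prod_comp_type, Finset.prod_range]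
      exact Finset.prod_congr rfl fun i _ => by rw [h i]
    · rw [if_neg fun h' => h ((hiff t).1 h'), if_neg h, zero_mul]
  · refine Finset.sum_eq_zero fun t _ => if_neg fun ht => hcond ?_
    obtain ⟨h1, h2⟩ := hfwd t ht
    refine ⟨h1, by rw [h2 0 (Nat.zero_le _)]; exact h0 t, fun i hi => ?_⟩
    rw [h2 i (Finset.mem_Icc.1 hi).2]
    exact leafCounts_nonneg t i

lemma kernelTerm_nonneg {K L : ℕ} {p : ℕ → ℝ} (hp : ∀ i ≤ K, 0 ≤ p i) (ℓ : Finset.Icc 3 L)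
    (Δz : State K L ℤ) : 0 ≤ kernelTerm p ℓ Δz := by
  unfold kernelTerm
  split_ifs
  · exact mul_nonneg (Nat.cast_nonneg _) (Finset.prod_nonneg fun i hi =>
      pow_nonneg (hp i (by have := Finset.mem_range.1 hi; omega)) _)
  · exact le_rfl

lemma hasSum_kernelTerm {K L : ℕ} (hK : 1 ≤ K) {p : ℕ → ℝ}
    (hp : ∑ i ∈ range (K + 1), p i = 1) (ℓ : Finset.Icc 3 L) :
    HasSum (fun Δz : State K L ℤ => kernelTerm p ℓ Δz) 1 := by
  have hℓ : Fintype.card (Fin ((ℓ : ℕ) - 1)) + 1 = (ℓ : ℕ) := by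
    have := (Finset.mem_Icc.1 ℓ.2).1
    simp; omega
  have h1 : ∑ t : Fin ((ℓ : ℕ) - 1) → Fin (K + 1), ∏ j, p (t j) = 1 := by
    have := Finset.prod_univ_sum (fun _ : Fin ((ℓ : ℕ) - 1) => (univ : Finset (Fin (K + 1))))
      fun _ i => p i
    rw [Fintype.piFinset_univ] at this
    rw [← this, Finset.prod_eq_one]
    intro j _
    rw [← hp, Finset.sum_range]
  rw [← h1]
  simp_rw [← sum_types_eq_kernelTerm hK p ℓ hℓ]
  refine hasSum_sum fun t _ => ?_
  have := hasSum_ite_eq (displacement ℓ (leafCounts t) : State K L ℤ) (∏ j, p (t j))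
  simpa only [eq_comm] using this

end

/-! ### The domain of the asymptotic kernel -/

section Domain

variable {K L : ℕ}

lemma coord_coe (u : Finset.Icc 1 K → ℝ) (i : Finset.Icc 1 K) : coord u i = u i := by
  unfold coord
  rw [dif_pos i.2]

lemma sum_mul_coord (hK : 1 ≤ K) (u : Finset.Icc 1 K → ℝ) :
    ∑ i : Finset.Icc 1 K, ((i : ℕ) : ℝ) * u i =
      ∑ i ∈ Finset.Ico 1 K, (i : ℝ) * coord u i + K * coord u K := by
  have h1 : ∑ i : Finset.Icc 1 K, ((i : ℕ) : ℝ) * u i =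
      ∑ i : Finset.Icc 1 K, (fun i : ℕ => (i : ℝ) * coord u i) i :=
    Finset.sum_congr rfl fun i _ => by simp only [coord_coe]
  rw [h1, Finset.sum_coe_sort (Finset.Icc 1 K) fun i : ℕ => (i : ℝ) * coord u i]
  have h2 : Finset.Icc 1 K = Finset.Ico 1 (K + 1) := by
    ext i; simp only [Finset.mem_Icc, Finset.mem_Ico]; omega
  rw [h2, Finset.sum_Ico_succ_top hK]

lemma coord_nonneg {u : Finset.Icc 1 K → ℝ} (hu : ∀ i, 0 ≤ u i) (i : ℕ) : 0 ≤ coord u i := by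
  unfold coord
  split_ifs
  · exact hu _
  · exact le_rfl

/-- The mean degree of the c-nodes of degree at least `K`. -/
noncomputable def heavyMean (x : State K L ℝ) : ℝ :=
  (totalDeg x.2 - ∑ i ∈ Finset.Ico 1 K, (i : ℝ) * coord x.1 i) / coord x.1 K

variable {ε : ℝ} {x : State K L ℝ}

lemma coord_pos_of_mem (hε : 0 < ε) (hx : x ∈ domainH K L ε) : 0 < coord x.1 K :=
  hε.trans_le hx.2.2.1

lemma totalDeg_ge_of_mem (hx : x ∈ domainH K L ε) : ε ≤ totalDeg x.2 := by
  have h1 := hx.2.2.2.2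
  have h2 : 0 ≤ ∑ i : Finset.Icc 1 K, ((i : ℕ) : ℝ) * x.1 i :=
    Finset.sum_nonneg fun i _ => mul_nonneg (Nat.cast_nonneg _) (hx.1 i)
  linarith

/-- The last condition defining `domainH` leaves the heavy c-nodes a positive excess over degree
`K`; this is what makes the equation for `λ` solvable. -/
lemma lt_heavyMean (hK : 1 ≤ K) (hε : 0 < ε) (hx : x ∈ domainH K L ε) : (K : ℝ) < heavyMean x := by
  have h1 := hx.2.2.2.2
  rw [sum_mul_coord hK] at h1
  unfold heavyMean
  rw [lt_div_iff₀ (coord_pos_of_mem hε hx)]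
  linarith

lemma existsUnique_isLambda (hK : 1 ≤ K) (hε : 0 < ε) (hx : x ∈ domainH K L ε) :
    ∃! l : ℝ, IsLambda x l :=
  existsUnique_meanTP hK (lt_heavyMean hK hε hx)

lemma lam_spec (hK : 1 ≤ K) (hε : 0 < ε) (hx : x ∈ domainH K L ε) :
    0 < lam x ∧ meanTP K (lam x) = heavyMean x :=
  Classical.epsilon_spec (existsUnique_isLambda hK hε hx).exists

/-- `K` times the Poisson atom equals the mean minus the parameter. In this form `pp x (K - 1)` is
visibly nonnegative, matches `typeMean`, and adds up with `pp x K` to a multiple of the heavy mean.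
-/
lemma pp_pred (hK : 1 ≤ K) (hε : 0 < ε) (hx : x ∈ domainH K L ε) :
    pp x (K - 1) = coord x.1 K * (heavyMean x - lam x) / totalDeg x.2 := by
  obtain ⟨hl, hm⟩ := lam_spec hK hε hx
  unfold pp
  rw [if_neg (by omega), if_pos (by omega), ← hm, meanTP_eq hK hl, add_sub_cancel_left, atomTP,
    factorial_pred_mul hK]
  have h1 : (K : ℝ) ≠ 0 := by positivity
  have h2 : ((K - 1).factorial : ℝ) ≠ 0 := by positivity
  have h3 := (expTail_pos K hl).ne'
  have h4 := (hε.trans_le (totalDeg_ge_of_mem hx)).ne'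
  field_simp

lemma pp_top (x : State K L ℝ) : pp x K = coord x.1 K * lam x / totalDeg x.2 := by
  unfold pp
  rw [if_neg (by omega), if_neg (by omega)]

lemma lam_le_heavyMean (hK : 1 ≤ K) (hε : 0 < ε) (hx : x ∈ domainH K L ε) :
    lam x ≤ heavyMean x := by
  obtain ⟨hl, hm⟩ := lam_spec hK hε hx
  rw [← hm, meanTP_eq hK hl]
  have := mul_nonneg (Nat.cast_nonneg (α := ℝ) K) (atomTP_pos K hl).le
  linarith

lemma pp_nonneg (hK : 1 ≤ K) (hε : 0 < ε) (hx : x ∈ domainH K L ε) {i : ℕ} (hi : i ≤ K) :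
    0 ≤ pp x i := by
  have hd := hε.trans_le (totalDeg_ge_of_mem hx)
  have hc := coord_pos_of_mem hε hx
  have hl := lam_spec hK hε hx
  rcases lt_trichotomy (i + 1) K with h | h | h
  · unfold pp
    rw [if_pos h]
    have := coord_nonneg hx.1 (i + 1)
    positivity
  · obtain rfl : i = K - 1 := by omega
    rw [pp_pred hK hε hx]
    have := sub_nonneg.2 (lam_le_heavyMean hK hε hx)
    positivity
  · obtain rfl : i = K := by omega
    rw [pp_top]
    have := hl.1
    positivity

lemma sum_pp (hK : 1 ≤ K) (hε : 0 < ε) (hx : x ∈ domainH K L ε) :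
    ∑ i ∈ range (K + 1), pp x i = 1 := by
  have hd := (hε.trans_le (totalDeg_ge_of_mem hx)).ne'
  have hc := (coord_pos_of_mem hε hx).ne'
  have h1 : ∑ i ∈ range (K - 1), pp x i =
      (∑ i ∈ Finset.Ico 1 K, (i : ℝ) * coord x.1 i) / totalDeg x.2 := by
    rw [Finset.sum_Ico_eq_sum_range, Finset.sum_div]
    refine Finset.sum_congr rfl fun i hi => ?_
    have := Finset.mem_range.1 hi
    unfold pp
    rw [if_pos (by omega), add_comm 1 i]
    push_cast
    ring
  have h0 : ∑ i ∈ range K, pp x i = ∑ i ∈ range (K - 1), pp x i + pp x (K - 1) := by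
    rw [← Finset.sum_range_succ, show K - 1 + 1 = K by omega]
  rw [Finset.sum_range_succ, h0, h1, pp_pred hK hε hx, pp_top]
  have h2 : coord x.1 K * heavyMean x =
      totalDeg x.2 - ∑ i ∈ Finset.Ico 1 K, (i : ℝ) * coord x.1 i := by
    unfold heavyMean
    field_simp
  rw [← add_div, ← add_div, div_eq_one_iff_eq hd]
  linarith

lemma asymKernel_nonneg (hK : 1 ≤ K) (hε : 0 < ε) (hx : x ∈ domainH K L ε) (Δz : State K L ℤ) :
    0 ≤ asymKernel x Δz := by
  rw [asymKernel_eq]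
  have hd := hε.trans_le (totalDeg_ge_of_mem hx)
  refine Finset.sum_nonneg fun ℓ _ => mul_nonneg ?_
    (kernelTerm_nonneg (fun i hi => pp_nonneg hK hε hx hi) ℓ Δz)
  have := hx.2.1 ℓ
  positivity

lemma hasSum_asymKernel (hK : 1 ≤ K) (hε : 0 < ε) (hx : x ∈ domainH K L ε) :
    HasSum (fun Δz : State K L ℤ => asymKernel x Δz) 1 := by
  have hd := (hε.trans_le (totalDeg_ge_of_mem hx)).ne'
  have h1 : ∑ ℓ : Finset.Icc 3 L, ((ℓ : ℕ) : ℝ) * x.2 ℓ / totalDeg x.2 * 1 = 1 := by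
    simp only [mul_one]
    rw [← Finset.sum_div]
    exact div_self hd
  rw [← h1]
  simp_rw [asymKernel_eq]
  exact hasSum_sum fun ℓ _ => (hasSum_kernelTerm hK (sum_pp hK hε hx) ℓ).mul_left _

end Domain

/-! ### Graphs as maps from slots -/

section Slots

variable {K L n m : ℕ}

/-- The edge slots of the v-nodes with degrees `δ`. -/
abbrev Slots (δ : Fin n → Fin (L + 1)) : Type := Σ α : Fin n, Fin (δ α : ℕ)

/-- The graph with v-degrees `δ` in which the slots are attached according to `φ`. -/
def toGraph (δ : Fin n → Fin (L + 1)) (φ : Slots δ → Fin m) : Graph L n m :=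
  fun α => ⟨δ α, fun i => φ ⟨α, i⟩⟩

/-- A graph is given by its v-degrees and the attachment of the slots. -/
def graphEquiv (L n m : ℕ) :
    Graph L n m ≃ Σ δ : Fin n → Fin (L + 1), (Slots δ → Fin m) where
  toFun G := ⟨fun α => (G α).1, fun s => (G s.1).2 s.2⟩
  invFun x := toGraph x.1 x.2
  left_inv _ := rfl
  right_inv _ := rfl

lemma sum_graph (f : Graph L n m → ℝ) :
    ∑ G, f G = ∑ δ : Fin n → Fin (L + 1), ∑ φ : Slots δ → Fin m, f (toGraph δ φ) := by
  rw [← (graphEquiv L n m).symm.sum_comp, Fintype.sum_sigma]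
  rfl

/-- The number of edges from the v-node `α` to the c-node `a`. -/
def localDeg {δ : Fin n → Fin (L + 1)} (φ : Slots δ → Fin m) (α : Fin n) (a : Fin m) : ℕ :=
  (univ.filter fun i : Fin (δ α : ℕ) => φ ⟨α, i⟩ = a).card

lemma deg_eq_sum_localDeg {δ : Fin n → Fin (L + 1)} (φ : Slots δ → Fin m) (a : Fin m) :
    deg φ a = ∑ α, localDeg φ α a := by
  unfold deg localDeg
  simp only [Finset.card_filter]
  rw [Fintype.sum_sigma]

lemma cDeg_toGraph (δ : Fin n → Fin (L + 1)) (φ : Slots δ → Fin m) (a : Fin m) :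
    cDeg (toGraph δ φ) a = deg φ a := (deg_eq_sum_localDeg φ a).symm

lemma ite_iff_min {d i : ℕ} (hi : i ≤ K) :
    (if i < K then d = i else K ≤ d) ↔ min d K = i := by
  split_ifs <;> omega

lemma degreeCounts_fst (G : Graph L n m) (i : Finset.Icc 1 K) :
    (degreeCounts K G).1 i = ((univ.filter fun a => min (cDeg G a) K = (i : ℕ)).card : ℤ) := by
  unfold degreeCounts
  simp only
  congr 2
  ext a
  simp only [Finset.mem_filter, Finset.mem_univ, true_and]
  exact ite_iff_min (Finset.mem_Icc.1 i.2).2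

/-! ### Peeling a leaf -/

variable {δ : Fin n → Fin (L + 1)} {φ : Slots δ → Fin m}

lemma eq_of_deg_one {s s' : Slots δ} (h : deg φ (φ s) = 1) (h' : φ s' = φ s) : s' = s := by
  obtain ⟨r, hr⟩ := Finset.card_eq_one.1 h
  have h1 : s ∈ ({r} : Finset (Slots δ)) := hr ▸ (by simp)
  have h2 : s' ∈ ({r} : Finset (Slots δ)) := hr ▸ (by simp [h'])
  rw [Finset.mem_singleton] at h1 h2
  rw [h1, h2]

lemma peel_apply {s : Slots δ} (h : deg φ (φ s) = 1) (β : Fin n) :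
    peel (toGraph δ φ) (φ s) β = if β = s.1 then ⟨0, Fin.elim0⟩ else toGraph δ φ β := by
  unfold peel
  by_cases hβ : β = s.1
  · subst hβ
    rw [if_pos rfl, if_pos ⟨s.2, rfl⟩]
  · rw [if_neg hβ, if_neg]
    rintro ⟨i, hi⟩
    exact hβ (congrArg Sigma.fst (eq_of_deg_one (s' := ⟨β, i⟩) h hi))

lemma cDeg_peel_add {s : Slots δ} (h : deg φ (φ s) = 1) (a : Fin m) :
    cDeg (peel (toGraph δ φ) (φ s)) a + localDeg φ s.1 a = deg φ a := by
  rw [deg_eq_sum_localDeg, ← Finset.sum_erase_add univ _ (Finset.mem_univ s.1), add_left_inj]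
  unfold cDeg
  rw [← Finset.sum_erase_add univ _ (Finset.mem_univ s.1)]
  have h1 : (univ.filter fun i => (peel (toGraph δ φ) (φ s) s.1).2 i = a).card = 0 := by
    rw [Finset.card_eq_zero, Finset.filter_eq_empty_iff]
    rintro i -
    rw [peel_apply h, if_pos rfl] at i
    exact i.elim0
  rw [h1, add_zero]
  refine Finset.sum_congr rfl fun β hβ => ?_
  have h2 : peel (toGraph δ φ) (φ s) β = toGraph δ φ β := by
    rw [peel_apply h, if_neg (Finset.ne_of_mem_erase hβ)]
  rw [h2]
  rfl

lemma vDeg_peel {s : Slots δ} (h : deg φ (φ s) = 1) (β : Fin n) :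
    vDeg (peel (toGraph δ φ) (φ s)) β = if β = s.1 then 0 else (δ β : ℕ) := by
  unfold vDeg
  rw [peel_apply h]
  split_ifs <;> rfl

/-- The types of the other slots at the v-node of a slot. -/
def neighbourTypes (K : ℕ) (φ : Slots δ → Fin m) (s : Slots δ) :
    {j : Fin (δ s.1 : ℕ) // j ≠ s.2} → Fin (K + 1) :=
  fun j => ⟨slotType K φ ⟨s.1, j⟩, Nat.lt_succ_of_le (min_le_right _ _)⟩

lemma leafCounts_neighbourTypes {s : Slots δ} (hs : slotType K φ s = 0) (i : ℕ) :
    leafCounts (neighbourTypes K φ s) i =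
      ((univ.filter fun j : Fin (δ s.1 : ℕ) => slotType K φ ⟨s.1, j⟩ = i).card : ℤ) := by
  unfold leafCounts neighbourTypes
  have h1 : (univ.filter fun j : {j : Fin (δ s.1 : ℕ) // j ≠ s.2} =>
      slotType K φ ⟨s.1, j⟩ = i).card =
      ((univ.erase s.2).filter fun j => slotType K φ ⟨s.1, j⟩ = i).card := by
    refine Finset.card_bij (fun j _ => j.1) ?_ ?_ ?_
    · intro j hj
      simpa [j.2] using hj
    · intro j _ j' _ h
      exact Subtype.ext h
    · intro j hj
      simp only [Finset.mem_filter, Finset.mem_erase, Finset.mem_univ, and_true] at hj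
      exact ⟨⟨j, hj.1⟩, by simpa using hj.2, rfl⟩
  simp only
  rw [h1, Finset.filter_erase]
  by_cases hi : i = 0
  · have hmem : s.2 ∈ univ.filter fun j : Fin (δ s.1 : ℕ) => slotType K φ ⟨s.1, j⟩ = i := by
      simp only [Finset.mem_filter, Finset.mem_univ, true_and, hi]
      exact hs
    have := Finset.card_erase_add_one hmem
    rw [if_pos hi, ← this]
    push_cast
    ring
  · have hmem : s.2 ∉ univ.filter fun j : Fin (δ s.1 : ℕ) => slotType K φ ⟨s.1, j⟩ = i := by
      simp only [Finset.mem_filter, Finset.mem_univ, true_and]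
      intro h
      exact hi (h.symm.trans hs)
    rw [if_neg hi, Finset.erase_eq_of_notMem hmem, zero_add]

lemma deg_eq_one_of_slotType (hK : 1 ≤ K) {s : Slots δ} (hs : slotType K φ s = 0) :
    deg φ (φ s) = 1 := by
  have := deg_pos φ s
  unfold slotType at hs
  omega

/-- The change of the degree counts when the edges at the v-node of a leaf lead to distinct
c-nodes. -/
lemma degreeCounts_peel_sub (hK : 1 ≤ K) {s : Slots δ} (hs : slotType K φ s = 0)
    (hinj : Function.Injective fun j : Fin (δ s.1 : ℕ) => φ ⟨s.1, j⟩)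
    (hδ : (δ s.1 : ℕ) ∈ Finset.Icc 3 L) :
    degreeCounts K (peel (toGraph δ φ) (φ s)) - degreeCounts K (toGraph δ φ) =
      displacement ⟨δ s.1, hδ⟩ (leafCounts (neighbourTypes K φ s)) := by
  have h1 := deg_eq_one_of_slotType hK hs
  refine Prod.ext (funext fun i => ?_) (funext fun j => ?_)
  · obtain ⟨i, hi⟩ := i
    have hi' := Finset.mem_Icc.1 hi
    rw [Prod.fst_sub, Pi.sub_apply, degreeCounts_fst, degreeCounts_fst]
    simp only [displacement]
    rw [leafCounts_neighbourTypes hs, leafCounts_neighbourTypes hs]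
    simp only [Finset.card_filter]
    push_cast
    rw [← Finset.sum_sub_distrib]
    -- Only c-nodes adjacent to the peeled v-node change degree, and by `hinj` they are parametrised
    -- by its slots.
    have hsupp : ∀ c ∉ univ.image (fun j : Fin (δ s.1 : ℕ) => φ ⟨s.1, j⟩),
        ((if min (cDeg (peel (toGraph δ φ) (φ s)) c) K = i then (1 : ℤ) else 0) -
          if min (cDeg (toGraph δ φ) c) K = i then 1 else 0) = 0 := by
      intro c hc
      have h2 := cDeg_peel_add h1 c
      have h3 : localDeg φ s.1 c = 0 := by
        unfold localDeg
        rw [Finset.card_eq_zero, Finset.filter_eq_empty_iff]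
        intro j _ hj
        exact hc (Finset.mem_image.2 ⟨j, Finset.mem_univ _, hj⟩)
      rw [cDeg_toGraph, ← h2, h3, add_zero, sub_self]
    rw [← Finset.sum_subset (Finset.subset_univ _) fun c _ hc => hsupp c hc,
      Finset.sum_image fun a _ b _ hab => hinj hab]
    -- Such a c-node drops from degree `d + 1` to `d`, and its slot has type `min d K`. In class `K`
    -- a node with `d ≥ K` is counted before and after, hence the absence of a gain there.
    have hpt : ∀ j : Fin (δ s.1 : ℕ),
        ((if min (cDeg (peel (toGraph δ φ) (φ s)) (φ ⟨s.1, j⟩)) K = i then (1 : ℤ) else 0) -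
          if min (cDeg (toGraph δ φ) (φ ⟨s.1, j⟩)) K = i then 1 else 0) =
        (if i < K then (if slotType K φ ⟨s.1, j⟩ = i then (1 : ℤ) else 0) else 0) -
          if slotType K φ ⟨s.1, j⟩ = i - 1 then 1 else 0 := by
      intro j
      have h2 := cDeg_peel_add h1 (φ ⟨s.1, j⟩)
      have h3 : localDeg φ s.1 (φ ⟨s.1, j⟩) = 1 := by
        unfold localDeg
        rw [Finset.card_eq_one]
        refine ⟨j, ?_⟩
        ext j'
        simp only [Finset.mem_filter, Finset.mem_univ, true_and, Finset.mem_singleton]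
        exact ⟨fun h => hinj h, fun h => by rw [h]⟩
      rw [cDeg_toGraph]
      rw [h3] at h2
      unfold slotType
      rw [← h2, Nat.add_sub_cancel]
      generalize cDeg (peel (toGraph δ φ) (φ s)) (φ ⟨s.1, j⟩) = d
      split_ifs <;> omega
    rw [Finset.sum_congr rfl fun j _ => hpt j, Finset.sum_sub_distrib]
    congr 1
    split_ifs
    · rfl
    · simp
  · obtain ⟨j, hj⟩ := j
    have hj' := Finset.mem_Icc.1 hj
    rw [Prod.snd_sub, Pi.sub_apply]
    simp only [degreeCounts, displacement, Subtype.mk.injEq]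
    have h2 : (univ.filter fun α => vDeg (peel (toGraph δ φ) (φ s)) α = j) =
        (univ.filter fun α => vDeg (toGraph δ φ) α = j).erase s.1 := by
      ext α
      simp only [Finset.mem_filter, Finset.mem_univ, true_and, Finset.mem_erase]
      rw [vDeg_peel h1]
      change (if α = s.1 then 0 else (δ α : ℕ)) = j ↔ α ≠ s.1 ∧ (δ α : ℕ) = j
      split_ifs with h
      · constructor
        · intro h0; omega
        · intro h0; exact absurd h h0.1
      · simp [h]
    rw [h2]
    by_cases hjs : j = (δ s.1 : ℕ)
    · have hmem : s.1 ∈ univ.filter fun α => vDeg (toGraph δ φ) α = j := by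
        simp only [Finset.mem_filter, Finset.mem_univ, true_and]
        exact hjs.symm
      rw [if_pos hjs, ← Finset.card_erase_add_one hmem]
      push_cast
      ring
    · rw [if_neg hjs, Finset.erase_eq_of_notMem, sub_self]
      simp only [Finset.mem_filter, Finset.mem_univ, true_and]
      exact fun h => hjs h.symm

end Slots

/-! ### The displacement caused by a given leaf slot, for fixed v-degrees. -/

section PerDegrees

variable {K L n m M : ℕ} {ω : ℕ → ℕ} {l : ℝ} {δ : Fin n → Fin (L + 1)}

lemma slot_deg_mem (hδ : ∀ α, (δ α : ℕ) = 0 ∨ 3 ≤ (δ α : ℕ)) (s : Slots δ) :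
    (δ s.1 : ℕ) ∈ Finset.Icc 3 L := by
  have h1 := s.2.2
  have h2 := (δ s.1).2
  rcases hδ s.1 with h | h
  · omega
  · exact Finset.mem_Icc.2 ⟨h, by omega⟩

lemma slot_eq_mk_iff {s : Slots δ} {j : Fin (δ s.1 : ℕ)} : s = ⟨s.1, j⟩ ↔ j = s.2 := by
  obtain ⟨α, i⟩ := s
  simp only [Sigma.mk.injEq, heq_eq_eq, true_and]
  exact eq_comm

lemma injective_vecThree {X : Type*} {a b c : X} (hab : a ≠ b) (hac : a ≠ c) (hbc : b ≠ c) :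
    Function.Injective ![a, b, c] := by
  intro i j hij
  fin_cases i <;> fin_cases j <;> simp_all

lemma sum_abs_indicator_sub_le {X : Type*} [DecidableEq X] (A : Finset X) (a b : X) :
    ∑ x ∈ A, |(if a = x then (1 : ℝ) else 0) - if b = x then 1 else 0| ≤
      if a = b then 0 else 2 := by
  split_ifs with h
  · subst h; simp
  · calc _ ≤ ∑ x ∈ A, ((if a = x then (1 : ℝ) else 0) + if b = x then 1 else 0) :=
          Finset.sum_le_sum fun x _ => by split_ifs <;> norm_num
      _ ≤ 1 + 1 := by
          rw [Finset.sum_add_distrib, Finset.sum_ite_eq, Finset.sum_ite_eq]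
          gcongr <;> split_ifs <;> norm_num
      _ = 2 := by norm_num

lemma card_collision_pair_le (h : Profile K M (Fintype.card (Slots δ)) ω l) {s s' s'' : Slots δ}
    (h1 : s ≠ s') (h2 : s ≠ s'') (h3 : s' ≠ s'') :
    (((classMaps (Slots δ) (Fin m) K ω).filter fun φ =>
        slotType K φ s = 0 ∧ φ s' = φ s'').card : ℝ) ≤
      ω 1 * (classMaps (Slots δ) (Fin m) K ω).card / (Fintype.card (Slots δ) : ℝ) ^ 2 *
        (9 * (M / ω K + K)) := by
  convert card_collision_le (B := Fin m) h (injective_vecThree h1 h2 h3) <;> rfl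

/-- A leaf whose v-node has two edges to the same c-node is rare. -/
lemma card_not_injective_le (h : Profile K M (Fintype.card (Slots δ)) ω l) (s : Slots δ) :
    (((classMaps (Slots δ) (Fin m) K ω).filter fun φ => slotType K φ s = 0 ∧
        ¬ Function.Injective fun j : Fin (δ s.1 : ℕ) => φ ⟨s.1, j⟩).card : ℝ) ≤
      (L : ℝ) ^ 2 * (ω 1 * (classMaps (Slots δ) (Fin m) K ω).card /
        (Fintype.card (Slots δ) : ℝ) ^ 2 * (9 * (M / ω K + K))) := by
  set Ψ := classMaps (Slots δ) (Fin m) K ω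
  set P := (univ : Finset (Fin (δ s.1 : ℕ) × Fin (δ s.1 : ℕ))).filter fun x =>
    x.1 ≠ x.2 ∧ x.1 ≠ s.2 ∧ x.2 ≠ s.2 with hP
  have hK : 1 ≤ K := by linarith [h.two_le]
  have hsub : (Ψ.filter fun φ => slotType K φ s = 0 ∧
      ¬ Function.Injective fun j : Fin (δ s.1 : ℕ) => φ ⟨s.1, j⟩) ⊆
      P.biUnion fun x => Ψ.filter fun φ => slotType K φ s = 0 ∧ φ ⟨s.1, x.1⟩ = φ ⟨s.1, x.2⟩ := by
    intro φ hφ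
    obtain ⟨hφ, h0, hni⟩ := Finset.mem_filter.1 hφ
    unfold Function.Injective at hni
    push Not at hni
    obtain ⟨x, y, hxy, hne⟩ := hni
    have hd := deg_eq_one_of_slotType hK h0
    have hinj : ∀ j j' : Fin (δ s.1 : ℕ), (⟨s.1, j⟩ : Slots δ) = ⟨s.1, j'⟩ → j = j' :=
      fun j j' hj => by simpa using hj
    refine Finset.mem_biUnion.2 ⟨(x, y), Finset.mem_filter.2 ⟨Finset.mem_univ _, hne, ?_, ?_⟩,
      Finset.mem_filter.2 ⟨hφ, h0, hxy⟩⟩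
    -- The leaf slot cannot take part in a collision, since its c-node has degree one. The two
    -- colliding slots and the leaf slot are therefore three distinct slots, as
    -- `card_collision_pair_le` requires.
    · rintro rfl
      exact hne (hinj _ _ (eq_of_deg_one (s := s) hd hxy.symm)).symm
    · rintro rfl
      exact hne (hinj _ _ (eq_of_deg_one (s := s) hd hxy))
  have hPcard : (P.card : ℝ) ≤ (L : ℝ) ^ 2 := by
    have h1 : P.card ≤ (δ s.1 : ℕ) * (δ s.1 : ℕ) := by
      refine (Finset.card_filter_le _ _).trans ?_
      rw [Finset.card_univ, Fintype.card_prod, Fintype.card_fin]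
    have h2 : (δ s.1 : ℕ) ≤ L := by have := (δ s.1).2; omega
    have h3 : P.card ≤ L ^ 2 := h1.trans (by rw [sq]; exact Nat.mul_le_mul h2 h2)
    exact_mod_cast h3
  have hC : 0 ≤ ω 1 * (Ψ.card : ℝ) / (Fintype.card (Slots δ) : ℝ) ^ 2 * (9 * (M / ω K + K)) := by
    positivity
  calc _ ≤ ((∑ x ∈ P, (Ψ.filter fun φ => slotType K φ s = 0 ∧
          φ ⟨s.1, x.1⟩ = φ ⟨s.1, x.2⟩).card : ℕ) : ℝ) :=
        Nat.cast_le.2 ((Finset.card_le_card hsub).trans Finset.card_biUnion_le)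
    _ = ∑ x ∈ P, ((Ψ.filter fun φ => slotType K φ s = 0 ∧
          φ ⟨s.1, x.1⟩ = φ ⟨s.1, x.2⟩).card : ℝ) := by push_cast; rfl
    _ ≤ ∑ x ∈ P, ω 1 * (Ψ.card : ℝ) / (Fintype.card (Slots δ) : ℝ) ^ 2 * (9 * (M / ω K + K)) := by
        refine Finset.sum_le_sum fun x hx => ?_
        obtain ⟨-, h12, h1, h2⟩ := Finset.mem_filter.1 hx
        exact card_collision_pair_le h (fun hh => h1 (slot_eq_mk_iff.1 hh))
            (fun hh => h2 (slot_eq_mk_iff.1 hh)) fun hh => h12 (by simpa using hh)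
    _ = P.card * (ω 1 * (Ψ.card : ℝ) / (Fintype.card (Slots δ) : ℝ) ^ 2 * (9 * (M / ω K + K))) := by
        rw [Finset.sum_const, nsmul_eq_mul]
    _ ≤ _ := by gcongr

lemma ratioConst_mono {y y' : ℝ} (hy : 0 ≤ y) (hyy : y ≤ y') :
    0 ≤ ratioConst K y ∧ ratioConst K y ≤ ratioConst K y' := by
  unfold ratioConst
  refine ⟨by positivity, ?_⟩
  have h0 : 0 ≤ y' := hy.trans hyy
  have : Real.exp (3 * y) ≤ Real.exp (3 * y') := Real.exp_le_exp.2 (by linarith)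
  gcongr

lemma typeConst_mono {q q' : ℕ} (hq : q ≤ q') {y y' : ℝ} (hy : 0 ≤ y) (hyy : y ≤ y') :
    typeConst K q y ≤ typeConst K q' y' := by
  unfold typeConst
  obtain ⟨h1, h2⟩ := ratioConst_mono (K := K) hy hyy
  have h3 : (q : ℝ) ≤ q' := by exact_mod_cast hq
  gcongr

/-- The constant in the estimate for the slots of one v-node. -/
noncomputable def slotConst (K L : ℕ) (y : ℝ) : ℝ :=
  2 * ((L : ℝ) ^ 2 * (9 * (y + K))) + (K + 1 : ℝ) ^ L * ((L : ℝ) ^ 2 + typeConst K L y)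

/-- The law of the displacement for a given leaf slot. -/
lemma sum_abs_slot_sub_le (h : Profile K M (Fintype.card (Slots δ)) ω l)
    (hδ : ∀ α, (δ α : ℕ) = 0 ∨ 3 ≤ (δ α : ℕ)) {y : ℝ} (hy : (M : ℝ) / ω K ≤ y)
    {z : State K L ℤ}
    (hz : ∀ φ ∈ classMaps (Slots δ) (Fin m) K ω, degreeCounts K (toGraph δ φ) = z)
    (A : Finset (State K L ℤ)) (s : Slots δ) :
    ∑ Δz ∈ A, |∑ φ ∈ classMaps (Slots δ) (Fin m) K ω,
        (if slotType K φ s = 0 then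
          (if degreeCounts K (peel (toGraph δ φ) (φ s)) - z = Δz then (1 : ℝ) else 0) else 0) -
        ω 1 * (classMaps (Slots δ) (Fin m) K ω).card / Fintype.card (Slots δ) *
          kernelTerm (fun i => typeMean K M ω l i / Fintype.card (Slots δ))
            ⟨δ s.1, slot_deg_mem hδ s⟩ Δz| ≤
      ω 1 * (classMaps (Slots δ) (Fin m) K ω).card / (Fintype.card (Slots δ) : ℝ) ^ 2 *
        slotConst K L y := by
  classical
  have hK : 1 ≤ K := by linarith [h.two_le]
  have hy0 : (0 : ℝ) ≤ (M : ℝ) / ω K := by positivity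
  set Ψ := classMaps (Slots δ) (Fin m) K ω with hΨ
  set E : ℝ := (Fintype.card (Slots δ) : ℝ) with hE
  have hE0 : 0 < E := by rw [hE]; exact_mod_cast h.E_pos
  set ℓ : Finset.Icc 3 L := ⟨δ s.1, slot_deg_mem hδ s⟩ with hℓ
  set p : ℕ → ℝ := fun i => typeMean K M ω l i / E with hp
  set D : (Slots δ → Fin m) → State K L ℤ := fun φ =>
    degreeCounts K (peel (toGraph δ φ) (φ s)) - z with hD
  set D' : (Slots δ → Fin m) → State K L ℤ := fun φ =>
    displacement ℓ (leafCounts (neighbourTypes K φ s)) with hD'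
  have hdelta : (ℓ : ℕ) ≤ L := (Finset.mem_Icc.1 ℓ.2).2
  have hJ : Fintype.card {j : Fin (δ s.1 : ℕ) // j ≠ s.2} + 1 = (ℓ : ℕ) := by
    have h1 := (Finset.mem_Icc.1 ℓ.2).1
    simp only [hℓ] at h1 ⊢
    rw [Fintype.card_subtype_compl, Fintype.card_fin, Fintype.card_subtype_eq]
    omega
  set N : ({j : Fin (δ s.1 : ℕ) // j ≠ s.2} → Fin (K + 1)) → ℝ := fun t =>
    ((Ψ.filter fun φ => slotType K φ s = 0 ∧
      ∀ j : {j : Fin (δ s.1 : ℕ) // j ≠ s.2}, slotType K φ ⟨s.1, j⟩ = (t j : ℕ)).card : ℝ) with hN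
  have hD0 : ∀ Δz, ∑ φ ∈ Ψ, (if slotType K φ s = 0 then
      (if D' φ = Δz then (1 : ℝ) else 0) else 0) =
      ∑ t : {j : Fin (δ s.1 : ℕ) // j ≠ s.2} → Fin (K + 1),
        if displacement ℓ (leafCounts t) = Δz then N t else 0 := by
    intro Δz
    rw [← Finset.sum_fiberwise_of_maps_to (s := Ψ)
      (fun φ _ => Finset.mem_univ (neighbourTypes K φ s))]
    refine Finset.sum_congr rfl fun t _ => ?_
    have hnt : ∀ φ : Slots δ → Fin m, neighbourTypes K φ s = t ↔
        ∀ j : {j : Fin (δ s.1 : ℕ) // j ≠ s.2}, slotType K φ ⟨s.1, j⟩ = (t j : ℕ) := by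
      intro φ
      rw [funext_iff]
      exact forall_congr' fun j => by rw [Fin.ext_iff]; rfl
    have h1 : ∀ φ ∈ Ψ.filter (fun φ => neighbourTypes K φ s = t),
        (if slotType K φ s = 0 then (if D' φ = Δz then (1 : ℝ) else 0) else 0) =
        if displacement ℓ (leafCounts t) = Δz then (if slotType K φ s = 0 then 1 else 0) else 0 := by
      intro φ hφ
      simp only [hD', (Finset.mem_filter.1 hφ).2]
      split_ifs <;> rfl
    rw [Finset.sum_congr rfl h1]
    split_ifs
    · rw [Finset.sum_filter]
      simp only [hN]
      rw [Finset.card_filter]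
      push_cast
      refine Finset.sum_congr rfl fun φ _ => ?_
      by_cases h2 : neighbourTypes K φ s = t
      · rw [if_pos h2]
        have h3 := (hnt φ).1 h2
        by_cases h4 : slotType K φ s = 0
        · rw [if_pos h4, if_pos ⟨h4, h3⟩]
        · rw [if_neg h4, if_neg fun h5 => h4 h5.1]
      · rw [if_neg h2, if_neg fun h5 => h2 ((hnt φ).2 h5.2)]
    · simp
  have hest : ∀ t, |N t - ω 1 * Ψ.card / E * ∏ j, p (t j)| ≤
      ω 1 * Ψ.card / E ^ 2 * ((L : ℝ) ^ 2 + typeConst K L y) := by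
    intro t
    have hinj : Function.Injective (fun x : Option {j : Fin (δ s.1 : ℕ) // j ≠ s.2} =>
        (x.elim s fun j => ⟨s.1, j⟩ : Slots δ)) := by
      intro x x' hx
      cases x with
      | none => cases x' with
        | none => rfl
        | some j' =>
          simp only [Option.elim] at hx
          exact absurd (slot_eq_mk_iff.1 hx) j'.2
      | some j => cases x' with
        | none =>
          simp only [Option.elim] at hx
          exact absurd (slot_eq_mk_iff.1 hx.symm) j.2
        | some j' =>
          simp only [Option.elim] at hx
          have : j.1 = j'.1 := by simpa using hx
          rw [Subtype.ext this]
    have h1 := abs_card_types_sub_le (B := Fin m) h hinj (fun j => (t j : ℕ))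
      fun j => Nat.lt_succ_iff.1 (t j).2
    have h2 : (Fintype.card {j : Fin (δ s.1 : ℕ) // j ≠ s.2} : ℝ) + 1 ≤ L := by
      have : Fintype.card {j : Fin (δ s.1 : ℕ) // j ≠ s.2} + 1 ≤ L := by rw [hJ]; exact hdelta
      exact_mod_cast this
    have h3 : typeConst K (Fintype.card {j : Fin (δ s.1 : ℕ) // j ≠ s.2}) (M / ω K) ≤
        typeConst K L y := typeConst_mono (by rw [← hJ] at hdelta; omega) hy0 hy
    refine le_trans (le_of_eq ?_) (h1.trans ?_)
    · simp only [hN, hp, Option.elim]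
      congr 2
      rw [← hE]
      ring
    · rw [← hE]
      gcongr
  have hcoll := card_not_injective_le (m := m) h s
  rw [← hE] at hcoll
  have hDD : ∀ φ ∈ Ψ, slotType K φ s = 0 →
      (Function.Injective fun j : Fin (δ s.1 : ℕ) => φ ⟨s.1, j⟩) → D φ = D' φ := by
    intro φ hφ h0 hi
    simp only [hD, hD']
    rw [← hz φ hφ]
    exact degreeCounts_peel_sub hK h0 hi (slot_deg_mem hδ s)
  -- The true displacement `D` and the ideal one `D'` differ only under a collision, and each such
  -- map costs at most `2` in `ℓ¹`.
  have hfirst : ∑ Δz ∈ A, |∑ φ ∈ Ψ, (if slotType K φ s = 0 then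
        (if D φ = Δz then (1 : ℝ) else 0) else 0) -
      ∑ φ ∈ Ψ, (if slotType K φ s = 0 then (if D' φ = Δz then (1 : ℝ) else 0) else 0)| ≤
      2 * ((L : ℝ) ^ 2 * (ω 1 * Ψ.card / E ^ 2 * (9 * (y + K)))) := by
    calc _ ≤ ∑ Δz ∈ A, ∑ φ ∈ Ψ, |(if slotType K φ s = 0 then
            (if D φ = Δz then (1 : ℝ) else 0) else 0) -
            (if slotType K φ s = 0 then (if D' φ = Δz then (1 : ℝ) else 0) else 0)| := by
          refine Finset.sum_le_sum fun Δz _ => ?_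
          rw [← Finset.sum_sub_distrib]
          exact Finset.abs_sum_le_sum_abs _ _
      _ = ∑ φ ∈ Ψ, ∑ Δz ∈ A, |(if slotType K φ s = 0 then
            (if D φ = Δz then (1 : ℝ) else 0) else 0) -
            (if slotType K φ s = 0 then (if D' φ = Δz then (1 : ℝ) else 0) else 0)| :=
          Finset.sum_comm
      _ ≤ ∑ φ ∈ Ψ, 2 * (if slotType K φ s = 0 ∧
            ¬ Function.Injective (fun j : Fin (δ s.1 : ℕ) => φ ⟨s.1, j⟩) then (1 : ℝ) else 0) := by
          refine Finset.sum_le_sum fun φ hφ => ?_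
          by_cases h0 : slotType K φ s = 0
          · simp only [h0, if_true, true_and]
            refine (sum_abs_indicator_sub_le A (D φ) (D' φ)).trans ?_
            by_cases hi : Function.Injective (fun j : Fin (δ s.1 : ℕ) => φ ⟨s.1, j⟩)
            · rw [if_pos (hDD φ hφ h0 hi), if_neg (not_not.2 hi)]; norm_num
            · rw [if_pos hi]; split_ifs <;> norm_num
          · simp [h0]
      _ = 2 * ((Ψ.filter fun φ => slotType K φ s = 0 ∧
            ¬ Function.Injective fun j : Fin (δ s.1 : ℕ) => φ ⟨s.1, j⟩).card : ℝ) := by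
          rw [← Finset.mul_sum, Finset.card_filter]
          push_cast
          rfl
      _ ≤ 2 * ((L : ℝ) ^ 2 * (ω 1 * Ψ.card / E ^ 2 * (9 * (M / ω K + K)))) := by gcongr
      _ ≤ _ := by gcongr
  -- A type vector contributes to one value of `Δz` only. So the error is at most the number of type
  -- vectors, bounded by `(K + 1) ^ L`, times the error for one of them.
  have hsecond : ∑ Δz ∈ A, |∑ φ ∈ Ψ, (if slotType K φ s = 0 then
        (if D' φ = Δz then (1 : ℝ) else 0) else 0) - ω 1 * Ψ.card / E * kernelTerm p ℓ Δz| ≤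
      (K + 1 : ℝ) ^ L * (ω 1 * Ψ.card / E ^ 2 * ((L : ℝ) ^ 2 + typeConst K L y)) := by
    have hTC : 0 ≤ ω 1 * (Ψ.card : ℝ) / E ^ 2 * ((L : ℝ) ^ 2 + typeConst K L y) :=
      (abs_nonneg _).trans (hest fun _ => 0)
    calc _ ≤ ∑ Δz ∈ A, ∑ t : {j : Fin (δ s.1 : ℕ) // j ≠ s.2} → Fin (K + 1),
            (if displacement ℓ (leafCounts t) = Δz then
              |N t - ω 1 * Ψ.card / E * ∏ j, p (t j)| else 0) := by
          refine Finset.sum_le_sum fun Δz _ => ?_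
          rw [hD0, ← sum_types_eq_kernelTerm hK p ℓ hJ, Finset.mul_sum, ← Finset.sum_sub_distrib]
          refine (Finset.abs_sum_le_sum_abs _ _).trans (Finset.sum_le_sum fun t _ => ?_)
          split_ifs
          · exact le_rfl
          · simp
      _ = ∑ t : {j : Fin (δ s.1 : ℕ) // j ≠ s.2} → Fin (K + 1), ∑ Δz ∈ A,
            (if displacement ℓ (leafCounts t) = Δz then
              |N t - ω 1 * Ψ.card / E * ∏ j, p (t j)| else 0) := Finset.sum_comm
      _ ≤ ∑ t : {j : Fin (δ s.1 : ℕ) // j ≠ s.2} → Fin (K + 1),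
            ω 1 * Ψ.card / E ^ 2 * ((L : ℝ) ^ 2 + typeConst K L y) := by
          refine Finset.sum_le_sum fun t _ => ?_
          rw [Finset.sum_ite_eq]
          split_ifs
          · exact hest t
          · exact hTC
      _ = (K + 1 : ℝ) ^ (Fintype.card {j : Fin (δ s.1 : ℕ) // j ≠ s.2}) *
            (ω 1 * Ψ.card / E ^ 2 * ((L : ℝ) ^ 2 + typeConst K L y)) := by
          rw [Finset.sum_const, nsmul_eq_mul, Finset.card_univ, Fintype.card_fun, Fintype.card_fin]
          push_cast
          rfl
      _ ≤ _ := by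
          gcongr
          · have : (0 : ℝ) ≤ K := Nat.cast_nonneg K
            linarith
          · rw [← hJ] at hdelta
            omega
  calc _ ≤ ∑ Δz ∈ A, (|∑ φ ∈ Ψ, (if slotType K φ s = 0 then
            (if D φ = Δz then (1 : ℝ) else 0) else 0) -
          ∑ φ ∈ Ψ, (if slotType K φ s = 0 then (if D' φ = Δz then (1 : ℝ) else 0) else 0)| +
          |∑ φ ∈ Ψ, (if slotType K φ s = 0 then (if D' φ = Δz then (1 : ℝ) else 0) else 0) -
            ω 1 * Ψ.card / E * kernelTerm p ℓ Δz|) :=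
        Finset.sum_le_sum fun Δz _ => abs_sub_le _ _ _
    _ ≤ 2 * ((L : ℝ) ^ 2 * (ω 1 * Ψ.card / E ^ 2 * (9 * (y + K)))) +
          (K + 1 : ℝ) ^ L * (ω 1 * Ψ.card / E ^ 2 * ((L : ℝ) ^ 2 + typeConst K L y)) := by
        rw [Finset.sum_add_distrib]
        exact add_le_add hfirst hsecond
    _ = _ := by unfold slotConst; ring

end PerDegrees

/-! ### One step of the peeling process -/

section Step

variable {K L n m M : ℕ} {ω : ℕ → ℕ} {l : ℝ} {δ : Fin n → Fin (L + 1)}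

lemma sum_graphKernel {G : Graph L n m} (hG : leaves G ≠ ∅) (P : Graph L n m → Prop)
    [DecidablePred P] :
    ∑ G' ∈ univ.filter P, graphKernel G G' =
      (((leaves G).filter fun a => P (peel G a)).card : ℝ) / (leaves G).card := by
  have h1 : ((leaves G).filter fun a => P (peel G a)).card =
      ∑ G' ∈ univ.filter P, ((leaves G).filter fun a => peel G a = G').card := by
    rw [Finset.card_eq_sum_card_fiberwise (f := fun a => peel G a) (t := univ.filter P)
      (fun a ha => by simpa using (Finset.mem_filter.1 ha).2)]
    refine Finset.sum_congr rfl fun G' hG' => ?_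
    rw [Finset.filter_filter]
    congr 1
    ext a
    simp only [Finset.mem_filter, and_congr_right_iff, and_iff_right_iff_imp]
    rintro - rfl
    exact (Finset.mem_filter.1 hG').2
  rw [h1]
  push_cast
  rw [Finset.sum_div]
  exact Finset.sum_congr rfl fun G' _ => by rw [graphKernel, if_neg hG]

lemma slotType_eq_zero_iff (hK : 1 ≤ K) {φ : Slots δ → Fin m} {s : Slots δ} :
    slotType K φ s = 0 ↔ deg φ (φ s) = 1 := by
  refine ⟨deg_eq_one_of_slotType hK, fun h => ?_⟩
  unfold slotType
  rw [h]
  simp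

/-- Leaves correspond to slots of type `0`. -/
lemma card_leaves_filter (hK : 1 ≤ K) (φ : Slots δ → Fin m) (P : Fin m → Prop)
    [DecidablePred P] :
    ((leaves (toGraph δ φ)).filter P).card =
      (univ.filter fun s => slotType K φ s = 0 ∧ P (φ s)).card := by
  refine (Finset.card_bij (fun s _ => φ s) ?_ ?_ ?_).symm
  · intro s hs
    obtain ⟨-, h0, hP⟩ := Finset.mem_filter.1 hs
    refine Finset.mem_filter.2 ⟨Finset.mem_filter.2 ⟨Finset.mem_univ _, ?_⟩, hP⟩
    rw [cDeg_toGraph]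
    exact (slotType_eq_zero_iff hK).1 h0
  · intro s _ s' hs' h
    exact eq_of_deg_one ((slotType_eq_zero_iff hK).1 (Finset.mem_filter.1 hs').2.1) h
  · intro a ha
    obtain ⟨ha, hP⟩ := Finset.mem_filter.1 ha
    have h1 := (Finset.mem_filter.1 ha).2
    rw [cDeg_toGraph] at h1
    obtain ⟨s, hs⟩ : (univ.filter fun s => φ s = a).Nonempty := by
      rw [← Finset.card_pos]
      change 0 < deg φ a
      omega
    obtain rfl := (Finset.mem_filter.1 hs).2
    exact ⟨s, Finset.mem_filter.2 ⟨Finset.mem_univ _, (slotType_eq_zero_iff hK).2 h1, hP⟩, rfl⟩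

/-- The probability that one step of the peeling process started from `G` leads to degree counts
`z + Δz`. -/
noncomputable def stepMass (G : Graph L n m) (z Δz : State K L ℤ) : ℝ :=
  ∑ G' ∈ univ.filter (fun G' : Graph L n m => degreeCounts K G' = z + Δz), graphKernel G G'

/-- The number of leaves is the constant `ω 1` over the whole ensemble, so averaging over leaves and
over maps can be interchanged without conditioning. -/
lemma stepMass_toGraph (hK : 2 ≤ K) (hω : 1 ≤ ω 1) {φ : Slots δ → Fin m}
    (hφ : φ ∈ classMaps (Slots δ) (Fin m) K ω) (z Δz : State K L ℤ) :
    stepMass (toGraph δ φ) z Δz = (∑ s, if slotType K φ s = 0 then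
      (if degreeCounts K (peel (toGraph δ φ) (φ s)) - z = Δz then (1 : ℝ) else 0) else 0) / ω 1 := by
  have hK1 : 1 ≤ K := by omega
  have hleaf : (leaves (toGraph δ φ)).card = ω 1 := by
    have := card_leaves_filter hK1 φ fun _ => True
    simp only [and_true, Finset.filter_true] at this
    rw [this]
    exact slotCount_zero hK hφ
  have hne : leaves (toGraph δ φ) ≠ ∅ := by
    intro h0
    rw [h0, Finset.card_empty] at hleaf
    omega
  unfold stepMass
  rw [sum_graphKernel hne, hleaf, card_leaves_filter hK1, Finset.card_filter]
  push_cast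
  congr 1
  refine Finset.sum_congr rfl fun s _ => ?_
  simp only [sub_eq_iff_eq_add', ite_and]

/-- The law of the displacement averaged over the graphs with given v-degrees. -/
lemma sum_abs_stepMass_sub_le (h : Profile K M (Fintype.card (Slots δ)) ω l) (hω : 1 ≤ ω 1)
    (hδ : ∀ α, (δ α : ℕ) = 0 ∨ 3 ≤ (δ α : ℕ)) {y : ℝ} (hy : (M : ℝ) / ω K ≤ y)
    {z : State K L ℤ}
    (hz : ∀ φ ∈ classMaps (Slots δ) (Fin m) K ω, degreeCounts K (toGraph δ φ) = z)
    (A : Finset (State K L ℤ)) :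
    ∑ Δz ∈ A, |∑ φ ∈ classMaps (Slots δ) (Fin m) K ω, stepMass (toGraph δ φ) z Δz -
        (classMaps (Slots δ) (Fin m) K ω).card * ((∑ s : Slots δ,
          kernelTerm (fun i => typeMean K M ω l i / Fintype.card (Slots δ))
            ⟨δ s.1, slot_deg_mem hδ s⟩ Δz) / Fintype.card (Slots δ))| ≤
      (classMaps (Slots δ) (Fin m) K ω).card / (Fintype.card (Slots δ) : ℝ) *
        slotConst K L y := by
  set Ψ := classMaps (Slots δ) (Fin m) K ω with hΨ
  set E : ℝ := (Fintype.card (Slots δ) : ℝ) with hE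
  have hE0 : 0 < E := by rw [hE]; exact_mod_cast h.E_pos
  have hω0 : (0 : ℝ) < ω 1 := by exact_mod_cast hω
  set T : Slots δ → State K L ℤ → ℝ := fun s Δz =>
    kernelTerm (fun i => typeMean K M ω l i / E) ⟨δ s.1, slot_deg_mem hδ s⟩ Δz with hT
  set f : Slots δ → State K L ℤ → ℝ := fun s Δz => ∑ φ ∈ Ψ, (if slotType K φ s = 0 then
    (if degreeCounts K (peel (toGraph δ φ) (φ s)) - z = Δz then (1 : ℝ) else 0) else 0) with hf
  have hpt : ∀ Δz, ∑ φ ∈ Ψ, stepMass (toGraph δ φ) z Δz - Ψ.card * ((∑ s, T s Δz) / E) =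
      (∑ s, (f s Δz - ω 1 * Ψ.card / E * T s Δz)) / ω 1 := by
    intro Δz
    rw [Finset.sum_congr rfl fun φ hφ => stepMass_toGraph h.two_le hω hφ z Δz, ← Finset.sum_div,
      Finset.sum_comm, Finset.sum_sub_distrib, ← Finset.mul_sum]
    change (∑ s, f s Δz) / (ω 1 : ℝ) - _ = _
    field_simp
  calc _ = ∑ Δz ∈ A, |(∑ s, (f s Δz - ω 1 * Ψ.card / E * T s Δz)) / ω 1| :=
        Finset.sum_congr rfl fun Δz _ => by rw [← hpt Δz]
    _ ≤ ∑ Δz ∈ A, (∑ s, |f s Δz - ω 1 * Ψ.card / E * T s Δz|) / ω 1 := by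
        refine Finset.sum_le_sum fun Δz _ => ?_
        rw [abs_div, abs_of_pos hω0]
        gcongr
        exact Finset.abs_sum_le_sum_abs _ _
    _ = (∑ s, ∑ Δz ∈ A, |f s Δz - ω 1 * Ψ.card / E * T s Δz|) / ω 1 := by
        rw [← Finset.sum_div, Finset.sum_comm]
    -- There are `E` slots with error of order `ω 1 / E²` each; division by `ω 1` removes it
    -- entirely.
    _ ≤ (∑ _s : Slots δ, ω 1 * Ψ.card / E ^ 2 * slotConst K L y) / ω 1 := by
        gcongr with s _
        exact sum_abs_slot_sub_le h hδ hy hz A s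
    _ = _ := by
        rw [Finset.sum_const, nsmul_eq_mul, Finset.card_univ, ← hE]
        field_simp

end Step

/-! ### The ensemble -/

section Ensemble

variable {K L n m : ℕ}

/-- The c-node counts of a state as natural numbers. -/
def classCount (z : State K L ℤ) (i : ℕ) : ℕ :=
  if h : i ∈ Finset.Icc 1 K then (z.1 ⟨i, h⟩).toNat else 0

/-- The v-degree sequences of the graphs in the ensemble. -/
def goodDegrees (n : ℕ) (z : State K L ℤ) : Finset (Fin n → Fin (L + 1)) :=
  univ.filter fun δ => (∀ α, (δ α : ℕ) = 0 ∨ 3 ≤ (δ α : ℕ)) ∧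
    ∀ j : Finset.Icc 3 L, ((univ.filter fun α => (δ α : ℕ) = j).card : ℤ) = z.2 j

lemma mem_goodDegrees {z : State K L ℤ} {δ : Fin n → Fin (L + 1)} : δ ∈ goodDegrees n z ↔
    (∀ α, (δ α : ℕ) = 0 ∨ 3 ≤ (δ α : ℕ)) ∧
      ∀ j : Finset.Icc 3 L, ((univ.filter fun α => (δ α : ℕ) = j).card : ℤ) = z.2 j := by
  simp [goodDegrees]

lemma toGraph_mem_ensemble {z : State K L ℤ} (hz : ∀ i, 0 ≤ z.1 i) {δ : Fin n → Fin (L + 1)}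
    {φ : Slots δ → Fin m} : toGraph δ φ ∈ ensemble n m z ↔
      δ ∈ goodDegrees n z ∧ φ ∈ classMaps (Slots δ) (Fin m) K (classCount z) := by
  have h1 : (degreeCounts K (toGraph δ φ)).1 = z.1 ↔
      φ ∈ classMaps (Slots δ) (Fin m) K (classCount z) := by
    rw [mem_classMaps, funext_iff, Subtype.forall]
    refine forall₂_congr fun i hi => ?_
    rw [degreeCounts_fst]
    simp only [cDeg_toGraph, classCount, dif_pos hi]
    have := hz ⟨i, hi⟩
    omega
  have h2 : (degreeCounts K (toGraph δ φ)).2 = z.2 ↔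
      ∀ j : Finset.Icc 3 L, ((univ.filter fun α => (δ α : ℕ) = j).card : ℤ) = z.2 j := funext_iff
  unfold ensemble
  rw [Finset.mem_filter, mem_goodDegrees, Prod.ext_iff, h1, h2]
  simp only [Finset.mem_univ, true_and]
  change (∀ α, (δ α : ℕ) = 0 ∨ 3 ≤ (δ α : ℕ)) ∧ _ ↔ _
  tauto

lemma sum_ensemble {z : State K L ℤ} (hz : ∀ i, 0 ≤ z.1 i) (f : Graph L n m → ℝ) :
    ∑ G ∈ ensemble n m z, f G = ∑ δ ∈ goodDegrees n z,
      ∑ φ ∈ classMaps (Slots δ) (Fin m) K (classCount z), f (toGraph δ φ) := by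
  have h1 : ∑ G ∈ ensemble n m z, f G = ∑ G, if G ∈ ensemble n m z then f G else 0 := by
    rw [Finset.sum_ite_mem, Finset.univ_inter]
  rw [h1, sum_graph, ← Finset.univ_inter (goodDegrees n z), ← Finset.sum_ite_mem]
  refine Finset.sum_congr rfl fun δ _ => ?_
  by_cases hδ : δ ∈ goodDegrees n z
  · rw [if_pos hδ, ← Finset.univ_inter (classMaps _ _ _ _), ← Finset.sum_ite_mem]
    refine Finset.sum_congr rfl fun φ _ => ?_
    simp only [toGraph_mem_ensemble hz, hδ, true_and]
  · rw [if_neg hδ]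
    refine Finset.sum_eq_zero fun φ _ => ?_
    rw [if_neg fun h => hδ ((toGraph_mem_ensemble hz).1 h).1]

/-- A v-node of degree `j` owns `j` slots, so a uniform slot sees the size-biased v-degree. This is
the factor `ℓ v_ℓ / d(v)` of the kernel. -/
lemma sum_slots {z : State K L ℤ} {δ : Fin n → Fin (L + 1)} (hδ : δ ∈ goodDegrees n z)
    (f : Finset.Icc 3 L → ℝ) :
    ∑ s : Slots δ, f ⟨δ s.1, slot_deg_mem (mem_goodDegrees.1 hδ).1 s⟩ =
      ∑ j : Finset.Icc 3 L, (j : ℕ) * (z.2 j : ℝ) * f j := by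
  obtain ⟨h1, h2⟩ := mem_goodDegrees.1 hδ
  set g : ℕ → ℝ := fun j => if h : j ∈ Finset.Icc 3 L then f ⟨j, h⟩ else 0 with hg
  have hfg : ∀ j : Finset.Icc 3 L, f j = g j := fun j => by simp only [hg]; rw [dif_pos j.2]
  have hR : ∀ j : Finset.Icc 3 L, (j : ℕ) * (z.2 j : ℝ) * f j =
      ∑ α, if (δ α : ℕ) = (j : ℕ) then ((δ α : ℕ) : ℝ) * g (δ α) else 0 := by
    intro j
    rw [← h2 j, Finset.card_filter, hfg j]
    push_cast
    rw [Finset.mul_sum, Finset.sum_mul]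
    refine Finset.sum_congr rfl fun α _ => ?_
    split_ifs with h
    · rw [h]; ring
    · ring
  rw [Finset.sum_congr rfl fun j _ => hR j, Finset.sum_comm, Finset.sum_congr rfl fun s _ => hfg _,
    Fintype.sum_sigma]
  refine Finset.sum_congr rfl fun α _ => ?_
  simp only [Finset.sum_const, Finset.card_univ, Fintype.card_fin, nsmul_eq_mul]
  rcases h1 α with h0 | h3
  · rw [h0]; simp
  · have hmem : (δ α : ℕ) ∈ Finset.Icc 3 L :=
      Finset.mem_Icc.2 ⟨h3, by have := (δ α).2; omega⟩
    rw [Finset.sum_eq_single ⟨(δ α : ℕ), hmem⟩]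
    · rw [if_pos rfl]
    · intro j _ hj
      rw [if_neg]
      intro h
      exact hj (Subtype.ext h.symm)
    · intro h
      exact absurd (Finset.mem_univ _) h

/-- A function with prescribed fibre sizes. -/
lemma exists_card_fiber_eq {ι : Type*} [Fintype ι] [DecidableEq ι] {N : ℕ} (q : ι → ℕ)
    (hq : ∑ i, q i ≤ N) :
    ∃ f : Fin N → Option ι, ∀ i, (univ.filter fun a => f a = some i).card = q i := by
  obtain ⟨e⟩ : Nonempty ((Σ i, Fin (q i)) ↪ Fin N) :=
    Function.Embedding.nonempty_of_card_le (by simpa using hq)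
  refine ⟨Function.extend e (fun s => some s.1) fun _ => none, fun i => ?_⟩
  have : (univ.filter fun a => Function.extend e (fun s => some s.1) (fun _ => none) a = some i) =
      univ.image fun k : Fin (q i) => e ⟨i, k⟩ := by
    ext a
    simp only [Finset.mem_filter, Finset.mem_univ, true_and, Finset.mem_image]
    constructor
    · intro h
      by_cases ha : ∃ s, e s = a
      · obtain ⟨⟨i', k⟩, rfl⟩ := ha
        rw [e.injective.extend_apply] at h
        obtain rfl : i' = i := by simpa using h
        exact ⟨k, rfl⟩
      · rw [Function.extend_apply' _ _ _ ha] at h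
        exact absurd h (by simp)
    · rintro ⟨k, rfl⟩
      rw [e.injective.extend_apply]
  rw [this, Finset.card_image_of_injective, Finset.card_univ, Fintype.card_fin]
  intro k k' h
  simpa using e.injective h

lemma goodDegrees_nonempty {z : State K L ℤ} (hz : ∀ j, 0 ≤ z.2 j) (hn : ∑ j, z.2 j ≤ n) :
    (goodDegrees n z).Nonempty := by
  obtain ⟨f, hf⟩ := exists_card_fiber_eq (N := n) (fun j => (z.2 j).toNat) (by
    zify
    rw [Finset.sum_congr rfl fun j _ => Int.toNat_of_nonneg (hz j)]
    exact hn)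
  set d : Option (Finset.Icc 3 L) → Fin (L + 1) := fun o =>
    o.elim 0 fun j => ⟨j, Nat.lt_succ_of_le (Finset.mem_Icc.1 j.2).2⟩ with hd
  have hd' : ∀ o, ((d o : ℕ) = 0 ∧ o = none) ∨ ∃ j, o = some j ∧ (d o : ℕ) = j := by
    intro o
    cases o with
    | none => exact Or.inl ⟨rfl, rfl⟩
    | some j => exact Or.inr ⟨j, rfl, rfl⟩
  refine ⟨fun α => d (f α), mem_goodDegrees.2 ⟨fun α => ?_, fun j => ?_⟩⟩
  · rcases hd' (f α) with h | ⟨j, -, hj⟩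
    · exact Or.inl h.1
    · exact Or.inr (hj ▸ (Finset.mem_Icc.1 j.2).1)
  · have : (univ.filter fun α => (d (f α) : ℕ) = j) = univ.filter fun α => f α = some j := by
      ext α
      simp only [Finset.mem_filter, Finset.mem_univ, true_and]
      have h3 := (Finset.mem_Icc.1 j.2).1
      rcases hd' (f α) with h | ⟨j', hj, hj'⟩
      · rw [h.1, h.2]
        simp only [reduceCtorEq, iff_false]
        omega
      · rw [hj', hj, Option.some_inj, Subtype.ext_iff]
    rw [this, hf, Int.toNat_of_nonneg (hz j)]

/-- The bound on `m` leaves room for c-nodes in the required classes; slots can then be attached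
because `M` exceeds `K` times the number of heavy c-nodes. -/
lemma classMaps_nonempty {M : ℕ} {l : ℝ} {z : State K L ℤ} {δ : Fin n → Fin (L + 1)}
    (h : Profile K M (Fintype.card (Slots δ)) (classCount z) l) (hz : ∀ i, 0 ≤ z.1 i)
    (hm : ∑ i, z.1 i ≤ m) : (classMaps (Slots δ) (Fin m) K (classCount z)).Nonempty := by
  have hK := h.two_le
  obtain ⟨f, hf⟩ := exists_card_fiber_eq (N := m) (fun i => (z.1 i).toNat) (by
    zify
    rw [Finset.sum_congr rfl fun j _ => Int.toNat_of_nonneg (hz j)]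
    exact hm)
  set κ : Fin m → ℕ := fun a => (f a).elim 0 fun i => (i : ℕ) with hκdef
  have hκ' : ∀ a, (κ a = 0 ∧ f a = none) ∨ ∃ i, f a = some i ∧ κ a = i := by
    intro a
    simp only [hκdef]
    cases f a with
    | none => exact Or.inl ⟨rfl, rfl⟩
    | some i => exact Or.inr ⟨i, rfl, rfl⟩
  have hκ : ∀ a, κ a ≤ K := by
    intro a
    rcases hκ' a with h | ⟨i, -, hi⟩
    · omega
    · exact hi ▸ (Finset.mem_Icc.1 i.2).2
  have hω : ∀ i ∈ Icc 1 K, (univ.filter fun a => κ a = i).card = classCount z i := by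
    intro i hi
    rw [classCount, dif_pos hi, ← hf ⟨i, hi⟩]
    congr 1
    ext a
    simp only [Finset.mem_filter, Finset.mem_univ, true_and]
    have h3 := (Finset.mem_Icc.1 hi).1
    rcases hκ' a with h | ⟨i', hj, hj'⟩
    · rw [h.1, h.2]
      simp only [reduceCtorEq, iff_false]
      omega
    · rw [hj', hj, Option.some_inj, Subtype.ext_iff]
  have hheavy : (heavy K κ).card = classCount z K := hω K (Finset.mem_Icc.2 ⟨by omega, le_rfl⟩)
  have hcard := card_classFiber (S := Slots δ) (M := M) hκ
    (by rw [sum_heavy_compl hκ hω]; exact h.sum_eq)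
  have hpos : (0 : ℝ) < (classFiber (Slots δ) K κ).card := by
    rw [hcard, hheavy]
    exact mul_pos (fiberConst_pos K κ) (tpc_pos h.one_le h.lt.le)
  obtain ⟨φ, hφ⟩ := Finset.card_pos.1 (Nat.cast_pos.1 hpos)
  refine ⟨φ, mem_classMaps.2 fun i hi => ?_⟩
  rw [← hω i hi]
  congr 1
  ext a
  rw [Finset.mem_filter, Finset.mem_filter, mem_classFiber.1 hφ a]

end Ensemble

/-! ### Rescaled states -/

section Rescale

variable {K L n m : ℕ} {ε : ℝ} {z : State K L ℤ}

lemma nonneg_of_rescale_mem (hn : 0 < n) (hx : rescale n z ∈ domainH K L ε) :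
    (∀ i, 0 ≤ z.1 i) ∧ ∀ j, 0 ≤ z.2 j := by
  have hn' : (0 : ℝ) < n := by exact_mod_cast hn
  have key : ∀ a : ℤ, 0 ≤ (a : ℝ) / n → 0 ≤ a := by
    intro a h
    rw [le_div_iff₀ hn', zero_mul] at h
    exact_mod_cast h
  exact ⟨fun i => key _ (hx.1 i), fun j => key _ (hx.2.1 j)⟩

lemma sum_snd_le_of_rescale_mem (hn : 0 < n) (hx : rescale n z ∈ domainH K L ε) :
    ∑ j, z.2 j ≤ n := by
  have hn' : (0 : ℝ) < n := by exact_mod_cast hn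
  have h := hx.2.2.2.1
  simp only [rescale] at h
  rw [← Finset.sum_div, div_le_one hn'] at h
  exact_mod_cast h

lemma classCount_eq (hn : 0 < n) (hz : ∀ i, 0 ≤ z.1 i) (i : ℕ) :
    (classCount z i : ℝ) = n * coord (rescale n z).1 i := by
  have hn' : (n : ℝ) ≠ 0 := by positivity
  unfold classCount coord
  split_ifs with h
  · simp only [rescale]
    rw [mul_div_cancel₀ _ hn', ← Int.cast_natCast, Int.toNat_of_nonneg (hz _)]
  · simp

lemma card_slots_eq (hn : 0 < n) {δ : Fin n → Fin (L + 1)} (hδ : δ ∈ goodDegrees n z) :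
    (Fintype.card (Slots δ) : ℝ) = n * totalDeg (rescale n z).2 := by
  have hn' : (n : ℝ) ≠ 0 := by positivity
  have h := sum_slots hδ fun _ => 1
  rw [Finset.sum_const, nsmul_eq_mul, Finset.card_univ, mul_one] at h
  rw [h, totalDeg, Finset.mul_sum]
  refine Finset.sum_congr rfl fun j _ => ?_
  simp only [rescale]
  field_simp

/-- This bounds the argument `y` of all the constants by a quantity depending only on `L` and `ε`.
-/
lemma heavyMean_le (hε : 0 < ε) {x : State K L ℝ} (hx : x ∈ domainH K L ε) :
    heavyMean x ≤ L / ε := by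
  have h1 : totalDeg x.2 ≤ L := by
    calc totalDeg x.2 ≤ ∑ j : Finset.Icc 3 L, (L : ℝ) * x.2 j := by
          refine Finset.sum_le_sum fun j _ => ?_
          have : ((j : ℕ) : ℝ) ≤ L := by exact_mod_cast (Finset.mem_Icc.1 j.2).2
          exact mul_le_mul_of_nonneg_right this (hx.2.1 j)
      _ = L * ∑ j, x.2 j := by rw [Finset.mul_sum]
      _ ≤ L * 1 := by gcongr; exact hx.2.2.2.1
      _ = L := mul_one _
  have h2 : 0 ≤ ∑ i ∈ Finset.Ico 1 K, (i : ℝ) * coord x.1 i :=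
    Finset.sum_nonneg fun i _ => mul_nonneg (Nat.cast_nonneg _) (coord_nonneg hx.1 i)
  unfold heavyMean
  exact div_le_div₀ (Nat.cast_nonneg L) (by linarith) hε hx.2.2.1

/-- The profile of a state in the domain. -/
lemma exists_profile (hK : 2 ≤ K) (hε : 0 < ε) (hn : 0 < n) (hx : rescale n z ∈ domainH K L ε)
    {E : ℕ} (hE : (E : ℝ) = n * totalDeg (rescale n z).2) :
    ∃ M : ℕ, Profile K M E (classCount z) (lam (rescale n z)) ∧
      (M : ℝ) / classCount z K = heavyMean (rescale n z) := by
  have hK1 : 1 ≤ K := by omega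
  have hn' : (0 : ℝ) < n := by exact_mod_cast hn
  obtain ⟨hz1, -⟩ := nonneg_of_rescale_mem hn hx
  set x := rescale n z with hxdef
  have hω : ∀ i, (classCount z i : ℝ) = n * coord x.1 i := classCount_eq hn hz1
  have hcK : 0 < coord x.1 K := coord_pos_of_mem hε hx
  have hωK : (0 : ℝ) < classCount z K := by rw [hω]; positivity
  have hS : ((∑ i ∈ Finset.Ico 1 K, i * classCount z i : ℕ) : ℝ) =
      n * ∑ i ∈ Finset.Ico 1 K, (i : ℝ) * coord x.1 i := by
    push_cast
    rw [Finset.mul_sum]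
    exact Finset.sum_congr rfl fun i _ => by rw [hω]; ring
  have hlt := lt_heavyMean hK1 hε hx
  unfold heavyMean at hlt
  rw [lt_div_iff₀ hcK] at hlt
  have hltR : ((K * classCount z K + ∑ i ∈ Finset.Ico 1 K, i * classCount z i : ℕ) : ℝ) <
      (E : ℝ) := by
    rw [Nat.cast_add, hS, Nat.cast_mul, hω, hE]
    nlinarith
  have hltN := Nat.cast_lt.1 hltR
  obtain ⟨M, hM⟩ : ∃ M, M + ∑ i ∈ Finset.Ico 1 K, i * classCount z i = E :=
    ⟨E - ∑ i ∈ Finset.Ico 1 K, i * classCount z i, by omega⟩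
  have hMR : (M : ℝ) = n * (totalDeg x.2 - ∑ i ∈ Finset.Ico 1 K, (i : ℝ) * coord x.1 i) := by
    have : (M : ℝ) + ((∑ i ∈ Finset.Ico 1 K, i * classCount z i : ℕ) : ℝ) = E := by
      exact_mod_cast hM
    rw [hS, hE] at this
    linarith
  have hmean : (M : ℝ) / classCount z K = heavyMean x := by
    rw [hMR, hω, heavyMean, mul_div_mul_left _ _ hn'.ne']
  refine ⟨M, ⟨hK, by exact_mod_cast hωK, by omega, hM, (lam_spec hK1 hε hx).1, ?_⟩, hmean⟩
  rw [hmean, (lam_spec hK1 hε hx).2]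

/-- The predicted type frequencies at finite `n` are exactly the `𝔭_i` at the rescaled state, so
rescaling introduces no error of its own. -/
lemma typeMean_div_eq_pp (hK : 2 ≤ K) (hε : 0 < ε) (hn : 0 < n)
    (hx : rescale n z ∈ domainH K L ε) {M E : ℕ} (hE : (E : ℝ) = n * totalDeg (rescale n z).2)
    (hM : (M : ℝ) / classCount z K = heavyMean (rescale n z)) {i : ℕ} (hi : i ≤ K) :
    typeMean K M (classCount z) (lam (rescale n z)) i / E = pp (rescale n z) i := by
  have hK1 : 1 ≤ K := by omega
  have hn' : (n : ℝ) ≠ 0 := by positivity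
  have hω := classCount_eq hn (nonneg_of_rescale_mem hn hx).1
  have hcK := coord_pos_of_mem hε hx
  have hd := hε.trans_le (totalDeg_ge_of_mem hx)
  have hωK : (classCount z K : ℝ) ≠ 0 := by rw [hω]; positivity
  rw [div_eq_iff hωK, hω] at hM
  unfold typeMean
  rw [hE]
  split_ifs with h1 h2
  · unfold pp
    rw [if_pos h1, hω]
    field_simp
  · obtain rfl : i = K - 1 := by omega
    rw [pp_pred hK1 hε hx, hM, hω]
    field_simp
  · obtain rfl : i = K := by omega
    rw [pp_top, hω]
    field_simp

lemma kernelTerm_congr {p p' : ℕ → ℝ} (h : ∀ i ≤ K, p i = p' i) (ℓ : Finset.Icc 3 L)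
    (Δz : State K L ℤ) : kernelTerm p ℓ Δz = kernelTerm p' ℓ Δz := by
  unfold kernelTerm
  congr 2
  refine Finset.prod_congr rfl fun i hi => ?_
  rw [h i (by have := Finset.mem_range.1 hi; omega)]

lemma sum_slots_kernelTerm (hn : 0 < n) {δ : Fin n → Fin (L + 1)} (hδ : δ ∈ goodDegrees n z)
    {p : ℕ → ℝ} (hp : ∀ i ≤ K, p i = pp (rescale n z) i) (Δz : State K L ℤ) :
    (∑ s : Slots δ, kernelTerm p ⟨δ s.1, slot_deg_mem (mem_goodDegrees.1 hδ).1 s⟩ Δz) /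
      Fintype.card (Slots δ) = asymKernel (rescale n z) Δz := by
  have hn' : (n : ℝ) ≠ 0 := by positivity
  rw [sum_slots hδ fun ℓ => kernelTerm p ℓ Δz, asymKernel_eq, card_slots_eq hn hδ, Finset.sum_div]
  refine Finset.sum_congr rfl fun ℓ _ => ?_
  rw [kernelTerm_congr hp]
  simp only [rescale]
  rw [← mul_div_assoc ((ℓ : ℕ) : ℝ), div_div, div_mul_eq_mul_div]

lemma exactKernel_eq (Δz : State K L ℤ) : exactKernel n m z Δz =
    (∑ G ∈ ensemble n m z, stepMass G z Δz) / (ensemble n m z).card := rfl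

/-- The exact and the asymptotic kernel are close in `ℓ¹` on every finite set. -/
lemma sum_abs_exactKernel_sub_le (hK : 2 ≤ K) (hε : 0 < ε) (hn : 0 < n)
    (hx : rescale n z ∈ domainH K L ε) (hz : ∀ i, 1 ≤ z.1 i) (hm : ∑ i, z.1 i ≤ (m : ℤ))
    (A : Finset (State K L ℤ)) :
    ∑ Δz ∈ A, |exactKernel n m z Δz - asymKernel (rescale n z) Δz| ≤
      slotConst K L (L / ε) / (n * totalDeg (rescale n z).2) := by
  have hn' : (0 : ℝ) < n := by exact_mod_cast hn
  obtain ⟨hz1, hz2⟩ := nonneg_of_rescale_mem hn hx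
  set x := rescale n z with hxdef
  set ω := classCount z with hωdef
  set Ψ : (δ : Fin n → Fin (L + 1)) → Finset (Slots δ → Fin m) := fun δ =>
    classMaps (Slots δ) (Fin m) K ω with hΨ
  set N : ℝ := ((ensemble n m z).card : ℝ) with hN
  have hω1 : 1 ≤ ω 1 := by
    have h1 : (1 : ℕ) ∈ Finset.Icc 1 K := Finset.mem_Icc.2 ⟨le_rfl, by omega⟩
    have := hz ⟨1, h1⟩
    rw [hωdef, classCount, dif_pos h1]
    omega
  have hNsum : N = ∑ δ ∈ goodDegrees n z, ((Ψ δ).card : ℝ) := by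
    have := sum_ensemble (n := n) (m := m) hz1 fun _ => 1
    simpa using this
  -- Nonemptiness is essential: over an empty ensemble the quotient defining `exactKernel` would be
  -- `0`, far from a probability law.
  have hN0 : 0 < N := by
    obtain ⟨δ, hδ⟩ := goodDegrees_nonempty hz2 (sum_snd_le_of_rescale_mem hn hx)
    obtain ⟨M, hM, -⟩ := exists_profile hK hε hn hx (card_slots_eq hn hδ)
    obtain ⟨φ, hφ⟩ := classMaps_nonempty (m := m) hM hz1 hm
    rw [hN, Nat.cast_pos, Finset.card_pos]
    exact ⟨_, (toGraph_mem_ensemble hz1).2 ⟨hδ, hφ⟩⟩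
  have hpt : ∀ Δz, exactKernel n m z Δz - asymKernel x Δz =
      (∑ δ ∈ goodDegrees n z, (∑ φ ∈ Ψ δ, stepMass (toGraph δ φ) z Δz -
        (Ψ δ).card * asymKernel x Δz)) / N := by
    intro Δz
    rw [exactKernel_eq, sum_ensemble hz1, Finset.sum_sub_distrib, ← Finset.sum_mul, ← hNsum,
      sub_div, mul_div_cancel_left₀ _ hN0.ne']
  -- The number of slots and the limit kernel are the same for every admissible degree sequence, so
  -- the estimates average over `δ` with weights `|Ψ δ| / N`.
  have hper : ∀ δ ∈ goodDegrees n z, ∑ Δz ∈ A, |∑ φ ∈ Ψ δ, stepMass (toGraph δ φ) z Δz -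
      (Ψ δ).card * asymKernel x Δz| ≤
        (Ψ δ).card / (n * totalDeg x.2) * slotConst K L (L / ε) := by
    intro δ hδ
    have hE := card_slots_eq hn hδ
    obtain ⟨M, hM, hmean⟩ := exists_profile hK hε hn hx hE
    have h1 := sum_abs_stepMass_sub_le (m := m) hM hω1 (mem_goodDegrees.1 hδ).1
      (hmean.le.trans (heavyMean_le hε hx)) (z := z)
      (fun φ hφ => (Finset.mem_filter.1 ((toGraph_mem_ensemble hz1).2 ⟨hδ, hφ⟩)).2.2) A
    simp only [sum_slots_kernelTerm hn hδ
      (fun i hi => typeMean_div_eq_pp hK hε hn hx hE hmean hi)] at h1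
    rw [hE] at h1
    exact h1
  calc _ = ∑ Δz ∈ A, |(∑ δ ∈ goodDegrees n z, (∑ φ ∈ Ψ δ, stepMass (toGraph δ φ) z Δz -
        (Ψ δ).card * asymKernel x Δz)) / N| := Finset.sum_congr rfl fun Δz _ => by rw [hpt]
    _ ≤ ∑ Δz ∈ A, (∑ δ ∈ goodDegrees n z, |∑ φ ∈ Ψ δ, stepMass (toGraph δ φ) z Δz -
        (Ψ δ).card * asymKernel x Δz|) / N := by
        refine Finset.sum_le_sum fun Δz _ => ?_
        rw [abs_div, abs_of_pos hN0]
        gcongr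
        exact Finset.abs_sum_le_sum_abs _ _
    _ = (∑ δ ∈ goodDegrees n z, ∑ Δz ∈ A, |∑ φ ∈ Ψ δ, stepMass (toGraph δ φ) z Δz -
        (Ψ δ).card * asymKernel x Δz|) / N := by
        rw [← Finset.sum_div, Finset.sum_comm]
    _ ≤ (∑ δ ∈ goodDegrees n z,
          (Ψ δ).card / (n * totalDeg x.2) * slotConst K L (L / ε)) / N := by
        gcongr with δ hδ
        exact hper δ hδ
    _ = _ := by
        rw [← Finset.sum_mul, ← Finset.sum_div, ← hNsum]
        field_simp

lemma slotConst_nonneg {y : ℝ} (hy : 0 ≤ y) : 0 ≤ slotConst K L y := by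
  unfold slotConst typeConst
  have := (ratioConst_mono (K := K) hy le_rfl).1
  positivity

/-- An infinite sum in `ENNReal` is the supremum of its finite partial sums, so bounds over finite
sets suffice. The factor `1/2` is given away. -/
lemma tvDist_le_of_sum_le {S : Type} {f g : S → ℝ} {c : ℝ}
    (h : ∀ A : Finset S, ∑ s ∈ A, |f s - g s| ≤ c) : tvDist f g ≤ ENNReal.ofReal c := by
  have h1 : ∑' s, ENNReal.ofReal |f s - g s| ≤ ENNReal.ofReal c := by
    refine ENNReal.summable.tsum_le_of_sum_le fun A => ?_
    rw [← ENNReal.ofReal_sum_of_nonneg fun s _ => abs_nonneg _]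
    exact ENNReal.ofReal_le_ofReal (h A)
  unfold tvDist
  calc _ ≤ 1 * ENNReal.ofReal c := by
        gcongr
        exact ENNReal.inv_le_one.2 one_le_two
    _ = _ := one_mul _

end Rescale

end Peeling

theorem mainTheorem3 (K L : ℕ) (hK : 2 ≤ K) (hL : 3 ≤ L) (ε : ℝ) (hε0 : 0 < ε) (hε1 : ε < 1) :
    (∀ x ∈ Peeling.domainH K L ε,
      (∃! l : ℝ, Peeling.IsLambda x l) ∧
      (∀ Δz : Peeling.State K L ℤ, 0 ≤ Peeling.asymKernel x Δz) ∧
      HasSum (fun Δz : Peeling.State K L ℤ => Peeling.asymKernel x Δz) 1) ∧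
    ∃ k₂ : ℝ, 0 < k₂ ∧ ∀ (n m : ℕ) (z : Peeling.State K L ℤ), 0 < n →
      Peeling.rescale n z ∈ Peeling.domainH K L ε →
      (∀ i, 1 ≤ z.1 i) →
      ∑ i, z.1 i ≤ (m : ℤ) →
      Peeling.tvDist (Peeling.exactKernel n m z) (Peeling.asymKernel (Peeling.rescale n z)) ≤
        ENNReal.ofReal (k₂ * (n : ℝ)⁻¹) := by
  have hK1 : 1 ≤ K := by omega
  have hC : 0 ≤ Peeling.slotConst K L (L / ε) := Peeling.slotConst_nonneg (by positivity)
  refine ⟨fun x hx => ⟨Peeling.existsUnique_isLambda hK1 hε0 hx,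
    Peeling.asymKernel_nonneg hK1 hε0 hx, Peeling.hasSum_asymKernel hK1 hε0 hx⟩,
    -- The division by `ε` comes from `E = n d ≥ n ε`; adding `1` only ensures positivity.
    Peeling.slotConst K L (L / ε) / ε + 1, by positivity, fun n m z hn hx hz hm => ?_⟩
  refine Peeling.tvDist_le_of_sum_le fun A => ?_
  have hn' : (0 : ℝ) < n := by exact_mod_cast hn
  have hd := Peeling.totalDeg_ge_of_mem hx
  calc _ ≤ Peeling.slotConst K L (L / ε) / (n * Peeling.totalDeg (Peeling.rescale n z).2) :=
        Peeling.sum_abs_exactKernel_sub_le hK hε0 hn hx hz hm A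
    _ ≤ Peeling.slotConst K L (L / ε) / (n * ε) := by gcongr
    _ = Peeling.slotConst K L (L / ε) / ε * (n : ℝ)⁻¹ := by field_simp
    _ ≤ (Peeling.slotConst K L (L / ε) / ε + 1) * (n : ℝ)⁻¹ := by
        gcongr
        linarith
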